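/- **Definitions.** Let $B_n$ be the braid group on $n$ strands, $A\mapsto\overline{A}$ the map to the symmetric group $\Sigma_n$ (starting position $\mapsto$ final position; in a product $AC$ the braid $C$ comes first), and let $A\circ_i C$ be the braid obtained from $A$ by replacing the strand that ends in position $i$ by the braid $C$. Let $\Omega(n)$ be the set of parenthesized words in which each of $x_1,\dots,x_n$ occurs exactly once and a letter $x_0$ (standing for the unit) occurs any number of times; these words form the symmetric operad freely generated by one binary operation and one nullary operation. The *weak braiding operad* $\mathrm{wPaB}$ is the following symmetric operad in groupoids. Objects of $\mathrm{wPaB}(n)$ are pairs $(p,A)$ of a word $p\in\Omega(n)$ and a braid $A$ on all letters of $p$ (including the $x_0$). Let $\tau(p)\in\Sigma_n$ be the order of the letters $x_1,\dots,x_n$ in $p$, and $\widetilde A\in B_n$ the braid obtained from $A$ by deleting the strands that end at a letter $x_0$. A morphism $(p,A)\to(q,C)$ is the braid $\widetilde C\widetilde A^{-1}$ if $\overline{\widetilde C\widetilde A^{-1}}=\tau(q)^{-1}\tau(p)$; otherwise there is none. The symmetric groups relabel the letters, and composition is $(p,A)\circ_i(q,C)=(p\circ_i q,\,A\circ_{j}C)$,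 where $j$ is the place of $x_i$ in $p$; on morphisms it is the partial composition of braids. A category $\mathcal D$ is *weak-braided* if it is an algebra over this operad, i.e. if there is a morphism of symmetric operads $\phi:\mathrm{wPaB}\to\mathrm{End}_{\mathcal D}$, $\mathrm{End}_{\mathcal D}(n)=\mathrm{Fun}(\mathcal D^{n},\mathcal D)$. For a monoidal category $\mathcal D$ and a word $p$, let $p_{\mathcal D}:\mathcal D^n\to\mathcal D$ be the iterated tensor product prescribed by $p$, with the unit $\mathbb 1$ for each $x_0$. **Theorem.** Let $G$ be a group and let $\mathcal D$ be a braided $G$-crossed fusion category with additive structure functors: a fusion category with a grading $\mathcal D=\bigoplus_{g\in G}\mathcal D^g$, an action of $G$ by additive monoidal functors $F_g$ with $F_g(\mathcal D^h)\subseteq\mathcal D^{ghg^{-1}}$, and a $G$-braiding $X\otimes Y\cong F_g(Y)\otimes X$ for $X\in\mathcal D^g$, $Y\in\mathcal D$, which satisfies the usual compatibility with the action and the two hexagon axioms. Then $\mathcal D$ is weak-braided. More precisely, there is a morphism of symmetric operads $\phi:\mathrm{wPaB}\to\mathrm{End}_{\mathcal D}$ such that 1. $\phi(p,1)=p_{\mathcal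 D}$ for every word $p$, and the morphisms $((x_1x_2)x_3,1)\to(x_1(x_2x_3),1)$, $(x_0x_1,1)\to(x_1,1)$ and $(x_1x_0,1)\to(x_1,1)$ act as the associator and the unitors of $\mathcal D$; 2. every functor $\phi(p,A):\mathcal D^n\to\mathcal D$ is additive in each variable; 3. braids act through the twisting functors: for every $(p,A)\in\mathrm{wPaB}(n)$ and $g_1,\dots,g_n\in G$ there are $a_1,\dots,a_n\in G$, depending only on $(p,A)$ and $g_1,\dots,g_n$, and isomorphisms $\theta:\phi(p,A)(X_1,\dots,X_n)\cong p_{\mathcal D}(F_{a_1}X_1,\dots,F_{a_n}X_n)$, natural in $X_i\in\mathcal D^{g_i}$, with the following property. Let $p'$ be the word obtained from $p$ by permuting its letters so that $A$ leads from the letters of $p'$ to the letters of $p$. Write $A$ in any way as a product of the standard generators and their inverses, and let each generator act by the $G$-braiding of the two strands that it crosses (rebracketing when necessary, and using the structure isomorphisms $F_gF_h\cong F_{gh}$, $F_1\cong\mathrm{id}$, $F_g(\mathbb 1)\cong\mathbb 1$). The resulting morphism leads from $p'_{\mathcal D}(X_1,\dots,X_n)$ to $p_{\mathcal D}(F_{a_1}X_1,\dots,F_{a_n}X_n)$,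 does not depend on the chosen product, and equals $\theta\circ\phi(m)$, where $m:(p',1)\to(p,A)$ is the unique morphism of $\mathrm{wPaB}(n)$. -/

import Mathlib

open CategoryTheory

universe w w' v u

namespace WeakBraid

/-- Artin's relations on the generators `σ_0, …, σ_{n-2}`. -/
def braidRels (n : ℕ) : Set (FreeGroup (Fin (n - 1))) :=
  {r | ∃ i j : Fin (n - 1), (i : ℕ) + 1 = j ∧
      r = (.of i * .of j * .of i) * (.of j * .of i * .of j)⁻¹} ∪
  {r | ∃ i j : Fin (n - 1), (i : ℕ) + 2 ≤ j ∧
      r = (.of i * .of j) * (.of j * .of i)⁻¹}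

/-- The braid group on `n` strands. -/
abbrev BraidGroup (n : ℕ) : Type := PresentedGroup (braidRels n)

/-- The generator crossing the strands in positions `j` and `j + 1` (and `1` if there are no such
strands). -/
def sig (n j : ℕ) : BraidGroup n :=
  if h : j < n - 1 then PresentedGroup.of ⟨j, h⟩ else 1

theorem sig_braid {n i : ℕ} (h : i + 2 < n) :
    sig n i * sig n (i + 1) * sig n i = sig n (i + 1) * sig n i * sig n (i + 1) := by
  have h1 : i < n - 1 := by omega
  have h2 : i + 1 < n - 1 := by omega
  rw [sig, sig, dif_pos h1, dif_pos h2]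
  refine mul_inv_eq_one.1 ?_
  have := PresentedGroup.one_of_mem (rels := braidRels n)
    (Or.inl ⟨⟨i, h1⟩, ⟨i + 1, h2⟩, rfl, rfl⟩)
  simpa [PresentedGroup.of, mul_assoc] using this

theorem sig_comm {n i j : ℕ} (h : i + 2 ≤ j) :
    sig n i * sig n j = sig n j * sig n i := by
  by_cases hj : j < n - 1
  · have hi : i < n - 1 := by omega
    rw [sig, sig, dif_pos hi, dif_pos hj]
    refine mul_inv_eq_one.1 ?_
    have := PresentedGroup.one_of_mem (rels := braidRels n)
      (Or.inr ⟨⟨i, hi⟩, ⟨j, hj⟩, h, rfl⟩)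
    simpa [PresentedGroup.of, mul_assoc] using this
  · have : sig n j = 1 := dif_neg hj
    simp [this]

theorem sig_comm' {n i j : ℕ} (h : i + 2 ≤ j ∨ j + 2 ≤ i) :
    sig n i * sig n j = sig n j * sig n i :=
  h.elim sig_comm fun h => (sig_comm h).symm

/-- A homomorphism out of the braid group from images of the generators. -/
def liftBraid {n : ℕ} {H : Type*} [Group H] (f : ℕ → H)
    (h1 : ∀ i, i + 2 < n → f i * f (i + 1) * f i = f (i + 1) * f i * f (i + 1))
    (h2 : ∀ i j, i + 2 ≤ j → j + 1 < n → f i * f j = f j * f i) : BraidGroup n →* H :=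
  PresentedGroup.toGroup (f := fun j : Fin (n - 1) => f j) (by
    rintro r (⟨i, j, hij, rfl⟩ | ⟨i, j, hij, rfl⟩)
    · have hj := j.2
      have := h1 i (by omega)
      rw [hij] at this
      simp only [map_mul, map_inv, FreeGroup.lift_apply_of]
      rw [this, mul_inv_cancel]
    · have hj := j.2
      have := h2 i j hij (by omega)
      simp only [map_mul, map_inv, FreeGroup.lift_apply_of]
      rw [this, mul_inv_cancel])

theorem swap_braid (i : ℕ) :
    Equiv.swap i (i + 1) * Equiv.swap (i + 1) (i + 1 + 1) * Equiv.swap i (i + 1) =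
      Equiv.swap (i + 1) (i + 1 + 1) * Equiv.swap i (i + 1) * Equiv.swap (i + 1) (i + 1 + 1) := by
  ext x
  simp only [Equiv.Perm.coe_mul, Function.comp_apply, Equiv.swap_apply_def]
  grind

theorem swap_comm {i j : ℕ} (h : i + 2 ≤ j) :
    Equiv.swap i (i + 1) * Equiv.swap j (j + 1) = Equiv.swap j (j + 1) * Equiv.swap i (i + 1) := by
  ext x
  simp only [Equiv.Perm.coe_mul, Function.comp_apply, Equiv.swap_apply_def]
  grind

/-- The transposition of `j` and `j + 1` (and the identity if `j + 1` is out of range). -/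
def adjSwap (n j : ℕ) : Equiv.Perm (Fin n) :=
  if h : j + 1 < n then Equiv.swap ⟨j, by omega⟩ ⟨j + 1, h⟩ else 1

theorem val_adjSwap {n j : ℕ} (h : j + 1 < n) (x : Fin n) :
    (adjSwap n j x : ℕ) = Equiv.swap j (j + 1) (x : ℕ) := by
  rw [adjSwap, dif_pos h, Equiv.swap_apply_def, Equiv.swap_apply_def]
  simp only [Fin.ext_iff]
  split_ifs <;> rfl

/-- The underlying permutation of a braid: position at the start ↦ position at the end. The
product `A * C` is `C` followed by `A`. -/
def perm (n : ℕ) : BraidGroup n →* Equiv.Perm (Fin n) :=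
  liftBraid (adjSwap n)
    (by
      intro i hi
      ext x
      have := congrArg (fun e : Equiv.Perm ℕ => e (x : ℕ)) (swap_braid i)
      simpa [val_adjSwap (show i + 1 < n by omega), val_adjSwap (show i + 1 + 1 < n by omega)]
        using this)
    (by
      intro i j hij hj
      ext x
      have := congrArg (fun e : Equiv.Perm ℕ => e (x : ℕ)) (swap_comm hij)
      simpa [val_adjSwap (show i + 1 < n by omega), val_adjSwap (show j + 1 < n by omega)]
        using this)

/-- The strand in position `o` crosses the next `b` strands. -/
def strandCross (n o : ℕ) : ℕ → BraidGroup n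
  | 0 => 1
  | b + 1 => sig n (o + b) * strandCross n o b

/-- The block of `a` parallel strands starting in position `o` crosses the next `b` strands, all
crossings being positive. -/
def blockCross (n o : ℕ) : ℕ → ℕ → BraidGroup n
  | 0, _ => 1
  | a + 1, b => blockCross n o a b * strandCross n (o + a) b

theorem strandCross_comm {n o b j : ℕ} (h : j + 2 ≤ o ∨ o + b + 1 ≤ j) :
    strandCross n o b * sig n j = sig n j * strandCross n o b := by
  induction b with
  | zero => simp [strandCross]
  | succ b ih =>
    rw [strandCross, mul_assoc, ih (by omega), ← mul_assoc, ← mul_assoc,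
      sig_comm' (show o + b + 2 ≤ j ∨ j + 2 ≤ o + b by omega)]

/-- Sliding a crossing through a strand that passes over it. -/
theorem strandCross_slide {n o b i : ℕ} (hi : i + 1 < b) (hn : o + b < n) :
    strandCross n o b * sig n (o + 1 + i) = sig n (o + i) * strandCross n o b := by
  induction b with
  | zero => omega
  | succ b ih =>
    rw [strandCross]
    rcases Nat.lt_or_ge (i + 1) b with h | h
    · rw [mul_assoc, ih h (by omega), ← mul_assoc, ← mul_assoc,
        sig_comm' (show o + b + 2 ≤ o + i ∨ o + i + 2 ≤ o + b by omega)]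
    · obtain rfl : b = i + 1 := by omega
      rw [strandCross]
      have h1 := strandCross_comm (n := n) (o := o) (b := i) (j := o + 1 + i) (by omega)
      have h2 := sig_braid (n := n) (i := o + i) (by omega)
      have e1 : o + (i + 1) = o + i + 1 := by omega
      have e2 : o + 1 + i = o + i + 1 := by omega
      rw [e2] at h1
      rw [e1, e2]
      simp only [mul_assoc] at h2 ⊢
      rw [h1]
      simp only [← mul_assoc] at h2 ⊢
      rw [h2]

theorem strandCross_pair {n o b : ℕ} (hn : o + 1 + b < n) :
    strandCross n o b * strandCross n (o + 1) b * sig n o =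
      sig n (o + b) * (strandCross n o b * strandCross n (o + 1) b) := by
  induction b with
  | zero => simp [strandCross]
  | succ b ih =>
    have ih := ih (by omega)
    have hc := strandCross_comm (n := n) (o := o) (b := b) (j := o + 1 + b) (by omega)
    have e : o + 1 + b = o + b + 1 := by omega
    have e' : o + (b + 1) = o + b + 1 := by omega
    have h2 := sig_braid (n := n) (i := o + b) (by omega)
    rw [e] at hc
    rw [strandCross, strandCross, e, e']
    calc sig n (o + b) * strandCross n o b * (sig n (o + b + 1) * strandCross n (o + 1) b) * sig n o
        = sig n (o + b) * (strandCross n o b * sig n (o + b + 1)) * strandCross n (o + 1) b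
            * sig n o := by simp only [mul_assoc]
      _ = sig n (o + b) * sig n (o + b + 1) *
            (strandCross n o b * strandCross n (o + 1) b * sig n o) := by
          rw [hc]; simp only [mul_assoc]
      _ = (sig n (o + b) * sig n (o + b + 1) * sig n (o + b)) *
            (strandCross n o b * strandCross n (o + 1) b) := by
          rw [ih]; simp only [mul_assoc]
      _ = sig n (o + b + 1) * sig n (o + b) * (sig n (o + b + 1) * strandCross n o b) *
             strandCross n (o + 1) b := by
          rw [h2]; simp only [mul_assoc]
      _ = _ := by rw [← hc]; simp only [mul_assoc]

theorem blockCross_comm {n o a b j : ℕ} (h : j + 2 ≤ o ∨ o + a + b ≤ j) :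
    blockCross n o a b * sig n j = sig n j * blockCross n o a b := by
  induction a with
  | zero => simp [blockCross]
  | succ a ih =>
    rw [blockCross, mul_assoc, strandCross_comm (by omega), ← mul_assoc, ih (by omega), mul_assoc]

theorem blockCross_add (n o a a' b : ℕ) :
    blockCross n o (a + a') b = blockCross n o a b * blockCross n (o + a) a' b := by
  induction a' with
  | zero => simp [blockCross]
  | succ a' ih => rw [← add_assoc, blockCross, ih, blockCross, mul_assoc, add_assoc]

theorem blockCross_slide_right {n o a b i : ℕ} (hi : i + 1 < b) (hn : o + a + b ≤ n) :
    blockCross n o a b * sig n (o + a + i) = sig n (o + i) * blockCross n o a b := by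
  induction a with
  | zero => simp [blockCross]
  | succ a ih =>
    have := strandCross_slide (n := n) (o := o + a) hi (by omega)
    rw [blockCross, mul_assoc, show o + (a + 1) + i = o + a + 1 + i by omega, this, ← mul_assoc,
      ih (by omega), mul_assoc]

theorem blockCross_slide_left {n o a b i : ℕ} (hi : i + 1 < a) (hn : o + a + b ≤ n) :
    blockCross n o a b * sig n (o + i) = sig n (o + b + i) * blockCross n o a b := by
  obtain ⟨c, rfl⟩ : ∃ c, a = i + 2 + c := ⟨a - (i + 2), by omega⟩
  have h2 := strandCross_pair (n := n) (o := o + i) (b := b) (by omega)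
  have hA : blockCross n o (i + 2) b * sig n (o + i) =
      sig n (o + b + i) * blockCross n o (i + 2) b := by
    rw [blockCross, blockCross]
    have h3 := blockCross_comm (n := n) (o := o) (a := i) (b := b) (j := o + i + b) (by omega)
    rw [show o + (i + 1) = o + i + 1 by omega, show o + b + i = o + i + b by omega]
    rw [mul_assoc (blockCross n o i b), mul_assoc (blockCross n o i b), h2, ← mul_assoc, h3,
      mul_assoc]
  rw [blockCross_add, mul_assoc, blockCross_comm (by omega), ← mul_assoc, hA, mul_assoc]

theorem strandCross_range {n o a c o' d : ℕ} (hn : o + a + c ≤ n) (h1 : o ≤ o')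
    (h2 : o' + d + 1 ≤ o + a) :
    blockCross n o a c * strandCross n o' d = strandCross n (o' + c) d * blockCross n o a c := by
  induction d with
  | zero => simp [strandCross]
  | succ d ih =>
    have := blockCross_slide_left (n := n) (o := o) (a := a) (b := c) (i := o' + d - o)
      (by omega) hn
    rw [show o + (o' + d - o) = o' + d by omega, show o + c + (o' + d - o) = o' + c + d by omega]
      at this
    rw [strandCross, strandCross, ← mul_assoc, this, mul_assoc, ih (by omega), mul_assoc]

theorem blockCross_range {n o a b c : ℕ} (hn : o + a + b + c ≤ n) :
    blockCross n o (a + b) c * blockCross n o a b =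
      blockCross n (o + c) a b * blockCross n o (a + b) c := by
  suffices H : ∀ d, d ≤ a → blockCross n o (a + b) c * blockCross n o d b =
      blockCross n (o + c) d b * blockCross n o (a + b) c from H a le_rfl
  intro d hd
  induction d with
  | zero => simp [blockCross]
  | succ d ih =>
    rw [blockCross, blockCross, ← mul_assoc, ih (by omega), mul_assoc,
      strandCross_range (by omega) (by omega) (by omega), mul_assoc,
      show o + d + c = o + c + d by omega]

/-- The braid relation for blocks. -/
theorem blockCross_braid {n o a b c : ℕ} (hn : o + a + b + c ≤ n) :
    blockCross n o b c * blockCross n (o + b) a c * blockCross n o a b =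
      blockCross n (o + c) a b * blockCross n o a c * blockCross n (o + a) b c := by
  rw [← blockCross_add, add_comm b a, blockCross_range hn, blockCross_add n o a b c, mul_assoc]

theorem strandCross_far {n o b o' b' : ℕ} (h : o + b < o') :
    strandCross n o b * strandCross n o' b' = strandCross n o' b' * strandCross n o b := by
  induction b' with
  | zero => simp [strandCross]
  | succ b' ih =>
    rw [strandCross, ← mul_assoc, strandCross_comm (by omega), mul_assoc, ih, mul_assoc]

theorem blockCross_strandCross_far {n o a b o' b' : ℕ} (h : o + a + b ≤ o') :
    blockCross n o a b * strandCross n o' b' = strandCross n o' b' * blockCross n o a b := by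
  induction b' with
  | zero => simp [strandCross]
  | succ b' ih =>
    rw [strandCross, ← mul_assoc, blockCross_comm (by omega), mul_assoc, ih, mul_assoc]

theorem blockCross_far {n o a b o' a' b' : ℕ} (h : o + a + b ≤ o') :
    blockCross n o a b * blockCross n o' a' b' = blockCross n o' a' b' * blockCross n o a b := by
  induction a' with
  | zero => simp [blockCross]
  | succ a' ih =>
    rw [blockCross, ← mul_assoc, ih, mul_assoc, blockCross_strandCross_far (by omega), mul_assoc]

open Finset in
theorem sum_swap {L j : ℕ} (k : ℕ → ℕ) (h : j + 1 < L) :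
    ∑ i ∈ range L, k (Equiv.swap j (j + 1) i) = ∑ i ∈ range L, k i := by
  refine sum_nbij' (Equiv.swap j (j + 1)) (Equiv.swap j (j + 1)) ?_ ?_ ?_ ?_ ?_ <;>
    intro a ha <;> simp only [mem_range, Equiv.swap_apply_def] at ha ⊢ <;> grind

open Finset in
theorem sum_swap_le {L j : ℕ} (k : ℕ → ℕ) (h : L ≤ j) :
    ∑ i ∈ range L, k (Equiv.swap j (j + 1) i) = ∑ i ∈ range L, k i :=
  sum_congr rfl fun a ha => by
    rw [Equiv.swap_apply_of_ne_of_ne] <;> simp only [mem_range] at ha <;> omega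

/-- Assignments of a width `k i` to every position `i < L`, with total width `N`. -/
abbrev Widths (L N : ℕ) : Type := {k : ℕ → ℕ // ∑ i ∈ Finset.range L, k i = N}

/-- Exchange the widths in positions `j` and `j + 1`. -/
def Widths.swap {L N : ℕ} (j : ℕ) (h : j + 1 < L) (k : Widths L N) : Widths L N :=
  ⟨fun i => k.1 (Equiv.swap j (j + 1) i), (sum_swap k.1 h).trans k.2⟩

theorem Widths.swap_swap {L N : ℕ} (j : ℕ) (h : j + 1 < L) (k : Widths L N) :
    (k.swap j h).swap j h = k :=
  Subtype.ext (funext fun i => by simp [Widths.swap])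

/-- The braid obtained from the generator crossing positions `j` and `j + 1` when the strand that
starts in position `i` is replaced by `k i` parallel strands. -/
def cableSig {L N : ℕ} (j : ℕ) (k : Widths L N) : BraidGroup N :=
  blockCross N (∑ i ∈ Finset.range j, k.1 i) (k.1 j) (k.1 (j + 1))

/-- The action of a generator on pairs consisting of widths (of the strands below the braid) and a
braid on the parallel strands: stack the cabled generator on top. -/
def cableGen (L N j : ℕ) : Equiv.Perm (Widths L N × BraidGroup N) :=
  if h : j + 1 < L then
    { toFun := fun x => (x.1.swap j h, cableSig j x.1 * x.2)
      invFun := fun x => (x.1.swap j h, (cableSig j (x.1.swap j h))⁻¹ * x.2)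
      left_inv := fun x => by simp [Widths.swap_swap]
      right_inv := fun x => by simp [Widths.swap_swap] }
  else 1

theorem cableGen_apply {L N j : ℕ} (h : j + 1 < L) (x : Widths L N × BraidGroup N) :
    cableGen L N j x = (x.1.swap j h, cableSig j x.1 * x.2) := by
  rw [cableGen, dif_pos h]; rfl

theorem sum_range_le {L i : ℕ} (k : ℕ → ℕ) (h : i ≤ L) :
    ∑ a ∈ Finset.range i, k a ≤ ∑ a ∈ Finset.range L, k a :=
  Finset.sum_le_sum_of_subset (Finset.range_mono h)

/-- The action of braids on cabled braids. -/
def cableAct (L N : ℕ) : BraidGroup L →* Equiv.Perm (Widths L N × BraidGroup N) :=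
  liftBraid (cableGen L N)
    (by
      intro i hi
      refine Equiv.ext fun x => ?_
      obtain ⟨k, b⟩ := x
      simp only [Equiv.Perm.coe_mul, Function.comp_apply, cableGen_apply (show i + 1 < L by omega),
        cableGen_apply (show i + 1 + 1 < L by omega)]
      refine Prod.ext ?_ ?_
      · refine Subtype.ext (funext fun a => ?_)
        have := congrArg (fun e : Equiv.Perm ℕ => k.1 (e a)) (swap_braid i)
        simpa [Widths.swap] using this
      · have hle := sum_range_le k.1 (show i + 3 ≤ L by omega)
        rw [k.2] at hle
        simp only [Finset.sum_range_succ] at hle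
        have h1 : Equiv.swap i (i + 1) (i + 1 + 1) = i + 1 + 1 :=
          Equiv.swap_apply_of_ne_of_ne (by omega) (by omega)
        have h2 : Equiv.swap (i + 1) (i + 1 + 1) i = i :=
          Equiv.swap_apply_of_ne_of_ne (by omega) (by omega)
        have key := blockCross_braid (n := N) (o := ∑ a ∈ Finset.range i, k.1 a) (a := k.1 i)
          (b := k.1 (i + 1)) (c := k.1 (i + 1 + 1)) (by omega)
        simp only [cableSig, Widths.swap, Finset.sum_range_succ, sum_swap_le _ (le_refl i),
          sum_swap_le (L := i) (j := i + 1) _ (by omega), Equiv.swap_apply_left,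
          Equiv.swap_apply_right, h1, h2, ← mul_assoc]
        have e5 := sum_swap_le (L := i) (j := i + 1) (fun a => k.1 (Equiv.swap i (i + 1) a))
          (by omega)
        have e6 := sum_swap_le (L := i) (j := i) (fun a => k.1 (Equiv.swap (i + 1) (i + 1 + 1) a))
          le_rfl
        have e7 := sum_swap_le (L := i) (j := i + 1) k.1 (by omega)
        have e8 := sum_swap_le (L := i) (j := i) k.1 le_rfl
        rw [e5, e6, e7, e8, key])
    (by
      intro i j hij hj
      refine Equiv.ext fun x => ?_
      obtain ⟨k, b⟩ := x
      simp only [Equiv.Perm.coe_mul, Function.comp_apply, cableGen_apply (show i + 1 < L by omega),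
        cableGen_apply hj]
      refine Prod.ext ?_ ?_
      · refine Subtype.ext (funext fun a => ?_)
        have := congrArg (fun e : Equiv.Perm ℕ => k.1 (e a)) (swap_comm hij)
        simpa [Widths.swap] using this.symm
      · have e1 : Equiv.swap i (i + 1) j = j :=
          Equiv.swap_apply_of_ne_of_ne (by omega) (by omega)
        have e2 : Equiv.swap i (i + 1) (j + 1) = j + 1 :=
          Equiv.swap_apply_of_ne_of_ne (by omega) (by omega)
        have e3 : Equiv.swap j (j + 1) i = i :=
          Equiv.swap_apply_of_ne_of_ne (by omega) (by omega)
        have e4 : Equiv.swap j (j + 1) (i + 1) = i + 1 :=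
          Equiv.swap_apply_of_ne_of_ne (by omega) (by omega)
        have hle := sum_range_le k.1 (show i + 2 ≤ j by omega)
        simp only [Finset.sum_range_succ] at hle
        simp only [cableSig, Widths.swap, e1, e2, e3, e4, ← mul_assoc]
        rw [sum_swap k.1 (show i + 1 < j by omega), sum_swap_le k.1 (show i ≤ j by omega),
          blockCross_far hle])

/-- The braid obtained from `A` by replacing the strand that ends in position `i` by `k i` parallel
strands, for every `i` (strands with `k i = 0` are deleted). It is the cocycle of the action
`cableAct`: if `A` carries the widths `k'` to the widths `k`, then `A` sends `(k', b)` to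
`(k, cable k A * b)`. -/
def cable {L N : ℕ} (k : Widths L N) (A : BraidGroup L) : BraidGroup N :=
  ((cableAct L N A).symm (k, 1)).2⁻¹

/-- The braid `C` placed on the strands in positions `i, …, i + M - 1`. -/
def shiftBraid {M N : ℕ} (i : ℕ) (h : i + M ≤ N) : BraidGroup M →* BraidGroup N :=
  liftBraid (fun j => sig N (i + j))
    (fun j hj => sig_braid (by omega)) (fun j j' hj _ => sig_comm (by omega))

theorem sum_single {L : ℕ} (i : Fin L) (M : ℕ) :
    ∑ a ∈ Finset.range L, (if a = (i : ℕ) then M else 1) = L - 1 + M := by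
  have := i.2
  rw [Finset.sum_ite, Finset.sum_const, Finset.sum_const, Finset.filter_eq',
    Finset.filter_ne', if_pos (by simp), Finset.card_erase_of_mem (by simp)]
  simp [add_comm]

/-- Partial composition `A ∘_i C` of the braid operad: the strand of `A` that ends in position `i`
is replaced by the braid `C`. -/
def braidComp {L M : ℕ} (A : BraidGroup L) (i : Fin L) (C : BraidGroup M) :
    BraidGroup (L - 1 + M) :=
  shiftBraid i (by omega) C * cable ⟨fun a => if a = (i : ℕ) then M else 1, sum_single i M⟩ A

/-- Parenthesized words in letters of `α` and in a letter `x_0` standing for the unit. -/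
inductive PTree (α : Type) : Type
  | unit : PTree α
  | leaf (a : α) : PTree α
  | node (l r : PTree α) : PTree α

namespace PTree

variable {α β : Type}

/-- The word without its parentheses; `none` is the letter `x_0`. -/
def leaves : PTree α → List (Option α)
  | unit => [none]
  | leaf a => [some a]
  | node l r => l.leaves ++ r.leaves

/-- The letters different from `x_0`, in order. -/
def vars (p : PTree α) : List α := p.leaves.reduceOption

/-- Substitution of a word for every letter different from `x_0`. -/
def bind (f : α → PTree β) : PTree α → PTree β
  | unit => unit
  | leaf a => f a
  | node l r => node (l.bind f) (r.bind f)

/-- Relabelling of the letters different from `x_0`. -/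
def map (f : α → β) (p : PTree α) : PTree β := p.bind fun a => leaf (f a)

/-- The arrangement of parentheses, where all letters (also `x_0`) become equal. -/
def shape : PTree α → PTree Unit
  | unit => leaf ()
  | leaf _ => leaf ()
  | node l r => node l.shape r.shape

theorem vars_bind (f : α → PTree β) (p : PTree α) :
    (p.bind f).vars = p.vars.flatMap fun a => (f a).vars := by
  induction p with
  | unit => rfl
  | leaf a => simp [bind, vars, leaves]
  | node l r hl hr =>
    simp only [vars] at hl hr
    simp [bind, vars, leaves, List.reduceOption_append, hl, hr]

theorem leaves_bind (f : α → PTree β) (p : PTree α) :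
    (p.bind f).leaves = p.leaves.flatMap fun o => o.elim [none] fun a => (f a).leaves := by
  induction p with
  | unit => rfl
  | leaf a => simp [bind, leaves]
  | node l r hl hr => simp [bind, leaves, hl, hr]

theorem leaves_map (f : α → β) (p : PTree α) : (p.map f).leaves = p.leaves.map (Option.map f) := by
  induction p with
  | unit => rfl
  | leaf a => rfl
  | node l r hl hr =>
    simp only [map] at hl hr
    simp [map, bind, leaves, hl, hr]

theorem vars_map (f : α → β) (p : PTree α) : (p.map f).vars = p.vars.map f := by
  rw [map, vars_bind]
  simp [vars, leaves]
  exact (List.map_eq_flatMap ..).symm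

end PTree

/-- The arity `n` part of the free symmetric operad on one binary operation and one nullary
operation `x_0`: parenthesized words in which each of `x_1, …, x_n` (here indexed by `Fin n`)
occurs exactly once and `x_0` occurs any number of times. -/
structure Omega (n : ℕ) where
  /-- the parenthesized word -/
  tree : PTree (Fin n)
  nodup : tree.vars.Nodup
  mem : ∀ i, i ∈ tree.vars

/-- Where the letter `x_k` of a word of arity `n + 1` goes under composition with a word of arity
`m` in the slot `i`; `none` stands for the slot itself. -/
def slot {n : ℕ} (m : ℕ) (i k : Fin (n + 1)) : Option (Fin (n + m)) :=
  if h : k < i then some ⟨k, by omega⟩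
  else if h' : i < k then some ⟨k - 1 + m, by omega⟩
  else none

/-- The new names of the letters of the word of arity `m` that is inserted in the slot `i`. -/
def block {n m : ℕ} (i : Fin (n + 1)) (b : Fin m) : Fin (n + m) := ⟨i + b, by omega⟩

namespace Omega

variable {n m : ℕ}

theorem vars_length (p : Omega n) : p.tree.vars.length = n := by
  have := Fintype.card_congr (p.nodup.getEquivOfForallMemList _ p.mem)
  simpa using this

/-- The permutation `position ↦ letter` underlying a word, where `x_0` is ignored. -/
def tau (p : Omega n) : Equiv.Perm (Fin n) :=
  (finCongr p.vars_length.symm).trans (p.nodup.getEquivOfForallMemList _ p.mem)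

/-- The action of the symmetric group. -/
def smul (s : Equiv.Perm (Fin n)) (p : Omega n) : Omega n where
  tree := p.tree.map s
  nodup := by
    rw [PTree.vars_map]
    exact p.nodup.map s.injective
  mem i := by
    rw [PTree.vars_map]
    exact List.mem_map.2 ⟨s.symm i, p.mem _, s.apply_symm_apply i⟩

/-- The tree of the partial composition. -/
def compTree (p : PTree (Fin (n + 1))) (i : Fin (n + 1)) (q : PTree (Fin m)) : PTree (Fin (n + m)) :=
  p.bind fun k => match slot m i k with
    | some a => .leaf a
    | none => q.map (block i)

theorem mem_slot (i k : Fin (n + 1)) (q : Omega m) (a : Fin (n + m)) :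
    a ∈ ((match slot m i k with
      | some a => PTree.leaf a
      | none => q.tree.map (block i)) : PTree (Fin (n + m))).vars ↔
    (k : ℕ) = if (a : ℕ) < i then (a : ℕ) else if (a : ℕ) < i + m then (i : ℕ) else a + 1 - m := by
  unfold slot
  have ha := a.2
  split
  · rename_i b hb
    simp only [PTree.vars, PTree.leaves, List.reduceOption_cons_of_some, List.reduceOption_nil,
      List.mem_singleton]
    split_ifs at hb <;> simp only [Option.some.injEq] at hb <;> subst hb <;>
      simp only [Fin.ext_iff] <;> split_ifs <;> omega
  · rename_i hb
    rw [PTree.vars_map, List.mem_map]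
    split_ifs at hb
    have hk : k = i := by omega
    subst hk
    constructor
    · rintro ⟨b, -, rfl⟩
      simp [block]
    · intro h
      refine ⟨⟨a - k, ?_⟩, q.mem _, ?_⟩
      · split_ifs at h <;> omega
      · ext
        simp only [block]
        split_ifs at h <;> omega

theorem nodup_slot (i k : Fin (n + 1)) (q : Omega m) :
    ((match slot m i k with
      | some a => PTree.leaf a
      | none => q.tree.map (block i)) : PTree (Fin (n + m))).vars.Nodup := by
  split
  · simp [PTree.vars, PTree.leaves]
  · rw [PTree.vars_map]
    exact q.nodup.map fun a b h => by simpa [block, Fin.ext_iff] using h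

/-- Partial composition: substitution of a word for the letter `x_i`, with renumbering. -/
def comp (p : Omega (n + 1)) (i : Fin (n + 1)) (q : Omega m) : Omega (n + m) where
  tree := compTree p.tree i q.tree
  nodup := by
    rw [compTree, PTree.vars_bind, List.nodup_flatMap]
    refine ⟨fun k _ => nodup_slot i k q, p.nodup.imp ?_⟩
    intro k k' hk a h h'
    exact hk (Fin.ext (((mem_slot i k q a).1 h).trans ((mem_slot i k' q a).1 h').symm))
  mem a := by
    rw [compTree, PTree.vars_bind, List.mem_flatMap]
    have ha := a.2
    refine ⟨⟨if (a : ℕ) < i then (a : ℕ) else if (a : ℕ) < i + m then (i : ℕ) else a + 1 - m, ?_⟩,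
      p.mem _, (mem_slot i _ q a).2 rfl⟩
    split_ifs <;> omega

/-- The number of letters, where every occurrence of `x_0` counts. -/
def len (p : Omega n) : ℕ := p.tree.leaves.length

theorem mem_leaves (p : Omega n) (i : Fin n) : some i ∈ p.tree.leaves :=
  List.reduceOption_mem_iff.1 (p.mem i)

theorem count_leaves (l : List (Option (Fin n))) (i : Fin n) :
    l.count (some i) = l.reduceOption.count i := by
  induction l with
  | nil => rfl
  | cons a l ih => cases a <;> simp [List.count_cons, ih]

theorem length_slot (i a : Fin (n + 1)) (q : Omega m) :
    (PTree.leaves (match slot m i a with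
      | some a => .leaf a
      | none => q.tree.map (block i))).length = if a = i then q.len else 1 := by
  by_cases h : a = i
  · subst h
    simp [slot, PTree.leaves_map, len]
  · rw [if_neg h]
    rcases Nat.lt_or_gt_of_ne (fun e => h (Fin.ext e)) with h' | h'
    · rw [show slot m i a = some ⟨a, by omega⟩ from dif_pos h']
      rfl
    · rw [show slot m i a = some ⟨a - 1 + m, by omega⟩ from
        (dif_neg (Nat.lt_asymm h')).trans (dif_pos h')]
      rfl

theorem length_aux (l : List (Option (Fin (n + 1)))) (i : Fin (n + 1)) (q : Omega m) :
    (l.flatMap fun o => o.elim [none] fun a => PTree.leaves (match slot m i a with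
      | some a => .leaf a
      | none => q.tree.map (block i))).length + l.count (some i) =
    l.length + l.count (some i) * q.len := by
  induction l with
  | nil => simp
  | cons a l ih =>
    rw [List.flatMap_cons, List.length_append, List.count_cons, List.length_cons]
    cases a with
    | none =>
      simp only [Option.elim_none, List.length_singleton, beq_iff_eq, reduceCtorEq, if_false,
        add_zero]
      omega
    | some a =>
      rw [Option.elim_some, length_slot]
      by_cases h : a = i
      · simp only [h, if_true, beq_self_eq_true, add_mul, one_mul]
        omega
      · simp only [h, if_false, beq_iff_eq, Option.some.injEq, add_zero]
        omega

theorem comp_len (p : Omega (n + 1)) (i : Fin (n + 1)) (q : Omega m) :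
    (p.comp i q).len = p.len - 1 + q.len := by
  have h := length_aux p.tree.leaves i q
  rw [count_leaves, show p.tree.leaves.reduceOption = p.tree.vars from rfl,
    List.count_eq_one_of_mem p.nodup (p.mem i)] at h
  have h2 : (p.comp i q).len = _ := congrArg List.length (PTree.leaves_bind _ p.tree)
  have h3 := List.length_pos_of_mem (p.mem_leaves i)
  rw [h2]
  simp only [len] at h ⊢
  omega

theorem smul_len (s : Equiv.Perm (Fin n)) (p : Omega n) : (p.smul s).len = p.len := by
  simp [len, smul, PTree.leaves_map]

theorem sum_mask (l : List (Option (Fin n))) :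
    ∑ a ∈ Finset.range l.length, (if (l.getD a none).isSome then 1 else 0) =
      l.reduceOption.length := by
  induction l with
  | nil => rfl
  | cons a l ih =>
    rw [List.length_cons, Finset.sum_range_succ']
    simp only [List.getD_cons_succ, ih]
    cases a <;> simp

end Omega

/-- The objects of the weak braiding operad in arity `n`: a word `p` together with a braid on all
letters of `p`, where every occurrence of `x_0` counts as a strand. -/
structure WPaB (n : ℕ) where
  /-- the word -/
  word : Omega n
  /-- the number of letters of the word -/
  len : ℕ
  len_eq : word.len = len
  /-- the braid -/
  braid : BraidGroup len

namespace WPaB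

variable {n m : ℕ}

/-- The place `t_p⁻¹(i)` of the letter `x_i` in the word. -/
def pos (x : WPaB n) (i : Fin n) : Fin x.len :=
  ⟨x.word.tree.leaves.idxOf (some i),
    (List.idxOf_lt_length_iff.2 (x.word.mem_leaves i)).trans_eq x.len_eq⟩

/-- The braid on `n` strands that remains when all strands that end at letters `x_0` are deleted. -/
def strip (x : WPaB n) : BraidGroup n :=
  cable ⟨fun a => if (x.word.tree.leaves.getD a none).isSome then 1 else 0, by
    rw [← x.len_eq]
    exact (Omega.sum_mask _).trans x.word.vars_length⟩ x.braid

/-- There is a morphism from `(p, A)` to `(q, C)` only if the braid `C A⁻¹` (where the strands of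
`x_0` are deleted) carries the letters of `p` to those of `q`, and then this braid is the only
morphism. -/
instance : Category (WPaB n) where
  Hom x y := {g : BraidGroup n // perm n g = y.word.tau⁻¹ * x.word.tau ∧ g = y.strip * x.strip⁻¹}
  id x := ⟨1, by simp, by simp⟩
  comp {x y z} f g := ⟨g.1 * f.1, by
    rw [map_mul, f.2.1, g.2.1]; group, by rw [f.2.2, g.2.2]; group⟩
  id_comp f := Subtype.ext (mul_one f.1)
  comp_id f := Subtype.ext (one_mul f.1)
  assoc f g h := Subtype.ext (mul_assoc h.1 g.1 f.1).symm

instance (x y : WPaB n) : Subsingleton (x ⟶ y) :=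
  ⟨fun f g => Subtype.ext (f.2.2.trans g.2.2.symm)⟩

/-- The word `p` with the trivial braid. -/
def ofWord (p : Omega n) : WPaB n := ⟨p, p.len, rfl, 1⟩

/-- The action of the symmetric group on objects. -/
def smul (s : Equiv.Perm (Fin n)) (x : WPaB n) : WPaB n :=
  ⟨x.word.smul s, x.len, (x.word.smul_len s).trans x.len_eq, x.braid⟩

/-- Partial composition of objects. -/
def comp (x : WPaB (n + 1)) (i : Fin (n + 1)) (y : WPaB m) : WPaB (n + m) :=
  ⟨x.word.comp i y.word, x.len - 1 + y.len, by
    rw [Omega.comp_len, x.len_eq, y.len_eq], braidComp x.braid (x.pos i) y.braid⟩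

/-- The operadic unit. -/
def one : WPaB 1 :=
  ofWord ⟨.leaf 0, by simp [PTree.vars, PTree.leaves], fun i => by
    simp [PTree.vars, PTree.leaves, Subsingleton.elim i 0]⟩

end WPaB

section EndOperad

open MonoidalCategory

variable {D : Type u} [Category.{v} D] {n m : ℕ}

/-- The argument in one slot of a composite functor: a variable, or the value of the inserted
functor `H` on the block of variables of the slot `i`. -/
def argFunctor (i : Fin (n + 1)) (H : (Fin m → D) ⥤ D) :
    Option (Fin (n + m)) → ((Fin (n + m) → D) ⥤ D)
  | some a => Pi.eval (fun _ => D) a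
  | none => Pi.comap (fun _ => D) (block i) ⋙ H

/-- `argFunctor` on natural transformations. -/
def argTrans (i : Fin (n + 1)) {H H' : (Fin m → D) ⥤ D} (t : H ⟶ H') :
    (o : Option (Fin (n + m))) → (argFunctor i H o ⟶ argFunctor i H' o)
  | some _ => 𝟙 _
  | none => Functor.whiskerLeft (Pi.comap (fun _ => D) (block i)) t

/-- Partial composition in the endomorphism operad of `D`:
`(F ∘_i H)(X_1, …) = F(X_1, …, X_{i-1}, H(X_i, …, X_{i+m-1}), X_{i+m}, …)`. -/
def endComp (F : (Fin (n + 1) → D) ⥤ D) (i : Fin (n + 1)) (H : (Fin m → D) ⥤ D) :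
    (Fin (n + m) → D) ⥤ D :=
  Functor.pi' (fun k => argFunctor i H (slot m i k)) ⋙ F

/-- Partial composition of natural transformations in the endomorphism operad. -/
def endCompMap {F F' : (Fin (n + 1) → D) ⥤ D} (s : F ⟶ F') (i : Fin (n + 1))
    {H H' : (Fin m → D) ⥤ D} (t : H ⟶ H') : endComp F i H ⟶ endComp F' i H' :=
  NatTrans.pi' (fun k => argTrans i t (slot m i k)) ◫ s

/-- The action of the symmetric group on the endomorphism operad:
`(s F)(X_1, …, X_n) = F(X_{s(1)}, …, X_{s(n)})`. -/
def endSMul (s : Equiv.Perm (Fin n)) (F : (Fin n → D) ⥤ D) : (Fin n → D) ⥤ D :=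
  Pi.comap (fun _ => D) s ⋙ F

/-- The action of the symmetric group on natural transformations. -/
def endSMulMap (s : Equiv.Perm (Fin n)) {F F' : (Fin n → D) ⥤ D} (t : F ⟶ F') :
    endSMul s F ⟶ endSMul s F' :=
  Functor.whiskerLeft (Pi.comap (fun _ => D) s) t

/-- The functor `D^n ⥤ D` that tensors its arguments together as prescribed by a word, with the
monoidal unit for every `x_0`. -/
def PTree.functor (D : Type u) [Category.{v} D] [MonoidalCategory D] {α : Type} :
    PTree α → ((α → D) ⥤ D)
  | .unit => (Functor.const _).obj (𝟙_ D)
  | .leaf a => Pi.eval (fun _ => D) a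
  | .node l r => Functor.prod' (l.functor D) (r.functor D) ⋙ MonoidalCategory.tensor D

/-- A weak braiding on a category: the structure of an algebra over the weak braiding operad, that
is, a morphism of symmetric operads in groupoids from the weak braiding operad to the endomorphism
operad of `D`. In the conditions on morphisms, note that there is at most one morphism between two
objects of the weak braiding operad; so the result of acting by `s` on `f`, with the same braid as
`f`, is the only morphism `s x ⟶ s y`, and the operadic composite of `f : x ⟶ x'` and
`g : y ⟶ y'`, with braid `braidComp f (v⁻¹ i) g` for the permutation `v` of `x'`, is the only
morphism from `x ∘_i y` to `x' ∘_i y'`. -/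
structure WeakBraiding (D : Type u) [Category.{v} D] where
  /-- the twisted tensor products, and the natural transformations between them -/
  φ (n : ℕ) : WPaB n ⥤ ((Fin n → D) ⥤ D)
  obj_one : (φ 1).obj WPaB.one = Pi.eval (fun _ => D) 0
  obj_smul {n : ℕ} (s : Equiv.Perm (Fin n)) (x : WPaB n) :
    (φ n).obj (x.smul s) = endSMul s ((φ n).obj x)
  map_smul {n : ℕ} (s : Equiv.Perm (Fin n)) {x y : WPaB n} (f : x ⟶ y)
    (h : x.smul s ⟶ y.smul s) :
    (φ n).map h =
      eqToHom (obj_smul s x) ≫ endSMulMap s ((φ n).map f) ≫ eqToHom (obj_smul s y).symm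
  obj_comp {n m : ℕ} (x : WPaB (n + 1)) (i : Fin (n + 1)) (y : WPaB m) :
    (φ (n + m)).obj (x.comp i y) = endComp ((φ (n + 1)).obj x) i ((φ m).obj y)
  map_comp {n m : ℕ} {x x' : WPaB (n + 1)} (f : x ⟶ x') (i : Fin (n + 1)) {y y' : WPaB m}
    (g : y ⟶ y') (h : x.comp i y ⟶ x'.comp i y') :
    (φ (n + m)).map h =
      eqToHom (obj_comp x i y) ≫ endCompMap ((φ (n + 1)).map f) i ((φ m).map g) ≫
        eqToHom (obj_comp x' i y').symm

end EndOperad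

section Extends

/-- `x_1` as a word. -/
def wordX : Omega 1 := ⟨.leaf 0, by decide, by decide⟩
/-- `x_0 x_1` as a word. -/
def wordOX : Omega 1 := ⟨.node .unit (.leaf 0), by decide, by decide⟩
/-- `x_1 x_0` as a word. -/
def wordXO : Omega 1 := ⟨.node (.leaf 0) .unit, by decide, by decide⟩
/-- `(x_1 x_2) x_3` as a word. -/
def wordAssocL : Omega 3 :=
  ⟨.node (.node (.leaf 0) (.leaf 1)) (.leaf 2), by decide, by decide⟩
/-- `x_1 (x_2 x_3)` as a word. -/
def wordAssocR : Omega 3 :=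
  ⟨.node (.leaf 0) (.node (.leaf 1) (.leaf 2)), by decide, by decide⟩

open MonoidalCategory

variable {D : Type u} [Category.{v} D] [MonoidalCategory D]

/-- The weak braiding restricts, on words with the trivial braid, to the given monoidal structure:
words act as iterated tensor products, and the morphisms between words with the trivial braid act
as associators and unitors. -/
structure WeakBraiding.ExtendsMonoidal (W : WeakBraiding D) : Prop where
  obj_ofWord {n : ℕ} (p : Omega n) : (W.φ n).obj (WPaB.ofWord p) = p.tree.functor D
  associator : ∃ f : WPaB.ofWord wordAssocL ⟶ WPaB.ofWord wordAssocR, ∀ X : Fin 3 → D,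
    ((W.φ 3).map f).app X =
      eqToHom (Functor.congr_obj (obj_ofWord wordAssocL) X) ≫ (α_ (X 0) (X 1) (X 2)).hom ≫
        eqToHom (Functor.congr_obj (obj_ofWord wordAssocR) X).symm
  leftUnitor : ∃ f : WPaB.ofWord wordOX ⟶ WPaB.ofWord wordX, ∀ X : Fin 1 → D,
    ((W.φ 1).map f).app X =
      eqToHom (Functor.congr_obj (obj_ofWord wordOX) X) ≫ (λ_ (X 0)).hom ≫
        eqToHom (Functor.congr_obj (obj_ofWord wordX) X).symm
  rightUnitor : ∃ f : WPaB.ofWord wordXO ⟶ WPaB.ofWord wordX, ∀ X : Fin 1 → D,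
    ((W.φ 1).map f).app X =
      eqToHom (Functor.congr_obj (obj_ofWord wordXO) X) ≫ (ρ_ (X 0)).hom ≫
        eqToHom (Functor.congr_obj (obj_ofWord wordX) X).symm

/-- Additivity of a functor `D^n ⥤ D` in every variable. -/
def IsMultiadditive [Preadditive D] {n : ℕ} (F : (Fin n → D) ⥤ D) : Prop :=
  ∀ (X Y : Fin n → D) (i : Fin n) (f f' f'' : X ⟶ Y), f'' i = f i + f' i →
    (∀ j, j ≠ i → f j = f'' j ∧ f' j = f'' j) → F.map f'' = F.map f + F.map f'

end Extends

section Crossed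

open MonoidalCategory Limits

attribute [local instance] Abelian.hasFiniteBiproducts

/-- A fusion category over a field `k`: an abelian, `k`-linear, rigid monoidal category with
bilinear tensor product which is semisimple, with finitely many simple objects up to isomorphism,
finite dimensional spaces of morphisms, and `End(𝟙) = k`. -/
class FusionCategory (k : Type w) [Field k] (D : Type u) [Category.{v} D] [Abelian D] [Linear k D]
    [MonoidalCategory D] [MonoidalPreadditive D] [MonoidalLinear k D] [RigidCategory D] :
    Prop where
  finite_hom (X Y : D) : Module.Finite k (X ⟶ Y)
  semisimple (X : D) : ∃ (r : ℕ) (S : Fin r → D), (∀ i, Simple (S i)) ∧ Nonempty (X ≅ ⨁ S)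
  finite_simple : ∃ (r : ℕ) (S : Fin r → D), ∀ X : D, Simple X → ∃ i, Nonempty (X ≅ S i)
  end_unit (f : 𝟙_ D ⟶ 𝟙_ D) : ∃! c : k, f = c • 𝟙 (𝟙_ D)

/-- A braided `G`-crossed structure with additive structure functors on a monoidal category: a
grading `D = ⨁_g D^g`, an action of `G` by monoidal functors `F g` with `F g (D^h) ⊆ D^(g h g⁻¹)`,
and a `G`-braiding `X ⊗ Y ≅ F g (Y) ⊗ X` for `X` in `D^g`. -/
structure BraidedGCrossed (G : Type w) [Group G] (D : Type u) [Category.{v} D] [Abelian D]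
    [MonoidalCategory D] where
  /-- the objects of the component `D^g` -/
  deg : G → ObjectProperty D
  deg_iso (g : G) {X Y : D} (e : X ≅ Y) : deg g X → deg g Y
  deg_zero (g : G) {X : D} (h : IsZero X) : deg g X
  deg_biprod {g : G} {X Y : D} : deg g X → deg g Y → deg g (X ⊞ Y)
  hom_eq_zero {g h : G} {X Y : D} (hX : deg g X) (hY : deg h Y) (hgh : g ≠ h) (f : X ⟶ Y) : f = 0
  decomp (X : D) : ∃ (s : Finset G) (Y : G → D), (∀ g, deg g (Y g)) ∧
    Nonempty (X ≅ ⨁ fun g : s => Y g)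
  deg_unit : deg 1 (𝟙_ D)
  deg_tensor {g h : G} {X Y : D} : deg g X → deg h Y → deg (g * h) (X ⊗ Y)
  /-- the action of `G` -/
  F : G → D ⥤ D
  /-- the tensor structure of the functors `F g` -/
  monoidal (g : G) : (F g).Monoidal
  additive (g : G) : (F g).Additive
  /-- the tensor structure of the action: `F g (F h X) ≅ F (g h) X` -/
  mulIso (g h : G) : F h ⋙ F g ≅ F (g * h)
  mulIso_monoidal (g h : G) : NatTrans.IsMonoidal (mulIso g h).hom
  /-- the unit of the action: `F 1 X ≅ X` -/
  oneIso : F 1 ≅ 𝟭 D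
  oneIso_monoidal : NatTrans.IsMonoidal oneIso.hom
  mulIso_assoc (g h k : G) (X : D) :
    (F g).map ((mulIso h k).hom.app X) ≫ (mulIso g (h * k)).hom.app X =
      (mulIso g h).hom.app ((F k).obj X) ≫ (mulIso (g * h) k).hom.app X ≫
        eqToHom (by rw [mul_assoc])
  mulIso_one_left (g : G) (X : D) :
    (mulIso 1 g).hom.app X = oneIso.hom.app ((F g).obj X) ≫ eqToHom (by simp)
  mulIso_one_right (g : G) (X : D) :
    (mulIso g 1).hom.app X = (F g).map (oneIso.hom.app X) ≫ eqToHom (by simp)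
  deg_F (g : G) {h : G} {X : D} : deg h X → deg (g * h * g⁻¹) ((F g).obj X)
  /-- the `G`-braiding -/
  c {g : G} {X : D} (hX : deg g X) (Y : D) : X ⊗ Y ≅ (F g).obj Y ⊗ X
  c_naturality {g : G} {X X' Y Y' : D} (hX : deg g X) (hX' : deg g X') (f : X ⟶ X') (u : Y ⟶ Y') :
    (f ⊗ₘ u) ≫ (c hX' Y').hom = (c hX Y).hom ≫ ((F g).map u ⊗ₘ f)
  c_action (g : G) {h : G} {X : D} (hX : deg h X) (Y : D) :
    (F g).map (c hX Y).hom ≫ Functor.OplaxMonoidal.δ (F g) ((F h).obj Y) X ≫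
        (mulIso g h).hom.app Y ▷ (F g).obj X =
      Functor.OplaxMonoidal.δ (F g) X Y ≫ (c (deg_F g hX) ((F g).obj Y)).hom ≫
        (mulIso (g * h * g⁻¹) g).hom.app Y ▷ (F g).obj X ≫ eqToHom (by simp)
  hexagon_right {g : G} {X : D} (hX : deg g X) (Y Z : D) :
    (c hX (Y ⊗ Z)).hom ≫ Functor.OplaxMonoidal.δ (F g) Y Z ▷ X =
      (α_ X Y Z).inv ≫ (c hX Y).hom ▷ Z ≫ (α_ _ X Z).hom ≫ (F g).obj Y ◁ (c hX Z).hom ≫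
        (α_ _ _ X).inv
  hexagon_left {g h : G} {X Y : D} (hX : deg g X) (hY : deg h Y) (Z : D) :
    (c (deg_tensor hX hY) Z).hom =
      (α_ X Y Z).hom ≫ X ◁ (c hY Z).hom ≫ (α_ X _ Y).inv ≫ (c hX ((F h).obj Z)).hom ▷ Y ≫
        (α_ _ X Y).hom ≫ (mulIso g h).hom.app Z ▷ (X ⊗ Y)

attribute [instance] BraidedGCrossed.monoidal

namespace BraidedGCrossed

variable {G : Type w} [Group G] {D : Type u} [Category.{v} D] [Abelian D] [MonoidalCategory D]
  (C : BraidedGCrossed G D) {n : ℕ}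

/-- Homogeneous objects `X_1, …, X_n` of degrees `g_1, …, g_n`. -/
structure Family (n : ℕ) where
  g : Fin n → G
  obj : Fin n → D
  deg (i : Fin n) : C.deg (g i) (obj i)

/-- The label of a strand in the course of a braid: `none` for the unit object and
`some (a, i)` for the object `F a (X_i)`. -/
abbrev Strand (G : Type w) (n : ℕ) : Type w := Option (G × Fin n)

variable {C} in
/-- The object on a strand. -/
def Family.strandObj (X : C.Family n) : Strand G n → D
  | none => 𝟙_ D
  | some (a, i) => (C.F a).obj (X.obj i)

variable {C} in
/-- The degree of the object on a strand. -/
def Family.strandDeg (X : C.Family n) : Strand G n → G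
  | none => 1
  | some (a, i) => a * X.g i * a⁻¹

variable {C} in
theorem Family.deg_strand (X : C.Family n) :
    (s : Strand G n) → C.deg (X.strandDeg s) (X.strandObj s)
  | none => C.deg_unit
  | some (a, i) => C.deg_F a (X.deg i)

/-- The label after the action of `F b`. -/
def actStrand (b : G) : Strand G n → Strand G n
  | none => none
  | some (a, i) => some (b * a, i)

variable {C} in
/-- `F b (𝟙) ≅ 𝟙` and `F b (F a X) ≅ F (b a) X`. -/
def Family.actIso (X : C.Family n) (b : G) :
    (s : Strand G n) → ((C.F b).obj (X.strandObj s) ≅ X.strandObj (actStrand b s))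
  | none => (Functor.Monoidal.εIso (C.F b)).symm
  | some (a, i) => (C.mulIso b a).app (X.obj i)

/-- The tensor product of the objects on a list of strands. -/
def Family.tensor {C : BraidedGCrossed G D} (X : C.Family n) : List (Strand G n) → D
  | [] => 𝟙_ D
  | s :: l => X.strandObj s ⊗ X.tensor l

/-- The positive crossing of the strands in positions `j` and `j + 1` on labels: the strand that
starts in position `j + 1` is acted on by the degree of the other one. -/
def Family.cross {C : BraidedGCrossed G D} (X : C.Family n) :
    ℕ → List (Strand G n) → List (Strand G n)
  | 0, s :: t :: l => actStrand (X.strandDeg s) t :: s :: l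
  | j + 1, s :: l => s :: X.cross j l
  | _, l => l

/-- The positive crossing of the strands in positions `j` and `j + 1`, given by the `G`-braiding. -/
def Family.crossIso {C : BraidedGCrossed G D} (X : C.Family n) :
    (j : ℕ) → (l : List (Strand G n)) → (X.tensor l ≅ X.tensor (X.cross j l))
  | 0, s :: t :: l =>
    (α_ _ _ _).symm ≪≫ whiskerRightIso (C.c (X.deg_strand s) (X.strandObj t) ≪≫
      whiskerRightIso (X.actIso (X.strandDeg s) t) (X.strandObj s)) (X.tensor l) ≪≫ α_ _ _ _
  | j + 1, s :: l => whiskerLeftIso (X.strandObj s) (X.crossIso j l)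
  | 0, [] => Iso.refl _
  | 0, [_] => Iso.refl _
  | _ + 1, [] => Iso.refl _

/-- `X.BraidActs A l l' f` means that the morphism `f` is obtained from some expression of the braid
`A` as a product of the generators and their inverses, by letting the generators act through the
`G`-braiding, starting from the strands `l` and ending with the strands `l'`. -/
inductive Family.BraidActs {C : BraidedGCrossed G D} (X : C.Family n) {L : ℕ} :
    BraidGroup L → (l l' : List (Strand G n)) → (X.tensor l ⟶ X.tensor l') → Prop
  | one (l : List (Strand G n)) : X.BraidActs 1 l l (𝟙 _)
  | mul {A : BraidGroup L} {l l' : List (Strand G n)} {f : X.tensor l ⟶ X.tensor l'} {j : ℕ}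
      (hj : j + 1 < L) (h : X.BraidActs A l l' f) :
      X.BraidActs (sig L j * A) l (X.cross j l') (f ≫ (X.crossIso j l').hom)
  | inv_mul {A : BraidGroup L} {l l' : List (Strand G n)} {j : ℕ}
      {f : X.tensor l ⟶ X.tensor (X.cross j l')}
      (hj : j + 1 < L) (h : X.BraidActs A l (X.cross j l') f) :
      X.BraidActs ((sig L j)⁻¹ * A) l l' (f ≫ (X.crossIso j l').inv)

/-- The strands of a word, where `x_i` carries the object `F (a i) (X_i)`. -/
def strands (a : Fin n → G) : PTree (Fin n) → List (Strand G n)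
  | .unit => [none]
  | .leaf i => [some (a i, i)]
  | .node l r => strands a l ++ strands a r

variable {C} in
/-- The family `F (a_1) (X_1), …, F (a_n) (X_n)`. -/
abbrev Family.twisted (X : C.Family n) (a : Fin n → G) : Fin n → D :=
  fun i => (C.F (a i)).obj (X.obj i)

/-- Rebracketing. -/
def Family.appendIso {C : BraidedGCrossed G D} (X : C.Family n) (l' : List (Strand G n)) :
    (l : List (Strand G n)) → (X.tensor l ⊗ X.tensor l' ≅ X.tensor (l ++ l'))
  | [] => λ_ _
  | s :: l => α_ _ _ _ ≪≫ whiskerLeftIso (X.strandObj s) (X.appendIso l' l)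

/-- The tensor product prescribed by a word, rebracketed. -/
def Family.wordIso {C : BraidedGCrossed G D} (X : C.Family n) (a : Fin n → G) :
    (p : PTree (Fin n)) → ((p.functor D).obj (X.twisted a) ≅ X.tensor (strands a p))
  | .unit => (ρ_ (𝟙_ D)).symm
  | .leaf i => (ρ_ ((C.F (a i)).obj (X.obj i))).symm
  | .node l r => tensorIso (X.wordIso a l) (X.wordIso a r) ≪≫ X.appendIso _ _

/-- `q` is the word `p'` that arises from the word `p` of `x = (p, A)` by permuting all its letters,
also the `x_0`, in such a way that the braid `A` leads from the letters of `q` to the letters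
of `p`. -/
def IsUnwinding (q : Omega n) (x : WPaB n) : Prop :=
  q.tree.shape = x.word.tree.shape ∧
    ∀ a : Fin x.len, q.tree.leaves[(a : ℕ)]? = x.word.tree.leaves[(perm x.len x.braid a : ℕ)]?

/-- The braids act on the twisted tensor products of the weak braiding `W` through the functors
`F g` and the `G`-braiding: on objects `X_1, …, X_n` of degrees `g_1, …, g_n` the twisted tensor
product of `(p, A)` is naturally identified with `p (F_1 X_1, …, F_n X_n)`, where `F_i = F (a_i)`
and `a_i` depends on `(p, A)` and `g_1, …, g_n` only. For every expression of `A` as a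
product of generators and their inverses, the action of `A` through the `G`-braiding leads from
`p' (X_1, …, X_n)` to `p (F_1 X_1, …, F_n X_n)`, and coincides with the action of the morphism
`(p', 1) ⟶ (p, A)` of the weak braiding operad. -/
def ActsByTwisting (W : WeakBraiding D) (hW : W.ExtendsMonoidal) : Prop :=
  ∃ (a : ∀ {n : ℕ}, WPaB n → (Fin n → G) → Fin n → G)
    (θ : ∀ {n : ℕ} (x : WPaB n) (X : C.Family n),
      ((W.φ n).obj x).obj X.obj ≅ (x.word.tree.functor D).obj (X.twisted (a x X.g))),
    (∀ {n : ℕ} (x : WPaB n) (g : Fin n → G) (X Y : Fin n → D) (hX : ∀ i, C.deg (g i) (X i))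
      (hY : ∀ i, C.deg (g i) (Y i)) (u : X ⟶ Y),
      ((W.φ n).obj x).map u ≫ (θ x ⟨g, Y, hY⟩).hom =
        (θ x ⟨g, X, hX⟩).hom ≫ (x.word.tree.functor D).map fun i => (C.F (a x g i)).map (u i)) ∧
    ∀ {n : ℕ} (x : WPaB n) (X : C.Family n) (q : Omega n), IsUnwinding q x →
      ∃ (m : WPaB.ofWord q ⟶ x)
        (f : X.tensor (strands (fun _ => 1) q.tree) ⟶ X.tensor (strands (a x X.g) x.word.tree)),
        (X.wordIso (fun _ => 1) q.tree).hom ≫ f =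
          (q.tree.functor D).map (fun i => C.oneIso.hom.app (X.obj i)) ≫
            eqToHom (Functor.congr_obj (hW.obj_ofWord q) X.obj).symm ≫
              ((W.φ n).map m).app X.obj ≫ (θ x X).hom ≫
                (X.wordIso (a x X.g) x.word.tree).hom ∧
        X.BraidActs x.braid _ _ f ∧
        ∀ (l' : List (Strand G n)) (f' : X.tensor (strands (fun _ => 1) q.tree) ⟶ X.tensor l'),
          X.BraidActs x.braid _ l' f' → ∃ h : l' = strands (a x X.g) x.word.tree,
            f' ≫ eqToHom (congrArg X.tensor h) = f

end BraidedGCrossed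

end Crossed

end WeakBraid

/-!
The components of the weak braiding operad are contractible. A morphism `x ⟶ y` in `WPaB n` is
unique, and it exists precisely if the letters `x_1, …, x_n` occur in the same order at the starting
places of the strands of the two braids (`WPaB.nonempty_hom_iff`). Hence a weak braiding amounts to
two things: a functor for every object `x`, chosen compatibly with the operad structure, and
coherent natural isomorphisms between the functors of objects with the same order of the letters at
the start. Such functors exist already in every monoidal category. The word `x.unbraid` lists the
letters in the order at the start, and `x ↦ x.unbraid` is a morphism of operads on objects which
restricts to the identity on words with the trivial braid (`WPaB.unbraid_ofWord`,
`WPaB.unbraid_smul`, `WPaB.unbraid_comp`). The main point is the choice of the parentheses: they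
have to survive the substitution of one object into another, so `unbraid` keeps every subword whose
strands start in adjacent places. By Mac Lane coherence, in the form of the canonical isomorphisms
`can` between words with the same letters in the same order, the iterated tensor products
prescribed by the words `x.unbraid` form an algebra over the weak braiding operad, `weakBraiding`.

The twisting functors enter through the isomorphism `θ` between this functor and the tensor product
of twisted objects. The `G`-braiding satisfies a twisted Yang–Baxter equation
(`Family.yangBaxter`), which follows from one hexagon, naturality, and the compatibility of the
braiding with the action of `G`. It makes the action of a product of generators on a list of
strands independent of the chosen product (`Family.BraidActs.unique`). Every braid acts in this way
by isomorphisms, naturally in the objects and with twists that depend on their degrees only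
(`Family.exists_braidActs`). As the morphism from the unwound word to `x` acts by an isomorphism,
`θ` can be defined as the inverse of this isomorphism followed by the action of the braid, and then
it has the required property.
-/

/-! ### Braids acting on lists of letters -/

namespace WeakBraid

theorem liftBraid_sig {n : ℕ} {H : Type*} [Group H] (f : ℕ → H)
    (h1 : ∀ i, i + 2 < n → f i * f (i + 1) * f i = f (i + 1) * f i * f (i + 1))
    (h2 : ∀ i j, i + 2 ≤ j → j + 1 < n → f i * f j = f j * f i) {j : ℕ} (hj : j + 1 < n) :
    liftBraid f h1 h2 (sig n j) = f j := by
  rw [sig, dif_pos (by omega)]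
  exact PresentedGroup.toGroup.of _

theorem braid_induction {n : ℕ} {P : BraidGroup n → Prop} (one : P 1)
    (mul : ∀ A B, P A → P B → P (A * B)) (inv : ∀ A, P A → P A⁻¹)
    (gen : ∀ j, j + 1 < n → P (sig n j)) (A : BraidGroup n) : P A := by
  have hA : A ∈ Subgroup.closure (Set.range (PresentedGroup.of (rels := braidRels n))) := by
    rw [PresentedGroup.closure_range_of]; trivial
  induction hA using Subgroup.closure_induction with
  | mem x hx =>
    obtain ⟨j, rfl⟩ := hx
    have := gen j (by omega)
    rwa [sig, dif_pos j.2] at this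
  | one => exact one
  | mul x y _ _ hx hy => exact mul x y hx hy
  | inv x _ hx => exact inv x hx

theorem braid_induction_left {n : ℕ} {P : BraidGroup n → Prop} (one : P 1)
    (mul : ∀ j A, j + 1 < n → P A → P (sig n j * A))
    (inv_mul : ∀ j A, j + 1 < n → P A → P ((sig n j)⁻¹ * A)) (A : BraidGroup n) : P A := by
  suffices H : (∀ B, P B → P (A * B)) ∧ (∀ B, P B → P (A⁻¹ * B)) by
    simpa using H.1 1 one
  induction A using braid_induction with
  | one => simp
  | mul A B hA hB =>
    exact ⟨fun C hC => by rw [mul_assoc]; exact hA.1 _ (hB.1 _ hC),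
      fun C hC => by rw [mul_inv_rev, mul_assoc]; exact hB.2 _ (hA.2 _ hC)⟩
  | inv A hA => exact ⟨hA.2, by simpa using hA.1⟩
  | gen j hj => exact ⟨fun B => mul j B hj, fun B => inv_mul j B hj⟩

/-- The underlying permutation of a braid, extended to all natural numbers by the identity. -/
def natPerm (n : ℕ) : BraidGroup n →* Equiv.Perm ℕ :=
  liftBraid (fun j => Equiv.swap j (j + 1)) (fun i _ => swap_braid i) (fun _ _ h _ => swap_comm h)

theorem natPerm_sig {n j : ℕ} (hj : j + 1 < n) : natPerm n (sig n j) = Equiv.swap j (j + 1) :=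
  liftBraid_sig _ _ _ hj

theorem natPerm_apply_inv {n : ℕ} (A : BraidGroup n) (a : ℕ) :
    natPerm n A (natPerm n A⁻¹ a) = a := by
  rw [← Equiv.Perm.mul_apply, ← map_mul, mul_inv_cancel, map_one, Equiv.Perm.one_apply]

theorem natPerm_inv_apply {n : ℕ} (A : BraidGroup n) (a : ℕ) :
    natPerm n A⁻¹ (natPerm n A a) = a := by
  rw [← Equiv.Perm.mul_apply, ← map_mul, inv_mul_cancel, map_one, Equiv.Perm.one_apply]

theorem val_perm {n : ℕ} (A : BraidGroup n) (a : Fin n) : (perm n A a : ℕ) = natPerm n A a := by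
  revert a
  induction A using braid_induction with
  | one => simp
  | mul A B hA hB => intro a; simp [hA, hB]
  | inv A hA =>
    intro a
    have := hA (perm n A⁻¹ a)
    rw [← Equiv.Perm.mul_apply, ← map_mul, mul_inv_cancel, map_one, Equiv.Perm.one_apply] at this
    rw [this, natPerm_inv_apply]
  | gen j hj =>
    intro a
    rw [perm, liftBraid_sig _ _ _ hj, val_adjSwap hj, natPerm_sig hj]

theorem natPerm_lt {n a : ℕ} (A : BraidGroup n) (h : a < n) : natPerm n A a < n := by
  rw [← val_perm A ⟨a, h⟩]; exact (perm n A ⟨a, h⟩).2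

theorem natPerm_of_le {n a : ℕ} (A : BraidGroup n) (h : n ≤ a) : natPerm n A a = a := by
  induction A using braid_induction with
  | one => simp
  | mul A B hA hB => simp [hA, hB]
  | inv A hA => rw [map_inv, Equiv.Perm.inv_eq_iff_eq, hA]
  | gen j hj =>
    rw [natPerm_sig hj, Equiv.swap_apply_of_ne_of_ne (by omega) (by omega)]

/-- `Rearr π l l'` means that the list `l'` has in position `a` the entry of `l` in
position `π a`. -/
def Rearr {α : Type*} (π : Equiv.Perm ℕ) (l l' : List α) : Prop := ∀ a : ℕ, l'[a]? = l[π a]?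

namespace Rearr

variable {α β : Type*} {π ρ : Equiv.Perm ℕ} {l l' l'' : List α}

theorem one (l : List α) : Rearr 1 l l := fun _ => rfl

theorem mul (h : Rearr π l l') (h' : Rearr ρ l' l'') : Rearr (π * ρ) l l'' :=
  fun a => (h' a).trans (h _)

theorem inv (h : Rearr π l l') : Rearr π⁻¹ l' l := fun a => by
  rw [h, ← Equiv.Perm.mul_apply, mul_inv_cancel, Equiv.Perm.one_apply]

theorem eq (h : Rearr π l l') (h' : Rearr π l l'') : l' = l'' :=
  List.ext_getElem? fun a => (h a).trans (h' a).symm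

theorem map (h : Rearr π l l') (f : α → β) : Rearr π (l.map f) (l'.map f) := fun a => by
  simp [h a]

theorem swap {P Q : List α} {j : ℕ} (x y : α) (h : P.length = j) :
    Rearr (Equiv.swap j (j + 1)) (P ++ y :: x :: Q) (P ++ x :: y :: Q) := by
  intro a
  subst h
  simp only [Equiv.swap_apply_def]
  rcases Nat.lt_trichotomy a P.length with h | rfl | h
  · rw [if_neg (by omega), if_neg (by omega), List.getElem?_append_left h,
      List.getElem?_append_left h]
  · simp
  · obtain ⟨b, rfl⟩ : ∃ b, a = P.length + 1 + b := ⟨a - P.length - 1, by omega⟩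
    rw [if_neg (by omega)]
    rw [List.getElem?_append_right (by omega)]
    cases b with
    | zero => simp [show P.length + 1 + 0 - P.length = 1 by omega]
    | succ b =>
      rw [if_neg (by omega), List.getElem?_append_right (by omega)]
      simp [show P.length + 1 + (b + 1) - P.length = b + 2 by omega]

end Rearr

/-- Every list of `N` letters can be rearranged by a braid on `N` strands. -/
theorem exists_rearr {α : Type*} {N : ℕ} (A : BraidGroup N) {l : List α} (h : l.length = N) :
    ∃ l', l'.length = N ∧ l'.Perm l ∧ Rearr (natPerm N A) l l' := by
  subst h
  refine ⟨List.ofFn (l.get ∘ perm _ A), by simp, ?_, ?_⟩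
  · have := Equiv.Perm.ofFn_comp_perm (perm _ A) l.get
    rwa [List.ofFn_get] at this
  · intro a
    rw [List.getElem?_ofFn]
    split_ifs with ha
    · have := val_perm A ⟨a, ha⟩
      simp [← this]
    · rw [natPerm_of_le _ (by omega), eq_comm, List.getElem?_eq_none (by omega)]

theorem Rearr.perm {α : Type*} {N : ℕ} {A : BraidGroup N} {l l' : List α} (h : l.length = N)
    (hl : Rearr (natPerm N A) l l') : l'.Perm l := by
  obtain ⟨l'', -, h2, h3⟩ := exists_rearr A h
  rwa [hl.eq h3]

theorem exists_eq_append_singleton {α : Type*} {l : List α} {a : ℕ} (h : l.length = a + 1) :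
    ∃ u x, l = u ++ [x] :=
  ⟨_, _, (List.dropLast_append_getLast (List.ne_nil_of_length_eq_add_one h)).symm⟩

/-- The strand of the letter `x` in position `o` crosses the letters `v`. -/
theorem rearr_strandCross {α : Type*} {N o b : ℕ} {P Q v : List α} {x : α} (hP : P.length = o)
    (hv : v.length = b) (hN : o + b < N) :
    Rearr (natPerm N (strandCross N o b)) (P ++ v ++ x :: Q) (P ++ x :: (v ++ Q)) := by
  induction b generalizing v Q with
  | zero =>
    obtain rfl := List.length_eq_zero_iff.1 hv
    simpa [strandCross] using Rearr.one _
  | succ b ih =>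
    obtain ⟨v, y, rfl⟩ := exists_eq_append_singleton hv
    simp only [List.length_append, List.length_cons, List.length_nil] at hv
    rw [strandCross, map_mul, natPerm_sig (by omega)]
    refine Rearr.mul (l' := P ++ v ++ x :: y :: Q) ?_ ?_
    · have := Rearr.swap (P := P ++ v) (Q := Q) (j := o + b) x y (by simp; omega)
      simpa using this
    · simpa using ih (Q := y :: Q) (v := v) (by omega) (by omega)

theorem rearr_blockCross {α : Type*} {N o a b : ℕ} {P Q u v : List α} (hP : P.length = o)
    (hu : u.length = a) (hv : v.length = b) (hN : o + a + b ≤ N) :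
    Rearr (natPerm N (blockCross N o a b)) (P ++ v ++ u ++ Q) (P ++ u ++ v ++ Q) := by
  induction a generalizing u Q with
  | zero =>
    obtain rfl := List.length_eq_zero_iff.1 hu
    simpa [blockCross] using Rearr.one _
  | succ a ih =>
    obtain ⟨u, x, rfl⟩ := exists_eq_append_singleton hu
    simp only [List.length_append, List.length_cons, List.length_nil] at hu
    rw [blockCross, map_mul]
    refine Rearr.mul (l' := P ++ u ++ v ++ x :: Q) ?_ ?_
    · simpa using ih (u := u) (Q := x :: Q) (by omega) (by omega)
    · have := rearr_strandCross (N := N) (o := o + a) (P := P ++ u) (Q := Q) (x := x)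
        (by simp; omega) hv (by omega)
      simpa using this

/-- The concatenation of the lists `l 0, …, l (L - 1)`. -/
def flat {α : Type*} (L : ℕ) (l : ℕ → List α) : List α := (List.range L).flatMap l

theorem flat_congr {α : Type*} {L : ℕ} {l l' : ℕ → List α} (h : ∀ a < L, l a = l' a) :
    flat L l = flat L l' := by
  rw [flat, flat, List.flatMap_congr]
  simpa using h

theorem length_flat {α : Type*} (L : ℕ) (l : ℕ → List α) :
    (flat L l).length = ∑ a ∈ Finset.range L, (l a).length := by
  induction L with
  | zero => rfl
  | succ L ih =>
    rw [Finset.sum_range_succ, ← ih]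
    simp [flat, List.range_succ]

theorem flat_add {α : Type*} (a b : ℕ) (l : ℕ → List α) :
    flat (a + b) l = flat a l ++ flat b fun i => l (a + i) := by
  simp [flat, List.range_add, List.flatMap_map]

theorem flat_one {α : Type*} (l : ℕ → List α) : flat 1 l = l 0 := by simp [flat]

theorem flat_split {α : Type*} {L i : ℕ} (h : i < L) (l : ℕ → List α) :
    flat L l = flat i l ++ l i ++ flat (L - (i + 1)) fun a => l (i + 1 + a) := by
  conv_lhs => rw [show L = i + 1 + (L - (i + 1)) by omega, flat_add, flat_add, flat_one]
  simp

theorem flat_split_two {α : Type*} {L i : ℕ} (h : i + 1 < L) (l : ℕ → List α) :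
    flat L l = flat i l ++ l i ++ l (i + 1) ++ flat (L - (i + 2)) fun a => l (i + 2 + a) := by
  conv_lhs => rw [show L = i + 1 + 1 + (L - (i + 2)) by omega, flat_add, flat_add, flat_add,
    flat_one, flat_one]
  simp

theorem cableAct_fst {L N : ℕ} (A : BraidGroup L) (x : Widths L N × BraidGroup N) :
    (cableAct L N A x).1.1 = x.1.1 ∘ natPerm L A⁻¹ := by
  induction A using braid_induction generalizing x with
  | one => simp
  | mul A B hA hB => simp [hA, hB, Function.comp_assoc]
  | inv A hA =>
    have := hA (cableAct L N A⁻¹ x)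
    rw [show cableAct L N A (cableAct L N A⁻¹ x) = x by simp] at this
    rw [this, Function.comp_assoc, inv_inv]
    funext a
    simp
  | gen j hj =>
    rw [cableAct, liftBraid_sig _ _ _ hj, cableGen_apply hj, map_inv, natPerm_sig hj]
    funext a
    simp [Widths.swap]

/-- The braid which `A` contributes to `cableAct` permutes blocks of the given widths in the way `A`
permutes positions. -/
theorem rearr_cableAct {α : Type*} {L N : ℕ} (A : BraidGroup L) (x : Widths L N × BraidGroup N)
    (l : ℕ → List α) (hl : ∀ j < L, (l j).length = x.1.1 j) :
    Rearr (natPerm N ((cableAct L N A x).2 * x.2⁻¹)) (flat L (l ∘ natPerm L A⁻¹)) (flat L l) := by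
  induction A using braid_induction generalizing x l with
  | one => simpa using Rearr.one _
  | mul A B hA hB =>
    have h1 := hB x l hl
    have h2 := hA (cableAct L N B x) (l ∘ natPerm L B⁻¹) (by
      intro j hj
      rw [cableAct_fst, Function.comp_apply, Function.comp_apply, hl]
      exact natPerm_lt _ hj)
    have := h2.mul h1
    rw [← map_mul] at this
    simpa [Function.comp_assoc, mul_assoc] using this
  | inv A hA =>
    have h := hA (cableAct L N A⁻¹ x) (l ∘ natPerm L A) (by
      intro j hj
      rw [cableAct_fst, Function.comp_apply, Function.comp_apply, hl _ (natPerm_lt _ hj),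
        inv_inv])
    have e : cableAct L N A (cableAct L N A⁻¹ x) = x := by simp
    rw [e, Function.comp_assoc] at h
    have := h.inv
    rw [← map_inv] at this
    have e2 : l ∘ (natPerm L A) ∘ natPerm L A⁻¹ = l := by
      funext a; simp
    rw [e2] at this
    simpa using this
  | gen j hj =>
    obtain ⟨k, b⟩ := x
    have hle := sum_range_le k.1 (show j + 2 ≤ L by omega)
    rw [k.2] at hle
    simp only [Finset.sum_range_succ] at hle
    rw [cableAct, liftBraid_sig _ _ _ hj, cableGen_apply hj, map_inv, natPerm_sig hj]
    simp only [mul_inv_cancel_right, Equiv.swap_inv]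
    rw [flat_split_two hj, flat_split_two hj]
    have e1 : flat j (l ∘ Equiv.swap j (j + 1)) = flat j l := flat_congr fun a ha => by
      rw [Function.comp_apply, Equiv.swap_apply_of_ne_of_ne (by omega) (by omega)]
    have e2 : (fun a => (l ∘ Equiv.swap j (j + 1)) (j + 2 + a)) = fun a => l (j + 2 + a) :=
      funext fun a => by
        rw [Function.comp_apply, Equiv.swap_apply_of_ne_of_ne (by omega) (by omega)]
    rw [e1, e2]
    simp only [Function.comp_apply, Equiv.swap_apply_left, Equiv.swap_apply_right]
    exact rearr_blockCross (by
      rw [length_flat]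
      exact Finset.sum_congr rfl fun a ha => hl a (by
        have := Finset.mem_range.1 ha
        omega)) (hl _ (by omega)) (hl _ hj) hle

/-- The permutation of a cabled braid permutes blocks. -/
theorem rearr_cable {α : Type*} {L N : ℕ} (A : BraidGroup L) (k : Widths L N) (l : ℕ → List α)
    (hl : ∀ j < L, (l j).length = k.1 j) :
    Rearr (natPerm N (cable k A)) (flat L l) (flat L (l ∘ natPerm L A)) := by
  have e : cableAct L N A ((cableAct L N A).symm (k, 1)) = (k, 1) := Equiv.apply_symm_apply _ _
  have h := rearr_cableAct A ((cableAct L N A).symm (k, 1)) (l ∘ natPerm L A) (by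
    intro j hj
    have h2 := cableAct_fst A ((cableAct L N A).symm (k, 1))
    rw [e] at h2
    rw [Function.comp_apply, hl _ (natPerm_lt _ hj), h2]
    simp)
  rw [e] at h
  have e2 : (l ∘ natPerm L A) ∘ natPerm L A⁻¹ = l := by
    funext a; simp
  rw [e2] at h
  simpa [cable] using h

theorem natPerm_shiftBraid {M N i : ℕ} (h : i + M ≤ N) (C : BraidGroup M) :
    (∀ t, natPerm N (shiftBraid i h C) (i + t) = i + natPerm M C t) ∧
      ∀ a < i, natPerm N (shiftBraid i h C) a = a := by
  induction C using braid_induction with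
  | one => simp
  | mul A B hA hB =>
    exact ⟨fun t => by simp [hA, hB], fun a ha => by simp [hA.2 a ha, hB.2 a ha]⟩
  | inv A hA =>
    refine ⟨fun t => ?_, fun a ha => ?_⟩
    · rw [map_inv, map_inv, Equiv.Perm.inv_eq_iff_eq, hA.1, natPerm_apply_inv]
    · rw [map_inv, map_inv, Equiv.Perm.inv_eq_iff_eq, hA.2 a ha]
  | gen j hj =>
    rw [shiftBraid, liftBraid_sig _ _ _ hj, natPerm_sig (by omega), natPerm_sig hj]
    refine ⟨fun t => ?_, fun a ha => ?_⟩
    · simp only [Equiv.swap_apply_def]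
      split_ifs <;> omega
    · rw [Equiv.swap_apply_of_ne_of_ne (by omega) (by omega)]

theorem rearr_shiftBraid {α : Type*} {M N i : ℕ} (h : i + M ≤ N) {C : BraidGroup M}
    {P Q v v' : List α} (hP : P.length = i) (hv : v.length = M)
    (hC : Rearr (natPerm M C) v v') :
    Rearr (natPerm N (shiftBraid i h C)) (P ++ v ++ Q) (P ++ v' ++ Q) := by
  obtain ⟨h1, h2⟩ := natPerm_shiftBraid h C
  have hv' : v'.length = M := (hC.perm hv).length_eq.trans hv
  intro a
  rw [List.append_assoc, List.append_assoc]
  rcases Nat.lt_or_ge a i with ha | ha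
  · rw [h2 a ha, List.getElem?_append_left (by omega), List.getElem?_append_left (by omega)]
  · obtain ⟨t, rfl⟩ : ∃ t, a = i + t := ⟨a - i, by omega⟩
    subst hP
    have aux (R : List α) (s : ℕ) : (P ++ R)[P.length + s]? = R[s]? := by
      rw [List.getElem?_append_right (by omega), Nat.add_sub_cancel_left]
    rw [h1, aux, aux]
    rcases Nat.lt_or_ge t M with ht | ht
    · rw [List.getElem?_append_left (by omega), List.getElem?_append_left, hC]
      rw [hv]; exact natPerm_lt _ ht
    · rw [natPerm_of_le _ ht, List.getElem?_append_right (by omega),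
        List.getElem?_append_right (by omega), hv, hv']

/-- The permutation of a partial composition: the block of the strands in position `i` is permuted
by `C`, and the blocks are permuted by `A`. -/
theorem rearr_braidComp {α : Type*} {L M : ℕ} (A : BraidGroup L) (i : Fin L) (C : BraidGroup M)
    (l l' : ℕ → List α) (hl : ∀ j, j < L → j ≠ i → l' j = l j ∧ (l j).length = 1)
    (hi : (l i).length = M) (hC : Rearr (natPerm M C) (l i) (l' i)) :
    Rearr (natPerm (L - 1 + M) (braidComp A i C)) (flat L l) (flat L (l' ∘ natPerm L A)) := by
  have hi' : (l' i).length = M := (hC.perm hi).length_eq.trans hi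
  have h1 := rearr_cable A ⟨fun a => if a = (i : ℕ) then M else 1, sum_single i M⟩ l' (by
    intro j hj
    simp only
    split_ifs with h
    · rw [h, hi']
    · rw [(hl j hj h).1, (hl j hj h).2])
  rw [braidComp, map_mul]
  refine Rearr.mul ?_ h1
  have hi2 := i.2
  rw [flat_split i.2 l, flat_split i.2 l']
  have e1 : flat (i : ℕ) l' = flat i l := flat_congr fun a ha => (hl a (by omega) (by omega)).1
  have e2 : flat (L - ((i : ℕ) + 1)) (fun a => l' (i + 1 + a)) =
      flat (L - ((i : ℕ) + 1)) (fun a => l (i + 1 + a)) :=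
    flat_congr fun a ha => (hl _ (by omega) (by omega)).1
  rw [e1, e2]
  refine rearr_shiftBraid _ ?_ hi hC
  rw [length_flat, Finset.sum_congr rfl (fun a ha => (hl a (by
    have := Finset.mem_range.1 ha
    omega) (by have := Finset.mem_range.1 ha; omega)).2)]
  simp

end WeakBraid

/-! ### Shapes and leaves of words -/

namespace WeakBraid

namespace PTree

variable {α β γ : Type}

theorem length_leaves_shape (p : PTree α) : p.shape.leaves.length = p.leaves.length := by
  induction p with
  | unit => rfl
  | leaf a => rfl
  | node l r hl hr => simp [shape, leaves, hl, hr]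

theorem length_leaves_of_shape {p : PTree α} {q : PTree β} (h : p.shape = q.shape) :
    p.leaves.length = q.leaves.length := by
  rw [← length_leaves_shape p, h, length_leaves_shape]

theorem length_leaves_pos (p : PTree α) : 0 < p.leaves.length := by
  induction p with
  | unit => simp [leaves]
  | leaf a => simp [leaves]
  | node l r hl hr => simp [leaves]; omega

/-- A word is determined by its parentheses and its letters. -/
theorem eq_of_shape_leaves {p q : PTree α} (h : p.shape = q.shape) (h' : p.leaves = q.leaves) :
    p = q := by
  induction p generalizing q with
  | unit => cases q <;> simp_all [shape, leaves]
  | leaf a => cases q <;> simp_all [shape, leaves]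
  | node l r hl hr =>
    cases q with
    | unit => simp [shape] at h
    | leaf a => simp [shape] at h
    | node l' r' =>
      simp only [shape, node.injEq] at h
      obtain ⟨h1, h2⟩ := List.append_inj h' (length_leaves_of_shape h.1)
      rw [hl h.1 h1, hr h.2 h2]

theorem shape_bind_congr {p : PTree α} {q : PTree β} {f : α → PTree γ} {δ : Type} {g : β → PTree δ}
    (h : p.shape = q.shape)
    (h' : (p.leaves.map fun o => (o.elim .unit f).shape) =
      q.leaves.map fun o => (o.elim .unit g).shape) :
    (p.bind f).shape = (q.bind g).shape := by
  induction p generalizing q with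
  | unit => cases q <;> simp_all [shape, leaves, bind]
  | leaf a => cases q <;> simp_all [shape, leaves, bind]
  | node l r hl hr =>
    cases q with
    | unit => simp [shape] at h
    | leaf a => simp [shape] at h
    | node l' r' =>
      simp only [shape, node.injEq] at h
      simp only [leaves, List.map_append] at h'
      obtain ⟨h1, h2⟩ := List.append_inj h' (by simpa using length_leaves_of_shape h.1)
      simp only [bind, shape, hl h.1 h1, hr h.2 h2]

theorem shape_map (f : α → β) (p : PTree α) : (p.map f).shape = p.shape := by
  induction p with
  | unit => rfl
  | leaf a => rfl
  | node l r hl hr =>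
    simp only [map] at hl hr
    simp [map, bind, shape, hl, hr]

/-- The word with the single letter `o`, where `none` stands for `x_0`. -/
def ofOption : Option α → PTree α
  | none => unit
  | some a => leaf a

/-- The word with the parentheses of `p` and with the letters from the list `L`. -/
def fill : PTree α → List (Option β) → PTree β
  | unit, L => ofOption L.head?.join
  | leaf _, L => ofOption L.head?.join
  | node l r, L => node (l.fill (L.take l.leaves.length)) (r.fill (L.drop l.leaves.length))

theorem leaves_ofOption (o : Option α) : (ofOption o).leaves = [o] := by
  cases o <;> rfl

theorem shape_ofOption (o : Option α) : (ofOption o).shape = .leaf () := by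
  cases o <;> rfl

theorem shape_fill (p : PTree α) (L : List (Option β)) : (p.fill L).shape = p.shape := by
  induction p generalizing L with
  | unit => exact shape_ofOption _
  | leaf a => exact shape_ofOption _
  | node l r hl hr => simp [fill, shape, hl, hr]

theorem leaves_fill (p : PTree α) {L : List (Option β)} (h : L.length = p.leaves.length) :
    (p.fill L).leaves = L := by
  induction p generalizing L with
  | unit =>
    obtain ⟨a, rfl⟩ := List.length_eq_one_iff.1 h
    exact leaves_ofOption _
  | leaf a =>
    obtain ⟨a, rfl⟩ := List.length_eq_one_iff.1 h
    exact leaves_ofOption _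
  | node l r hl hr =>
    simp only [leaves, List.length_append] at h
    simp only [fill, leaves]
    rw [hl (by simp; omega), hr (by simp; omega), List.take_append_drop]

/-- The right comb of a list of words. -/
def comb : List (PTree α) → PTree α
  | [] => unit
  | [b] => b
  | b :: b' :: m => node b (comb (b' :: m))

theorem vars_node (l r : PTree α) : (node l r).vars = l.vars ++ r.vars := by
  simp [vars, leaves, List.reduceOption_append]

theorem vars_comb (m : List (PTree α)) : (comb m).vars = m.flatMap vars := by
  induction m with
  | nil => rfl
  | cons b m ih =>
    cases m with
    | nil => simp [comb]
    | cons b' m => rw [comb, vars_node, ih]; rfl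

theorem leaves_comb {m : List (PTree α)} (h : m ≠ []) : (comb m).leaves = m.flatMap leaves := by
  induction m with
  | nil => exact absurd rfl h
  | cons b m ih =>
    cases m with
    | nil => simp [comb]
    | cons b' m => rw [comb, leaves, ih (by simp)]; rfl

theorem bind_comb (f : α → PTree β) (m : List (PTree α)) :
    (comb m).bind f = comb (m.map (bind f)) := by
  induction m with
  | nil => rfl
  | cons b m ih =>
    cases m with
    | nil => rfl
    | cons b' m => simp only [comb, bind, ih, List.map_cons]

/-- The first number in a word of numbers. -/
def start (p : PTree ℕ) : ℕ := p.vars.headD 0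

/-- Words of numbers, ordered by their first numbers. -/
def startLE (p q : PTree ℕ) : Bool := decide (p.start ≤ q.start)

open Classical in
/-- The maximal subwords of `p` whose numbers form an interval, with the subwords rearranged in such
a way that the numbers in each of them are in increasing order, and listed in increasing order. -/
noncomputable def blocks : PTree ℕ → List (PTree ℕ)
  | unit => []
  | leaf s => [leaf s]
  | node l r =>
    let m := (l.blocks ++ r.blocks).mergeSort startLE
    if ∃ s n, m.flatMap vars = List.range' s (n + 1) then [comb m] else m

/-- Rearrangement of a word of numbers in increasing order. Subwords whose numbers form an interval
remain subwords. -/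
noncomputable def rewind (p : PTree ℕ) : PTree ℕ := comb p.blocks

theorem blocks_perm (p : PTree ℕ) : (p.blocks.flatMap vars).Perm p.vars := by
  induction p with
  | unit => exact List.Perm.refl _
  | leaf s => exact List.Perm.refl _
  | node l r hl hr =>
    have h : (((l.blocks ++ r.blocks).mergeSort startLE).flatMap vars).Perm (node l r).vars := by
      refine ((List.mergeSort_perm _ _).flatMap_right _).trans ?_
      rw [List.flatMap_append, vars_node]
      exact hl.append hr
    rw [blocks]
    split_ifs
    · simpa [vars_comb] using h
    · exact h

theorem exists_vars_of_mem_blocks {p b : PTree ℕ} (h : b ∈ p.blocks) :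
    ∃ s n, b.vars = List.range' s (n + 1) := by
  induction p with
  | unit => simp [blocks] at h
  | leaf s =>
    obtain rfl := List.mem_singleton.1 h
    exact ⟨s, 0, rfl⟩
  | node l r hl hr =>
    rw [blocks] at h
    split_ifs at h with hm
    · obtain rfl := List.mem_singleton.1 h
      rwa [vars_comb]
    · rw [List.mem_mergeSort, List.mem_append] at h
      exact h.elim hl hr

theorem leaves_of_mem_blocks {p b : PTree ℕ} (h : b ∈ p.blocks) : b.leaves = b.vars.map some := by
  induction p generalizing b with
  | unit => simp [blocks] at h
  | leaf s =>
    obtain rfl := List.mem_singleton.1 h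
    rfl
  | node l r hl hr =>
    have H : ∀ b ∈ (l.blocks ++ r.blocks).mergeSort startLE, b.leaves = b.vars.map some := by
      intro b hb
      rw [List.mem_mergeSort, List.mem_append] at hb
      exact hb.elim hl hr
    rw [blocks] at h
    split_ifs at h with hm
    · obtain rfl := List.mem_singleton.1 h
      obtain ⟨s, n, hm⟩ := hm
      rw [vars_comb, leaves_comb (by rintro e; simp [e] at hm), List.map_flatMap]
      exact List.flatMap_congr H
    · exact H b h

theorem start_eq {b : PTree ℕ} {s n : ℕ} (h : b.vars = List.range' s (n + 1)) : b.start = s := by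
  rw [start, h]; rfl

theorem pairwise_flatMap_vars {m : List (PTree ℕ)}
    (h1 : ∀ b ∈ m, ∃ s n, b.vars = List.range' s (n + 1)) (h2 : (m.flatMap vars).Nodup)
    (h3 : m.Pairwise fun b b' => startLE b b') : (m.flatMap vars).Pairwise (· < ·) := by
  induction m with
  | nil => simp
  | cons b m ih =>
    rw [List.flatMap_cons, List.nodup_append] at h2
    rw [List.pairwise_cons] at h3
    rw [List.flatMap_cons, List.pairwise_append]
    obtain ⟨s, n, hb⟩ := h1 b (by simp)
    refine ⟨hb ▸ List.pairwise_lt_range', ih (fun b hb => h1 b (by simp [hb])) h2.2.1 h3.2, ?_⟩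
    intro x hx y hy
    obtain ⟨b', hb', hy⟩ := List.mem_flatMap.1 hy
    obtain ⟨s', n', e⟩ := h1 b' (by simp [hb'])
    have h4 : s ≤ s' := by
      have := h3.1 b' hb'
      rwa [startLE, start_eq hb, start_eq e, decide_eq_true_eq] at this
    have h5 : s' ∉ b.vars := fun h =>
      h2.2.2 s' h s' (List.mem_flatMap.2 ⟨b', hb', by rw [e]; simp⟩) rfl
    rw [hb, List.mem_range'_1] at h5 hx
    rw [e, List.mem_range'_1] at hy
    omega

/-- If the numbers of a word fill an interval, then its blocks have been joined to one word. -/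
theorem exists_blocks_eq {p : PTree ℕ} {s n : ℕ} (h : p.vars.Perm (List.range' s (n + 1))) :
    ∃ b, p.blocks = [b] ∧ b.vars = List.range' s (n + 1) := by
  cases p with
  | unit =>
    have := h.length_eq
    simp [vars, leaves] at this
  | leaf a =>
    refine ⟨leaf a, rfl, ?_⟩
    have := h.length_eq
    simp only [vars, leaves] at h this ⊢
    simp only [List.length_range', List.reduceOption_cons_of_some, List.reduceOption_nil,
      List.length_singleton] at this
    obtain rfl : n = 0 := by omega
    exact List.singleton_perm_singleton.1 h ▸ rfl
  | node l r =>
    set m := (l.blocks ++ r.blocks).mergeSort startLE with hm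
    have hp : (m.flatMap vars).Perm (List.range' s (n + 1)) := by
      refine ((List.mergeSort_perm _ _).flatMap_right _).trans ?_
      rw [List.flatMap_append]
      rw [vars_node] at h
      exact ((blocks_perm l).append (blocks_perm r)).trans h
    have hs : m.Pairwise fun b b' => startLE b b' := by
      refine List.pairwise_mergeSort ?_ ?_ _
      · intro a b c h1 h2
        simp only [startLE, decide_eq_true_eq] at *
        omega
      · intro a b
        simp only [startLE, Bool.or_eq_true, decide_eq_true_eq]
        omega
    have h1 : ∀ b ∈ m, ∃ s n, b.vars = List.range' s (n + 1) := by
      intro b hb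
      rw [hm, List.mem_mergeSort, List.mem_append] at hb
      exact hb.elim exists_vars_of_mem_blocks exists_vars_of_mem_blocks
    have h2 := pairwise_flatMap_vars h1 (hp.nodup_iff.2 List.nodup_range') hs
    have h3 : m.flatMap vars = List.range' s (n + 1) :=
      hp.eq_of_pairwise (fun a b _ _ h h' => absurd h (Nat.lt_asymm h')) h2 List.pairwise_lt_range'
    exact ⟨comb m, if_pos ⟨s, n, h3⟩, (vars_comb m).trans h3⟩

/-- A word whose numbers are in order is not changed. -/
theorem blocks_of_ordered {p : PTree ℕ} (h : p.leaves = p.vars.map some) {s n : ℕ}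
    (hv : p.vars = List.range' s n) : p.blocks = [p] := by
  induction p generalizing s n with
  | unit => simp [leaves, vars] at h
  | leaf a => rfl
  | node l r hl hr =>
    rw [vars_node] at hv h
    rw [leaves, List.map_append] at h
    have aux (q : PTree ℕ) : q.vars.length ≤ q.leaves.length := List.reduceOption_length_le _
    have e := congrArg List.length h
    simp only [List.length_append, List.length_map] at e
    have hl' := aux l
    have hr' := aux r
    obtain ⟨h1, h2⟩ := List.append_inj h (by simp; omega)
    have hlp := length_leaves_pos l
    have hrp := length_leaves_pos r
    obtain ⟨a, ha⟩ : ∃ a, l.vars.length = a + 1 := ⟨l.vars.length - 1, by omega⟩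
    obtain ⟨b, hb⟩ : ∃ b, r.vars.length = b + 1 := ⟨r.vars.length - 1, by omega⟩
    have en : n = (a + 1) + (b + 1) := by
      have := congrArg List.length hv
      simp only [List.length_append, List.length_range'] at this
      omega
    have hv' := hv
    rw [en, ← List.range'_append_1] at hv'
    obtain ⟨h3, h4⟩ := List.append_inj hv' (by simp [ha])
    have hsort : ([l] ++ [r]).mergeSort startLE = [l, r] := by
      refine List.mergeSort_of_pairwise ?_
      simp [startLE, start_eq h3, start_eq h4]
    rw [blocks, hl h1 h3, hr h2 h4, hsort, if_pos]
    · rfl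
    · exact ⟨s, a + 1 + b, by simp [hv, en, add_assoc]⟩

section Substitution

variable {K k : ℕ → ℕ}

theorem flatMap_range' (hK : ∀ s, K (s + 1) = K s + k s) (s n : ℕ) :
    ((List.range' s n).flatMap fun t => List.range' (K t) (k t)) =
      List.range' (K s) (K (s + n) - K s) := by
  have hmono : Monotone K := monotone_nat_of_le_succ fun s => by rw [hK]; omega
  induction n generalizing s with
  | zero => simp
  | succ n ih =>
    have h1 : K (s + 1) ≤ K (s + 1 + n) := hmono (by omega)
    rw [List.range'_succ, List.flatMap_cons, ih, hK, List.range'_append_1,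
      show s + (n + 1) = s + 1 + n by omega]
    rw [hK] at h1
    congr 1
    omega

theorem eq_range'_of_flatMap (hK : ∀ s, K (s + 1) = K s + k s) (hk : ∀ s, 0 < k s) {l : List ℕ}
    {S N : ℕ} (h : (l.flatMap fun t => List.range' (K t) (k t)) = List.range' S N) :
    l = List.range' (l.headD 0) l.length := by
  have hmono : StrictMono K := strictMono_nat_of_lt_succ fun s => by rw [hK]; have := hk s; omega
  induction l generalizing S N with
  | nil => rfl
  | cons a l ih =>
    rw [List.flatMap_cons] at h
    have hN : k a ≤ N := by
      have := congrArg List.length h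
      simp only [List.length_append, List.length_range'] at this
      omega
    rw [show N = k a + (N - k a) by omega, ← List.range'_append_1] at h
    obtain ⟨h1, h2⟩ := List.append_inj h (by simp)
    have ih := ih h2
    have hS : S = K a := by
      obtain ⟨c, hc⟩ : ∃ c, k a = c + 1 := ⟨k a - 1, by have := hk a; omega⟩
      rw [hc, List.range'_succ, List.range'_succ] at h1
      exact (List.cons.inj h1).1.symm
    cases l with
    | nil => rfl
    | cons b l =>
      obtain ⟨c, hc⟩ : ∃ c, k b = c + 1 := ⟨k b - 1, by have := hk b; omega⟩
      have hb : K b = K (a + 1) := by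
        have := congrArg (fun l => l.head?) h2
        rw [List.flatMap_cons, hc, List.range'_succ] at this
        cases hM : N - k a with
        | zero => simp [hM] at this
        | succ M =>
          simp only [hM, List.range'_succ, List.cons_append, List.head?_cons,
            Option.some.injEq] at this
          rw [hK]; omega
      obtain rfl := hmono.injective hb
      rw [ih]
      simp [List.range'_succ]

/-- The construction of `blocks` is compatible with substitution of words `F s` with rearrangement
`F' s`. -/
theorem blocks_bind (hK : ∀ s, K (s + 1) = K s + k s) (hk : ∀ s, 0 < k s) {F F' : ℕ → PTree ℕ}
    {p : PTree ℕ}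
    (hF : ∀ s ∈ p.vars, (F s).blocks = [F' s] ∧ (F' s).vars = List.range' (K s) (k s)) :
    (p.bind F).blocks = p.blocks.map (bind F') := by
  have hmono : StrictMono K := strictMono_nat_of_lt_succ fun s => by rw [hK]; have := hk s; omega
  induction p with
  | unit => rfl
  | leaf s => simpa [bind, blocks] using (hF s (by simp [vars, leaves])).1
  | node l r hl hr =>
    rw [vars_node] at hF
    have hl := hl fun s hs => hF s (List.mem_append_left _ hs)
    have hr := hr fun s hs => hF s (List.mem_append_right _ hs)
    have hmem : ∀ b ∈ l.blocks ++ r.blocks, b.vars ⊆ l.vars ++ r.vars := by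
      intro b hb x hx
      rw [List.mem_append] at hb ⊢
      exact hb.imp (fun h => (blocks_perm l).subset (List.mem_flatMap.2 ⟨b, h, hx⟩))
        (fun h => (blocks_perm r).subset (List.mem_flatMap.2 ⟨b, h, hx⟩))
    have hvars : ∀ b ∈ l.blocks ++ r.blocks, (b.bind F').vars =
        b.vars.flatMap fun t => List.range' (K t) (k t) := by
      intro b hb
      rw [vars_bind]
      exact List.flatMap_congr fun s hs => (hF s (hmem b hb hs)).2
    have hstart : ∀ b ∈ l.blocks ++ r.blocks, (b.bind F').start = K b.start := by
      intro b hb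
      obtain ⟨s, n, h⟩ : ∃ s n, b.vars = List.range' s (n + 1) :=
        (List.mem_append.1 hb).elim exists_vars_of_mem_blocks exists_vars_of_mem_blocks
      obtain ⟨c, hc⟩ : ∃ c, k s = c + 1 := ⟨k s - 1, by have := hk s; omega⟩
      rw [start_eq h, start, hvars b hb, h, List.range'_succ, List.flatMap_cons, hc,
        List.range'_succ]
      rfl
    have hsort : ((l.blocks ++ r.blocks).map (bind F')).mergeSort startLE =
        ((l.blocks ++ r.blocks).mergeSort startLE).map (bind F') := by
      refine (List.map_mergeSort fun a ha b hb => ?_).symm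
      rw [startLE, startLE, hstart a ha, hstart b hb]
      simp only [hmono.le_iff_le]
    have hflat : (((l.blocks ++ r.blocks).mergeSort startLE).map (bind F')).flatMap vars =
        (((l.blocks ++ r.blocks).mergeSort startLE).flatMap vars).flatMap
          fun t => List.range' (K t) (k t) := by
      rw [List.flatMap_map, List.flatMap_assoc]
      exact List.flatMap_congr fun b hb => hvars b (List.mem_mergeSort.1 hb)
    rw [bind, blocks, blocks, hl, hr, ← List.map_append, hsort, hflat]
    generalize (l.blocks ++ r.blocks).mergeSort startLE = m
    by_cases h : ∃ s n, m.flatMap vars = List.range' s (n + 1)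
    · rw [if_pos h, if_pos]
      · simp [bind_comb]
      · obtain ⟨s, n, h⟩ := h
        have h2 : K s < K (s + (n + 1)) := hmono (by omega)
        exact ⟨K s, K (s + (n + 1)) - K s - 1, by
          rw [h, flatMap_range' hK]
          congr 1
          omega⟩
    · rw [if_neg h, if_neg]
      rintro ⟨S, N, h'⟩
      refine h ⟨(m.flatMap vars).headD 0, (m.flatMap vars).length - 1,
        (eq_range'_of_flatMap hK hk h').trans ?_⟩
      have : m.flatMap vars ≠ [] := by
        rintro e
        simp [e] at h'
      have := List.length_pos_iff.2 this
      congr 1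
      omega

end Substitution

end PTree

end WeakBraid

/-! ### The word obtained by undoing the braid -/

namespace WeakBraid

theorem PTree.shape_bind_of_leaf {α β : Type} {f : α → PTree β} (hf : ∀ a, (f a).shape = .leaf ())
    (p : PTree α) : (p.bind f).shape = p.shape := by
  induction p with
  | unit => rfl
  | leaf a => exact hf a
  | node l r hl hr => rw [bind, shape, shape, hl, hr]

theorem flat_getD {α β : Type*} (l : List α) (d : α) (g : α → List β) :
    flat l.length (fun j => g (l.getD j d)) = l.flatMap g := by
  induction l with
  | nil => rfl
  | cons a l ih =>
    rw [List.length_cons, add_comm, flat_add, flat_one, List.flatMap_cons, ← ih]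
    congr 1
    exact flat_congr fun j _ => by rw [add_comm 1 j, List.getD_cons_succ]

theorem flatMap_toList {α : Type*} (l : List (Option α)) :
    l.flatMap Option.toList = l.reduceOption := by
  induction l with
  | nil => rfl
  | cons a l ih => cases a <;> simp [ih]

theorem Omega.eq_of_tree {n : ℕ} {p q : Omega n} (h : p.tree = q.tree) : p = q := by
  cases p; cases q; cases h; rfl

theorem Omega.getElem?_vars {n : ℕ} (p : Omega n) (a : Fin n) :
    p.tree.vars[(a : ℕ)]? = some (p.tau a) := by
  rw [List.getElem?_eq_getElem (by rw [p.vars_length]; exact a.2)]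
  rfl

namespace WPaB

variable {n m : ℕ}

/-- The letters of the word at the places where the strands of the braid start. -/
def source (x : WPaB n) : List (Option (Fin n)) :=
  (List.range x.len).map fun a => x.word.tree.leaves.getD (natPerm x.len x.braid a) none

/-- The places where the strands start, listed in the order in which the strands end. -/
def starts (x : WPaB n) : List ℕ := (List.range x.len).map (natPerm x.len x.braid⁻¹)

theorem length_leaves (x : WPaB n) : x.word.tree.leaves.length = x.len := x.len_eq

theorem length_source (x : WPaB n) : x.source.length = x.len := by simp [source]

theorem length_starts (x : WPaB n) : x.starts.length = x.len := by simp [starts]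

theorem len_pos (x : WPaB n) : 0 < x.len := by
  rw [← x.length_leaves]; exact PTree.length_leaves_pos _

theorem getD_source (x : WPaB n) {a : ℕ} (h : a < x.len) :
    x.source.getD a none = x.word.tree.leaves.getD (natPerm x.len x.braid a) none := by
  simp [source, h]

theorem rearr_source (x : WPaB n) :
    Rearr (natPerm x.len x.braid) x.word.tree.leaves x.source := by
  intro a
  rcases Nat.lt_or_ge a x.len with h | h
  · have h2 : natPerm x.len x.braid a < x.word.tree.leaves.length := by
      rw [length_leaves]; exact natPerm_lt _ h
    simp [source, h, h2]
  · rw [natPerm_of_le _ h, List.getElem?_eq_none (by rwa [length_source]),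
      List.getElem?_eq_none (by rwa [length_leaves])]

theorem rearr_starts (x : WPaB n) :
    Rearr (natPerm x.len x.braid) x.starts (List.range x.len) := by
  intro a
  rcases Nat.lt_or_ge a x.len with h | h
  · simp [starts, h, natPerm_lt]
  · rw [natPerm_of_le _ h, List.getElem?_eq_none (by simpa),
      List.getElem?_eq_none (by rwa [length_starts])]

theorem source_perm (x : WPaB n) : x.source.Perm x.word.tree.leaves :=
  x.rearr_source.perm x.length_leaves

theorem starts_perm (x : WPaB n) : x.starts.Perm (List.range x.len) :=
  (x.rearr_starts.perm x.length_starts).symm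

/-- The word with every letter replaced by the place where its strand starts. -/
def label (x : WPaB n) : PTree ℕ := x.word.tree.fill (x.starts.map some)

theorem shape_label (x : WPaB n) : x.label.shape = x.word.tree.shape := PTree.shape_fill _ _

theorem leaves_label (x : WPaB n) : x.label.leaves = x.starts.map some :=
  PTree.leaves_fill _ (by rw [List.length_map, length_starts, length_leaves])

theorem vars_label (x : WPaB n) : x.label.vars = x.starts := by
  rw [PTree.vars, leaves_label]
  simp [List.reduceOption]

theorem exists_blocks_label (x : WPaB n) :
    ∃ b, x.label.blocks = [b] ∧ b.vars = List.range' 0 x.len := by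
  obtain ⟨c, hc⟩ : ∃ c, x.len = c + 1 := ⟨x.len - 1, by have := x.len_pos; omega⟩
  have := x.starts_perm
  rw [← vars_label, List.range_eq_range', hc] at this
  rw [hc]
  exact PTree.exists_blocks_eq this

theorem blocks_label (x : WPaB n) : x.label.blocks = [x.label.rewind] := by
  obtain ⟨b, hb, -⟩ := x.exists_blocks_label
  rw [PTree.rewind, hb, PTree.comb]

theorem vars_rewind (x : WPaB n) : x.label.rewind.vars = List.range' 0 x.len := by
  obtain ⟨b, hb, h⟩ := x.exists_blocks_label
  rw [PTree.rewind, hb, PTree.comb, h]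

theorem leaves_rewind (x : WPaB n) : x.label.rewind.leaves = (List.range x.len).map some := by
  rw [PTree.leaves_of_mem_blocks (p := x.label) (by rw [blocks_label]; simp), vars_rewind,
    List.range_eq_range']

/-- A word whose letters are in the order in which the strands of the braid start. Every subword
that starts in adjacent places remains a subword, so that this is compatible with the operadic
composition. -/
noncomputable def unbraidTree (x : WPaB n) : PTree (Fin n) :=
  x.label.rewind.bind fun s => .ofOption (x.source.getD s none)

theorem leaves_unbraidTree (x : WPaB n) : x.unbraidTree.leaves = x.source := by
  rw [unbraidTree, PTree.leaves_bind, leaves_rewind, List.flatMap_map]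
  simp only [Option.elim_some, PTree.leaves_ofOption]
  have := flat_getD x.source none fun o => [o]
  rw [List.flatMap_singleton', length_source] at this
  exact this

theorem shape_unbraidTree (x : WPaB n) : x.unbraidTree.shape = x.label.rewind.shape :=
  PTree.shape_bind_of_leaf (fun _ => PTree.shape_ofOption _) _

theorem vars_perm (x : WPaB n) {t : PTree (Fin n)} (h : t.leaves = x.source) :
    t.vars.Perm x.word.tree.vars := by
  rw [PTree.vars, h]
  exact x.source_perm.filterMap _

/-- The word `unbraidTree`, in which every letter `x_1, …, x_n` occurs exactly once. -/
noncomputable def unbraid (x : WPaB n) : Omega n where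
  tree := x.unbraidTree
  nodup := (x.vars_perm x.leaves_unbraidTree).nodup_iff.2 x.word.nodup
  mem i := (x.vars_perm x.leaves_unbraidTree).mem_iff.2 (x.word.mem i)

/-- The word with the parentheses of the word of `x`, and with the letters in the order in which
the strands of the braid start. -/
def unwind (x : WPaB n) : Omega n where
  tree := x.word.tree.fill x.source
  nodup := (x.vars_perm (PTree.leaves_fill _
    (x.length_source.trans x.length_leaves.symm))).nodup_iff.2 x.word.nodup
  mem i := (x.vars_perm (PTree.leaves_fill _
    (x.length_source.trans x.length_leaves.symm))).mem_iff.2 (x.word.mem i)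

theorem leaves_unwind (x : WPaB n) : x.unwind.tree.leaves = x.source :=
  PTree.leaves_fill _ (x.length_source.trans x.length_leaves.symm)

theorem shape_unwind (x : WPaB n) : x.unwind.tree.shape = x.word.tree.shape :=
  PTree.shape_fill _ _

theorem source_ofWord (p : Omega n) : (ofWord p).source = p.tree.leaves := by
  have h := (ofWord p).rearr_source
  have e : natPerm (ofWord p).len (ofWord p).braid = 1 := map_one _
  rw [e] at h
  exact h.eq (Rearr.one _)

theorem starts_ofWord (p : Omega n) : (ofWord p).starts = List.range p.len := by
  have h := (ofWord p).rearr_starts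
  have e : natPerm (ofWord p).len (ofWord p).braid = 1 := map_one _
  rw [e] at h
  exact (h.eq (Rearr.one _)).symm

theorem unbraid_ofWord (p : Omega n) : (ofWord p).unbraid = p := by
  refine Omega.eq_of_tree (PTree.eq_of_shape_leaves ?_ ?_)
  · refine (shape_unbraidTree _).trans (Eq.trans ?_ (ofWord p).shape_label)
    rw [PTree.rewind, PTree.blocks_of_ordered (s := 0) (n := p.len)]
    · rfl
    · rw [vars_label, leaves_label]
    · rw [vars_label, starts_ofWord, List.range_eq_range']
  · exact (leaves_unbraidTree _).trans (source_ofWord p)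

theorem source_smul (s : Equiv.Perm (Fin n)) (x : WPaB n) :
    (x.smul s).source = x.source.map (Option.map s) := by
  have h := (x.smul s).rearr_source
  rw [show (x.smul s).word.tree.leaves = _ from PTree.leaves_map s x.word.tree] at h
  exact h.eq (x.rearr_source.map _)

theorem label_smul (s : Equiv.Perm (Fin n)) (x : WPaB n) : (x.smul s).label = x.label := by
  refine PTree.eq_of_shape_leaves ?_ ?_
  · rw [shape_label, shape_label]
    exact PTree.shape_map _ _
  · rw [leaves_label, leaves_label]; rfl

theorem unbraid_smul (s : Equiv.Perm (Fin n)) (x : WPaB n) :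
    (x.smul s).unbraid = x.unbraid.smul s := by
  refine Omega.eq_of_tree (PTree.eq_of_shape_leaves ?_ ?_)
  · refine (shape_unbraidTree _).trans ?_
    rw [label_smul]
    exact (shape_unbraidTree _).symm.trans (PTree.shape_map _ _).symm
  · refine (leaves_unbraidTree _).trans ?_
    rw [source_smul, ← leaves_unbraidTree]
    exact (PTree.leaves_map _ _).symm

theorem rearr_strip (x : WPaB n) :
    Rearr (natPerm n x.strip) x.word.tree.vars x.source.reduceOption := by
  have h := rearr_cable (N := n) x.braid
    ⟨fun a => if (x.word.tree.leaves.getD a none).isSome then 1 else 0, by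
      rw [← x.len_eq]
      exact (Omega.sum_mask _).trans x.word.vars_length⟩
    (fun j => (x.word.tree.leaves.getD j none).toList) (by
      intro j _
      dsimp only
      cases x.word.tree.leaves.getD j none <;> rfl)
  have e1 : flat x.len (fun j => (x.word.tree.leaves.getD j none).toList) = x.word.tree.vars := by
    rw [← x.length_leaves, flat_getD, flatMap_toList]; rfl
  have e2 : flat x.len ((fun j => (x.word.tree.leaves.getD j none).toList) ∘ natPerm x.len x.braid)
      = x.source.reduceOption := by
    rw [← flatMap_toList, ← flat_getD _ none, x.length_source]
    exact flat_congr fun a ha => by rw [getD_source x ha]; rfl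
  rwa [e1, e2] at h

/-- The permutation underlying an object is given by the order of the letters at the start of the
braid. -/
theorem getElem?_source (x : WPaB n) (a : Fin n) :
    x.source.reduceOption[(a : ℕ)]? = some ((x.word.tau * perm n x.strip) a) := by
  rw [x.rearr_strip, ← val_perm, Omega.getElem?_vars]
  rfl

theorem length_source_reduceOption (x : WPaB n) : x.source.reduceOption.length = n :=
  (x.rearr_strip.perm x.word.vars_length).length_eq.trans x.word.vars_length

/-- There is a morphism between two objects if and only if the letters are in the same order at the
start of the two braids. -/
theorem nonempty_hom_iff {x y : WPaB n} :
    Nonempty (x ⟶ y) ↔ x.source.reduceOption = y.source.reduceOption := by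
  have h : x.source.reduceOption = y.source.reduceOption ↔
      x.word.tau * perm n x.strip = y.word.tau * perm n y.strip := by
    constructor
    · intro h
      refine Equiv.ext fun a => Option.some_injective _ ?_
      rw [← getElem?_source, ← getElem?_source, h]
    · intro h
      refine List.ext_getElem? fun a => ?_
      rcases Nat.lt_or_ge a n with ha | ha
      · have h1 := x.getElem?_source ⟨a, ha⟩
        have h2 := y.getElem?_source ⟨a, ha⟩
        rw [h] at h1
        exact h1.trans h2.symm
      · rw [List.getElem?_eq_none (by rwa [length_source_reduceOption]),
          List.getElem?_eq_none (by rwa [length_source_reduceOption])]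
  rw [h]
  constructor
  · rintro ⟨g, h1, rfl⟩
    rw [map_mul, map_inv, mul_inv_eq_iff_eq_mul] at h1
    rw [h1]
    group
  · intro h
    refine ⟨⟨y.strip * x.strip⁻¹, ?_, rfl⟩⟩
    rw [map_mul, map_inv, mul_inv_eq_iff_eq_mul, mul_assoc, h]
    group

section Comp

variable (x : WPaB (n + 1)) (i : Fin (n + 1)) (y : WPaB m)

theorem getElem?_pos : x.word.tree.leaves[(x.pos i : ℕ)]? = some (some i) := by
  rw [pos, List.getElem?_idxOf (x.word.mem_leaves i)]

theorem getD_leaves_eq_iff {j : ℕ} :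
    x.word.tree.leaves.getD j none = some i ↔ j = x.pos i := by
  constructor
  · intro h
    have hc : x.word.tree.leaves.count (some i) = 1 := by
      rw [Omega.count_leaves]
      exact List.count_eq_one_of_mem x.word.nodup (x.word.mem i)
    by_contra hj
    have h1 : x.word.tree.leaves[j]? = some (some i) := by
      rw [List.getD_eq_getElem?_getD] at h
      cases h' : x.word.tree.leaves[j]? <;> simp_all
    have h2 := x.getElem?_pos i
    have hd : List.Duplicate (some i) x.word.tree.leaves := by
      rw [List.duplicate_iff_exists_distinct_get]
      obtain ⟨l1, e1⟩ := List.getElem?_eq_some_iff.1 h1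
      obtain ⟨l2, e2⟩ := List.getElem?_eq_some_iff.1 h2
      rcases Nat.lt_or_gt_of_ne hj with hj | hj
      · exact ⟨⟨j, l1⟩, ⟨_, l2⟩, hj, e1.symm, e2.symm⟩
      · exact ⟨⟨_, l2⟩, ⟨j, l1⟩, hj, e2.symm, e1.symm⟩
    have h3 : 2 ≤ x.word.tree.leaves.count (some i) := by
      convert List.duplicate_iff_two_le_count.1 hd
    omega
  · rintro rfl
    rw [List.getD_eq_getElem?_getD, getElem?_pos]
    rfl

/-- The place where the strand of the letter `x_i` starts. -/
def startOf : ℕ := natPerm x.len x.braid⁻¹ (x.pos i)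

theorem startOf_lt : x.startOf i < x.len := natPerm_lt _ (x.pos i).2

theorem natPerm_eq_pos_iff {s : ℕ} : natPerm x.len x.braid s = x.pos i ↔ s = x.startOf i := by
  constructor
  · intro h
    rw [startOf, ← h, natPerm_inv_apply]
  · rintro rfl
    exact natPerm_apply_inv _ _

/-- The new starting place of the strands, when `M` strands are inserted for the strand that
starts in the place `s₀`. -/
def newStart (s₀ M s : ℕ) : ℕ := if s ≤ s₀ then s else s + M - 1

/-- The number of strands by which the strand that starts in place `s` is replaced. -/
def newWidth (s₀ M s : ℕ) : ℕ := if s = s₀ then M else 1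

theorem newStart_succ {s₀ M : ℕ} (hM : 0 < M) (s : ℕ) :
    newStart s₀ M (s + 1) = newStart s₀ M s + newWidth s₀ M s := by
  unfold newStart newWidth
  split_ifs <;> omega

theorem newWidth_pos {s₀ M : ℕ} (hM : 0 < M) (s : ℕ) : 0 < newWidth s₀ M s := by
  unfold newWidth
  split_ifs <;> omega

theorem starts_comp : (x.comp i y).starts = flat x.len fun j =>
    if j = (x.pos i : ℕ) then y.starts.map (x.startOf i + ·)
    else [newStart (x.startOf i) y.len (natPerm x.len x.braid⁻¹ j)] := by
  have h := rearr_braidComp x.braid (x.pos i) y.braid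
    (fun j => if j = (x.pos i : ℕ) then y.starts.map (x.startOf i + ·)
      else [newStart (x.startOf i) y.len (natPerm x.len x.braid⁻¹ j)])
    (fun j => if j = (x.pos i : ℕ) then (List.range y.len).map (x.startOf i + ·)
      else [newStart (x.startOf i) y.len (natPerm x.len x.braid⁻¹ j)])
    (by
      intro j _ hj
      rw [if_neg hj, if_neg hj]
      exact ⟨rfl, rfl⟩)
    (by rw [if_pos rfl, List.length_map, length_starts])
    (by
      rw [if_pos rfl, if_pos rfl]
      exact y.rearr_starts.map _)
  have h2 := (x.comp i y).rearr_starts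
  refine h2.inv.eq (?_ : Rearr _ (List.range (x.len - 1 + y.len)) _)
  refine Eq.subst (motive := fun l => Rearr _ l _) ?_ h.inv
  have h3 := PTree.flatMap_range' (K := newStart (x.startOf i) y.len)
    (k := newWidth (x.startOf i) y.len) (newStart_succ y.len_pos) 0 x.len
  have hlt := x.startOf_lt i
  rw [show newStart (x.startOf i) y.len 0 = 0 from if_pos (Nat.zero_le _), zero_add, Nat.sub_zero,
    show newStart (x.startOf i) y.len x.len = x.len - 1 + y.len by
      rw [newStart, if_neg (by omega)]; omega] at h3
  rw [List.range_eq_range' (n := x.len - 1 + y.len), ← h3, ← List.range_eq_range']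
  refine flat_congr fun s _ => ?_
  rw [Function.comp_apply, newWidth]
  by_cases hs : s = x.startOf i
  · subst hs
    rw [if_pos rfl, if_pos ((x.natPerm_eq_pos_iff i).2 rfl), newStart, if_pos le_rfl,
      List.range_eq_range', List.map_add_range']
    rfl
  · rw [if_neg hs, if_neg fun h => hs ((x.natPerm_eq_pos_iff i).1 h), natPerm_inv_apply]
    rfl

/-- The word with the single letter `x_a`, or the inserted word for the slot `none`. -/
def slotTree (i : Fin (n + 1)) (t : PTree (Fin m)) : Option (Fin (n + m)) → PTree (Fin (n + m))
  | some a => .leaf a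
  | none => t.map (block i)

/-- The word that is substituted for `x_k` in a composite with `t` in the slot `i`. -/
def substTree (i : Fin (n + 1)) (t : PTree (Fin m)) (k : Fin (n + 1)) : PTree (Fin (n + m)) :=
  slotTree i t (slot m i k)

theorem substTree_self (t : PTree (Fin m)) : substTree i t i = t.map (block i) := by
  rw [substTree, show slot m i i = none by simp [slot]]
  rfl

theorem exists_substTree {i k : Fin (n + 1)} (h : k ≠ i) :
    ∃ a : Fin (n + m), ∀ t : PTree (Fin m), substTree i t k = .leaf a := by
  rcases Nat.lt_or_gt_of_ne (fun e => h (Fin.ext e)) with h' | h'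
  · exact ⟨⟨k, by omega⟩, fun t => by
      rw [substTree, show slot m i k = some ⟨k, by omega⟩ from dif_pos h']
      rfl⟩
  · exact ⟨⟨k - 1 + m, by omega⟩, fun t => by
      rw [substTree, show slot m i k = some ⟨k - 1 + m, by omega⟩ from
        (dif_neg (Nat.lt_asymm h')).trans (dif_pos h')]
      rfl⟩

theorem elim_substTree {o : Option (Fin (n + 1))} (h : o ≠ some i) :
    ∃ o' : Option (Fin (n + m)), ∀ t : PTree (Fin m),
      o.elim .unit (substTree i t) = .ofOption o' := by
  cases o with
  | none => exact ⟨none, fun _ => rfl⟩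
  | some k =>
    obtain ⟨a, ha⟩ := exists_substTree (m := m) (i := i) (k := k) (fun e => h (e ▸ rfl))
    exact ⟨some a, ha⟩

theorem leaves_elim (o : Option (Fin (n + 1))) (t : PTree (Fin m)) :
    (o.elim [none] fun a => (substTree i t a).leaves) = (o.elim .unit (substTree i t)).leaves := by
  cases o <;> rfl

theorem source_comp : (x.comp i y).source = x.source.flatMap fun o =>
    (o.elim .unit (substTree i y.unbraidTree)).leaves := by
  have h := rearr_braidComp x.braid (x.pos i) y.braid
    (fun j => ((x.word.tree.leaves.getD j none).elim .unit (substTree i y.word.tree)).leaves)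
    (fun j => ((x.word.tree.leaves.getD j none).elim .unit (substTree i y.unbraidTree)).leaves)
    (by
      intro j _ hj
      obtain ⟨o', ho'⟩ := elim_substTree (m := m) i (o := x.word.tree.leaves.getD j none)
        (fun e => hj ((x.getD_leaves_eq_iff i).1 e))
      rw [ho', ho', PTree.leaves_ofOption]
      exact ⟨rfl, rfl⟩)
    (by
      simp only [(x.getD_leaves_eq_iff i).2 rfl, Option.elim_some, substTree_self,
        PTree.leaves_map, List.length_map, length_leaves])
    (by
      simp only [(x.getD_leaves_eq_iff i).2 rfl, Option.elim_some, substTree_self,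
        PTree.leaves_map, leaves_unbraidTree]
      exact y.rearr_source.map _)
  have h2 := (x.comp i y).rearr_source
  refine h2.eq ?_
  have e1 : (x.comp i y).word.tree.leaves = flat x.len fun j =>
      ((x.word.tree.leaves.getD j none).elim .unit (substTree i y.word.tree)).leaves := by
    refine (PTree.leaves_bind _ _).trans ?_
    rw [← x.length_leaves]
    have := flat_getD x.word.tree.leaves none fun o =>
      (o.elim .unit (substTree i y.word.tree)).leaves
    rw [this]
    exact List.flatMap_congr fun o _ => leaves_elim i o _
  have e2 : (x.source.flatMap fun o => (o.elim .unit (substTree i y.unbraidTree)).leaves) =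
      flat x.len ((fun j => ((x.word.tree.leaves.getD j none).elim .unit
        (substTree i y.unbraidTree)).leaves) ∘ natPerm x.len x.braid) := by
    rw [← flat_getD x.source none, length_source]
    exact flat_congr fun a ha => by rw [getD_source x ha]; rfl
  rw [e1, e2]
  exact h

/-- The substitution of the labels of `y` for the letter `x_i` in the labels of `x`. -/
def substLabel (s₀ M : ℕ) (t : PTree ℕ) (s : ℕ) : PTree ℕ :=
  if s = s₀ then t.map (s₀ + ·) else .leaf (newStart s₀ M s)

theorem startOf_eq_iff {j : ℕ} : natPerm x.len x.braid⁻¹ j = x.startOf i ↔ j = x.pos i :=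
  Equiv.apply_eq_iff_eq _

theorem map_leaves {γ : Type*} (f : Option (Fin n) → γ) (x : WPaB n) :
    x.word.tree.leaves.map f =
      (List.range x.len).map fun j => f (x.word.tree.leaves.getD j none) := by
  refine List.ext_getElem (by simp [length_leaves]) fun j h _ => ?_
  simp only [List.length_map] at h
  simp [h]

theorem map_source {γ : Type*} (f : Option (Fin n) → γ) (x : WPaB n) :
    x.source.map f = (List.range x.len).map fun j => f (x.source.getD j none) := by
  refine List.ext_getElem (by simp [length_source]) fun j h _ => ?_
  simp only [List.length_map] at h
  simp [h]

theorem shape_substLabel_of_ne {s₀ M s : ℕ} {t : PTree ℕ} (h : s ≠ s₀) :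
    (substLabel s₀ M t s).shape = .leaf () := by
  rw [substLabel, if_neg h]; rfl

theorem label_comp :
    (x.comp i y).label = x.label.bind (substLabel (x.startOf i) y.len y.label) := by
  refine PTree.eq_of_shape_leaves ?_ ?_
  · rw [shape_label]
    refine PTree.shape_bind_congr x.shape_label.symm ?_
    rw [leaves_label, starts]
    simp only [List.map_map]
    refine (map_leaves (fun o => (o.elim .unit (substTree i y.word.tree)).shape) x).trans ?_
    refine List.map_congr_left fun j _ => ?_
    simp only [Function.comp_apply, Option.elim_some]
    by_cases hj : j = x.pos i
    · rw [(x.getD_leaves_eq_iff i).2 hj, Option.elim_some, substTree_self, PTree.shape_map,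
        substLabel, if_pos ((x.startOf_eq_iff i).2 hj), PTree.shape_map, shape_label]
    · obtain ⟨o', ho'⟩ := elim_substTree (m := m) i (o := x.word.tree.leaves.getD j none)
        (fun e => hj ((x.getD_leaves_eq_iff i).1 e))
      rw [ho', PTree.shape_ofOption,
        shape_substLabel_of_ne fun e => hj ((x.startOf_eq_iff i).1 e)]
  · rw [leaves_label, starts_comp, PTree.leaves_bind, leaves_label, flat, List.map_flatMap,
      List.flatMap_map]
    refine Eq.trans ?_ (List.flatMap_map ..).symm
    refine List.flatMap_congr fun j _ => ?_
    rw [Option.elim_some, substLabel]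
    by_cases hj : j = x.pos i
    · rw [if_pos hj, if_pos ((x.startOf_eq_iff i).2 hj), PTree.leaves_map, leaves_label,
        List.map_map, List.map_map]
      rfl
    · rw [if_neg hj, if_neg fun e => hj ((x.startOf_eq_iff i).1 e)]
      rfl

theorem blocks_substLabel (s₀ s : ℕ) :
    (substLabel s₀ y.len y.label s).blocks = [substLabel s₀ y.len y.label.rewind s] ∧
      (substLabel s₀ y.len y.label.rewind s).vars =
        List.range' (newStart s₀ y.len s) (newWidth s₀ y.len s) := by
  by_cases hs : s = s₀
  · subst hs
    rw [substLabel, substLabel, if_pos rfl, if_pos rfl, newStart, if_pos le_rfl, newWidth,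
      if_pos rfl, PTree.vars_map, vars_rewind, List.map_add_range']
    refine ⟨?_, rfl⟩
    rw [PTree.map, PTree.blocks_bind (K := (s + ·)) (k := fun _ => 1) (fun _ => rfl)
      (fun _ => one_pos) (F' := fun a => .leaf (s + a)), blocks_label]
    · rfl
    · exact fun _ _ => ⟨rfl, rfl⟩
  · rw [substLabel, substLabel, if_neg hs, if_neg hs, newWidth, if_neg hs]
    exact ⟨rfl, rfl⟩

/-- Undoing the braid is compatible with partial composition. The strands of the inserted object start
in adjacent places, so they form a subword, which `PTree.rewind` does not break up. -/
theorem unbraid_comp : (x.comp i y).unbraid = x.unbraid.comp i y.unbraid := by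
  refine Omega.eq_of_tree (PTree.eq_of_shape_leaves ?_ ?_)
  · refine (shape_unbraidTree _).trans ?_
    rw [label_comp, PTree.rewind, PTree.blocks_bind (newStart_succ y.len_pos)
      (newWidth_pos y.len_pos) fun s _ => blocks_substLabel y _ s, blocks_label]
    refine PTree.shape_bind_congr x.shape_unbraidTree.symm ?_
    rw [leaves_rewind, List.map_map]
    refine Eq.trans ?_ (congrArg _ x.leaves_unbraidTree).symm
    refine Eq.trans ?_
      (map_source (fun o => (o.elim .unit (substTree i y.unbraidTree)).shape) x).symm
    refine List.map_congr_left fun s hs => ?_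
    rw [Function.comp_apply, Option.elim_some, getD_source x (List.mem_range.1 hs)]
    by_cases h : s = x.startOf i
    · rw [(x.getD_leaves_eq_iff i).2 ((x.natPerm_eq_pos_iff i).2 h), Option.elim_some,
        substTree_self, PTree.shape_map, substLabel, if_pos h, PTree.shape_map, shape_unbraidTree]
    · obtain ⟨o', ho'⟩ := elim_substTree (m := m) i
        (o := x.word.tree.leaves.getD (natPerm x.len x.braid s) none)
        (fun e => h ((x.natPerm_eq_pos_iff i).1 ((x.getD_leaves_eq_iff i).1 e)))
      rw [ho', PTree.shape_ofOption, shape_substLabel_of_ne h]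
  · refine (leaves_unbraidTree _).trans ?_
    rw [source_comp, ← leaves_unbraidTree]
    refine Eq.trans ?_ (PTree.leaves_bind _ _).symm
    exact List.flatMap_congr fun o _ => (leaves_elim i o _).symm

end Comp

end WPaB

end WeakBraid

/-! ### Coherence isomorphisms between words -/

namespace WeakBraid

section Coherence

open MonoidalCategory

variable {D : Type u} [Category.{v} D] [MonoidalCategory D] {α β : Type}

namespace PTree

/-- The letters of a word different from `x_0`, by recursion on the word. -/
def letters : PTree α → List α
  | unit => []
  | leaf a => [a]
  | node l r => l.letters ++ r.letters

theorem letters_eq_vars (p : PTree α) : p.letters = p.vars := by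
  induction p with
  | unit => rfl
  | leaf a => rfl
  | node l r hl hr => rw [letters, hl, hr, vars_node]

theorem letters_bind (f : α → PTree β) (p : PTree α) :
    (p.bind f).letters = p.letters.flatMap fun a => (f a).letters := by
  simp only [letters_eq_vars, vars_bind]

/-- The right bracketed word in the given letters, with a final `x_0`. -/
def ofList : List α → PTree α
  | [] => unit
  | a :: l => node (leaf a) (ofList l)

/-- The value of the functor of a word on objects. -/
abbrev obj (p : PTree α) (X : α → D) : D := (p.functor D).obj X

end PTree

/-- The right bracketed tensor product of the objects `X a` for the letters `a` of a list. -/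
@[reducible]
def listObj (X : α → D) : List α → D
  | [] => 𝟙_ D
  | a :: l => X a ⊗ listObj X l

/-- `listObj` on morphisms. -/
def listMap {X Y : α → D} (f : X ⟶ Y) : (l : List α) → (listObj X l ⟶ listObj Y l)
  | [] => 𝟙 _
  | a :: l => f a ⊗ₘ listMap f l

/-- Rebracketing of two lists into one. -/
def listAppend (X : α → D) (l' : List α) :
    (l : List α) → (listObj X l ⊗ listObj X l' ≅ listObj X (l ++ l'))
  | [] => λ_ _
  | a :: l => α_ _ _ _ ≪≫ whiskerLeftIso (X a) (listAppend X l' l)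

theorem listAppend_naturality {X Y : α → D} (f : X ⟶ Y) (l' l : List α) :
    (listMap f l ⊗ₘ listMap f l') ≫ (listAppend Y l' l).hom =
      (listAppend X l' l).hom ≫ listMap f (l ++ l') := by
  induction l with
  | nil =>
    change (𝟙 (𝟙_ D) ⊗ₘ listMap f l') ≫ (λ_ _).hom = (λ_ _).hom ≫ listMap f l'
    rw [id_tensorHom, leftUnitor_naturality]
  | cons a l ih =>
    change ((f a ⊗ₘ listMap f l) ⊗ₘ listMap f l') ≫ (α_ _ _ _).hom ≫
      Y a ◁ (listAppend Y l' l).hom =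
        ((α_ _ _ _).hom ≫ X a ◁ (listAppend X l' l).hom) ≫ (f a ⊗ₘ listMap f (l ++ l'))
    rw [Category.assoc, associator_naturality_assoc, ← id_tensorHom, ← id_tensorHom,
      tensorHom_comp_tensorHom, tensorHom_comp_tensorHom, ih, Category.comp_id, Category.id_comp]

theorem eqToHom_cons (X : α → D) (a : α) {l l' : List α} (h : l = l') :
    eqToHom (congrArg (fun l => X a ⊗ listObj X l) h) = X a ◁ eqToHom (congrArg (listObj X) h) := by
  subst h; simp

theorem listAppend_assoc (X : α → D) (l l' l'' : List α) :
    (listAppend X l' l).hom ▷ listObj X l'' ≫ (listAppend X l'' (l ++ l')).hom ≫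
        eqToHom (congrArg (listObj X) (List.append_assoc l l' l'')) =
      (α_ _ _ _).hom ≫ listObj X l ◁ (listAppend X l'' l').hom ≫
        (listAppend X (l' ++ l'') l).hom := by
  induction l with
  | nil =>
    simp [listAppend, listObj]
  | cons a l ih =>
    change ((α_ (X a) (listObj X l) (listObj X l')).hom ≫ X a ◁ (listAppend X l' l).hom) ▷
        listObj X l'' ≫ ((α_ (X a) (listObj X (l ++ l')) (listObj X l'')).hom ≫
          X a ◁ (listAppend X l'' (l ++ l')).hom) ≫
            eqToHom (congrArg (fun l => X a ⊗ listObj X l) (List.append_assoc l l' l'')) =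
      (α_ (X a ⊗ listObj X l) (listObj X l') (listObj X l'')).hom ≫
        (X a ⊗ listObj X l) ◁ (listAppend X l'' l').hom ≫
          (α_ (X a) (listObj X l) (listObj X (l' ++ l''))).hom ≫
            X a ◁ (listAppend X (l' ++ l'') l).hom
    rw [eqToHom_cons X a (List.append_assoc l l' l''), comp_whiskerRight]
    simp only [Category.assoc]
    rw [associator_naturality_middle_assoc, ← whiskerLeft_comp, ← whiskerLeft_comp, ih]
    simp

theorem listAppend_nil (X : α → D) (l : List α) :
    (listAppend X [] l).hom ≫ eqToHom (congrArg (listObj X) (List.append_nil l)) =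
      (ρ_ _).hom := by
  induction l with
  | nil => simp [listAppend, listObj, unitors_equal]
  | cons a l ih =>
    change ((α_ (X a) (listObj X l) (𝟙_ D)).hom ≫ X a ◁ (listAppend X [] l).hom) ≫
      eqToHom (congrArg (fun l => X a ⊗ listObj X l) (List.append_nil l)) =
        (ρ_ (X a ⊗ listObj X l)).hom
    rw [eqToHom_cons X a (List.append_nil l), Category.assoc, ← whiskerLeft_comp, ih]
    simp

/-- The tensor product prescribed by a word, rebracketed. -/
def normIso (X : α → D) : (p : PTree α) → (p.obj X ≅ listObj X p.letters)
  | .unit => Iso.refl _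
  | .leaf a => (ρ_ (X a)).symm
  | .node l r => tensorIso (normIso X l) (normIso X r) ≪≫ listAppend X _ _

theorem normIso_naturality {X Y : α → D} (f : X ⟶ Y) (p : PTree α) :
    (p.functor D).map f ≫ (normIso Y p).hom = (normIso X p).hom ≫ listMap f p.letters := by
  induction p with
  | unit => rfl
  | leaf a =>
    change f a ≫ (ρ_ (Y a)).inv = (ρ_ (X a)).inv ≫ (f a ⊗ₘ 𝟙 (𝟙_ D))
    rw [tensorHom_id]
    exact rightUnitor_inv_naturality (f a)
  | node l r hl hr =>
    change ((l.functor D).map f ⊗ₘ (r.functor D).map f) ≫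
      ((normIso Y l).hom ⊗ₘ (normIso Y r).hom) ≫ (listAppend Y _ _).hom =
        (((normIso X l).hom ⊗ₘ (normIso X r).hom) ≫ (listAppend X _ _).hom) ≫
          listMap f (l.letters ++ r.letters)
    rw [Category.assoc, ← listAppend_naturality, tensorHom_comp_tensorHom_assoc,
      tensorHom_comp_tensorHom_assoc, ← hl, ← hr]

/-- The canonical morphism between the tensor products prescribed by two words with the same letters
in the same order, composed of associators and unitors. -/
def can (X : α → D) {p q : PTree α} (h : p.letters = q.letters) : p.obj X ⟶ q.obj X :=
  (normIso X p).hom ≫ eqToHom (congrArg (listObj X) h) ≫ (normIso X q).inv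

theorem can_refl (X : α → D) {p : PTree α} (h : p.letters = p.letters) : can X h = 𝟙 _ := by
  simp [can]

theorem can_trans (X : α → D) {p q r : PTree α} (h : p.letters = q.letters)
    (h' : q.letters = r.letters) : can X h ≫ can X h' = can X (h.trans h') := by
  simp [can]

theorem can_naturality {X Y : α → D} (f : X ⟶ Y) {p q : PTree α} (h : p.letters = q.letters) :
    (p.functor D).map f ≫ can Y h = can X h ≫ (q.functor D).map f := by
  have aux : ∀ {l l' : List α} (h : l = l'), listMap f l ≫ eqToHom (congrArg (listObj Y) h) =
      eqToHom (congrArg (listObj X) h) ≫ listMap f l' := by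
    rintro l _ rfl
    simp
  rw [can, can, ← Category.assoc, normIso_naturality, Category.assoc, reassoc_of% (aux h),
    Category.assoc, Category.assoc]
  congr 2
  rw [Iso.comp_inv_eq, Category.assoc, normIso_naturality, Iso.inv_hom_id_assoc]

theorem can_node (X : α → D) {p p' q q' : PTree α} (hp : p.letters = p'.letters)
    (hq : q.letters = q'.letters) (h : (PTree.node p q).letters = (PTree.node p' q').letters) :
    can X h = can X hp ⊗ₘ can X hq := by
  have aux : ∀ {l l' m m' : List α} (h : l = l') (h' : m = m'),
      (listAppend X m l).hom ≫ eqToHom (by rw [h, h']) ≫ (listAppend X m' l').inv =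
        eqToHom (congrArg (listObj X) h) ⊗ₘ eqToHom (congrArg (listObj X) h') := by
    rintro l _ m _ rfl rfl
    simp
  change (((normIso X p).hom ⊗ₘ (normIso X q).hom) ≫ (listAppend X _ _).hom) ≫
    eqToHom (congrArg (listObj X) h) ≫ (listAppend X _ _).inv ≫
      ((normIso X p').inv ⊗ₘ (normIso X q').inv) =
    ((normIso X p).hom ≫ eqToHom (congrArg (listObj X) hp) ≫ (normIso X p').inv) ⊗ₘ
      ((normIso X q).hom ≫ eqToHom (congrArg (listObj X) hq) ≫ (normIso X q').inv)
  rw [← tensorHom_comp_tensorHom, ← tensorHom_comp_tensorHom, ← aux hp hq]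
  simp only [Category.assoc]
  rfl

theorem can_leftUnitor (X : α → D) {p : PTree α}
    (h : (PTree.node .unit p).letters = p.letters) : can X h = (λ_ (p.obj X)).hom := by
  change ((𝟙 (𝟙_ D) ⊗ₘ (normIso X p).hom) ≫ (λ_ (listObj X p.letters)).hom) ≫ 𝟙 _ ≫
    (normIso X p).inv = (λ_ (p.obj X)).hom
  simp

theorem can_rightUnitor (X : α → D) {p : PTree α}
    (h : (PTree.node p .unit).letters = p.letters) : can X h = (ρ_ (p.obj X)).hom := by
  have := listAppend_nil X p.letters
  change (((normIso X p).hom ⊗ₘ 𝟙 (𝟙_ D)) ≫ (listAppend X [] p.letters).hom) ≫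
    eqToHom (congrArg (listObj X) (List.append_nil p.letters)) ≫ (normIso X p).inv =
      (ρ_ (p.obj X)).hom
  rw [Category.assoc, reassoc_of% this]
  simp

theorem can_associator (X : α → D) {p q r : PTree α}
    (h : (PTree.node (.node p q) r).letters = (PTree.node p (.node q r)).letters) :
    can X h = (α_ (p.obj X) (q.obj X) (r.obj X)).hom := by
  have := listAppend_assoc X p.letters q.letters r.letters
  refine (Category.assoc ..).symm.trans ((Iso.comp_inv_eq _).2 ?_)
  rw [← id_tensorHom, ← tensorHom_id] at this
  change ((((((normIso X p).hom ⊗ₘ (normIso X q).hom) ≫ (listAppend X _ _).hom) ⊗ₘ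
    (normIso X r).hom) ≫ (listAppend X _ _).hom) ≫ eqToHom _) =
      (α_ _ _ _).hom ≫ ((normIso X p).hom ⊗ₘ (((normIso X q).hom ⊗ₘ (normIso X r).hom) ≫
        (listAppend X _ _).hom)) ≫ (listAppend X _ _).hom
  have e1 : ((normIso X p).hom ⊗ₘ (normIso X q).hom) ≫ (listAppend X q.letters p.letters).hom ⊗ₘ
      (normIso X r).hom = (((normIso X p).hom ⊗ₘ (normIso X q).hom) ⊗ₘ (normIso X r).hom) ≫
        ((listAppend X q.letters p.letters).hom ⊗ₘ 𝟙 _) := by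
    rw [tensorHom_comp_tensorHom, Category.comp_id]
  have e2 : (normIso X p).hom ⊗ₘ (((normIso X q).hom ⊗ₘ (normIso X r).hom) ≫
      (listAppend X r.letters q.letters).hom) =
      ((normIso X p).hom ⊗ₘ ((normIso X q).hom ⊗ₘ (normIso X r).hom)) ≫
        (𝟙 _ ⊗ₘ (listAppend X r.letters q.letters).hom) := by
    rw [tensorHom_comp_tensorHom, Category.comp_id]
  rw [e1, e2]
  simp only [Category.assoc]
  refine (congrArg _ this).trans ?_
  rw [associator_naturality_assoc]

/-- The canonical morphisms, as natural transformations. -/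
def canTrans (D : Type u) [Category.{v} D] [MonoidalCategory D] {p q : PTree α}
    (h : p.letters = q.letters) : p.functor D ⟶ q.functor D where
  app X := can X h
  naturality _ _ f := can_naturality f h

/-- The functor of a substitution is the composite functor. -/
theorem functor_bind (f : α → PTree β) (p : PTree α) :
    (p.bind f).functor D = Functor.pi' (fun k => (f k).functor D) ⋙ p.functor D := by
  induction p with
  | unit => rfl
  | leaf a => rfl
  | node l r hl hr => rw [PTree.bind, PTree.functor, hl, hr]; rfl

section Bind

variable (X : β → D) (f : α → PTree β)

theorem obj_bind (p : PTree α) : (p.bind f).obj X = p.obj fun k => (f k).obj X :=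
  Functor.congr_obj (functor_bind f p) X

theorem tensorHom_eqToHom {U U' V V' : D} (h : U = U') (h' : V = V') :
    eqToHom h ⊗ₘ eqToHom h' = eqToHom (by rw [h, h']) := by
  subst h h'; simp

theorem eqToHom_bind_node (l r : PTree α) :
    eqToHom (obj_bind X f (.node l r)) =
      eqToHom (obj_bind X f l) ⊗ₘ eqToHom (obj_bind X f r) :=
  (tensorHom_eqToHom _ _).symm

theorem eqToHom_bind_node_symm (l r : PTree α) :
    eqToHom (obj_bind X f (.node l r)).symm =
      eqToHom (obj_bind X f l).symm ⊗ₘ eqToHom (obj_bind X f r).symm :=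
  (tensorHom_eqToHom _ _).symm

/-- The canonical morphism between the words that arise by substitution of different words. -/
theorem can_bind_right {f f' : α → PTree β} (hf : ∀ k, (f k).letters = (f' k).letters)
    (p : PTree α) (h : (p.bind f).letters = (p.bind f').letters) :
    can X h = eqToHom (obj_bind X f p) ≫
      (p.functor D).map (X := fun k => (f k).obj X) (Y := fun k => (f' k).obj X)
        (fun k => can X (hf k)) ≫ eqToHom (obj_bind X f' p).symm := by
  induction p with
  | unit =>
    have e : 𝟙 (𝟙_ D) = 𝟙 (𝟙_ D) ≫ 𝟙 (𝟙_ D) ≫ 𝟙 (𝟙_ D) := by simp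
    exact (can_refl X h).trans e
  | leaf a =>
    have e : can X (hf a) = 𝟙 _ ≫ can X (hf a) ≫ 𝟙 _ := by simp
    exact e
  | node l r hl hr =>
    have hb (p : PTree α) : (p.bind f).letters = (p.bind f').letters := by
      simp only [PTree.letters_bind, hf]
    refine (can_node X (hb l) (hb r) h).trans ?_
    rw [hl, hr, eqToHom_bind_node, eqToHom_bind_node_symm, ← tensorHom_comp_tensorHom,
      ← tensorHom_comp_tensorHom]
    rfl

/-- Compatibility of the canonical morphism between `p` and `q` with substitution. -/
def CanBind (p q : PTree α) : Prop :=
  ∃ (h : p.letters = q.letters) (h' : (p.bind f).letters = (q.bind f).letters),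
    can X h' = eqToHom (obj_bind X f p) ≫ can (fun k => (f k).obj X) h ≫
      eqToHom (obj_bind X f q).symm

variable {X f}

theorem CanBind.refl (p : PTree α) : CanBind X f p p := ⟨rfl, rfl, by simp [can_refl]⟩

theorem CanBind.trans {p q r : PTree α} (h : CanBind X f p q) (h' : CanBind X f q r) :
    CanBind X f p r := by
  obtain ⟨h1, h2, h3⟩ := h
  obtain ⟨h1', h2', h3'⟩ := h'
  refine ⟨h1.trans h1', h2.trans h2', ?_⟩
  rw [← can_trans X h2 h2', ← can_trans _ h1 h1', h3, h3']
  simp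

theorem CanBind.symm {p q : PTree α} (h : CanBind X f p q) : CanBind X f q p := by
  obtain ⟨h1, h2, h3⟩ := h
  refine ⟨h1.symm, h2.symm, ?_⟩
  have e1 : can X h2.symm ≫ can X h2 = 𝟙 _ := by rw [can_trans, can_refl]
  have e2 : can X h2 ≫ can X h2.symm = 𝟙 _ := by rw [can_trans, can_refl]
  have e3 : can (fun k => (f k).obj X) h1.symm ≫ can (fun k => (f k).obj X) h1 = 𝟙 _ := by
    rw [can_trans, can_refl]
  have : (eqToHom (obj_bind X f q) ≫ can (fun k => (f k).obj X) h1.symm ≫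
      eqToHom (obj_bind X f p).symm) ≫ can X h2 = 𝟙 _ := by
    rw [h3]
    simp [reassoc_of% e3]
  calc can X h2.symm = ((eqToHom (obj_bind X f q) ≫ can (fun k => (f k).obj X) h1.symm ≫
      eqToHom (obj_bind X f p).symm) ≫ can X h2) ≫ can X h2.symm := by rw [this, Category.id_comp]
    _ = _ := by rw [Category.assoc, e2, Category.comp_id]

theorem CanBind.node {p p' q q' : PTree α} (h : CanBind X f p p') (h' : CanBind X f q q') :
    CanBind X f (.node p q) (.node p' q') := by
  obtain ⟨h1, h2, h3⟩ := h
  obtain ⟨h1', h2', h3'⟩ := h'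
  refine ⟨by rw [PTree.letters, PTree.letters, h1, h1'],
    by rw [PTree.bind, PTree.bind, PTree.letters, PTree.letters, h2, h2'], ?_⟩
  refine (can_node X h2 h2' _).trans ?_
  rw [can_node _ h1 h1', h3, h3', eqToHom_bind_node, eqToHom_bind_node_symm,
    ← tensorHom_comp_tensorHom, ← tensorHom_comp_tensorHom]
  rfl

theorem CanBind.leftUnitor (p : PTree α) : CanBind X f (.node .unit p) p := by
  refine ⟨rfl, rfl, ?_⟩
  refine (can_leftUnitor X (p := p.bind f) rfl).trans ?_
  have e : eqToHom (obj_bind X f (.node .unit p)) = 𝟙_ D ◁ eqToHom (obj_bind X f p) :=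
    (eqToHom_bind_node ..).trans (id_tensorHom ..)
  have e' : (λ_ ((p.bind f).obj X)).hom = 𝟙_ D ◁ eqToHom (obj_bind X f p) ≫
      (λ_ (p.obj fun k => (f k).obj X)).hom ≫ eqToHom (obj_bind X f p).symm := by
    rw [leftUnitor_naturality_assoc]
    simp
  exact e'.trans (congrArg₂ (fun s t => s ≫ t ≫ eqToHom (obj_bind X f p).symm) e.symm
    (can_leftUnitor (fun k => (f k).obj X) (p := p) rfl).symm)

theorem CanBind.rightUnitor (p : PTree α) : CanBind X f (.node p .unit) p := by
  refine ⟨List.append_nil _, List.append_nil _, ?_⟩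
  refine (can_rightUnitor X (p := p.bind f) _).trans ?_
  have e : eqToHom (obj_bind X f (.node p .unit)) = eqToHom (obj_bind X f p) ▷ 𝟙_ D :=
    (eqToHom_bind_node ..).trans (tensorHom_id ..)
  have e' : (ρ_ ((p.bind f).obj X)).hom = eqToHom (obj_bind X f p) ▷ 𝟙_ D ≫
      (ρ_ (p.obj fun k => (f k).obj X)).hom ≫ eqToHom (obj_bind X f p).symm := by
    rw [rightUnitor_naturality_assoc]
    simp
  exact e'.trans (congrArg₂ (fun s t => s ≫ t ≫ eqToHom (obj_bind X f p).symm) e.symm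
    (can_rightUnitor (fun k => (f k).obj X) (p := p) _).symm)

theorem CanBind.associator (p q r : PTree α) :
    CanBind X f (.node (.node p q) r) (.node p (.node q r)) := by
  refine ⟨List.append_assoc _ _ _, List.append_assoc _ _ _, ?_⟩
  refine (can_associator X (p := p.bind f) (q := q.bind f) (r := r.bind f) _).trans ?_
  have e1 : eqToHom (obj_bind X f (.node (.node p q) r)) =
      (eqToHom (obj_bind X f p) ⊗ₘ eqToHom (obj_bind X f q)) ⊗ₘ eqToHom (obj_bind X f r) :=
    (eqToHom_bind_node ..).trans (congrArg (· ⊗ₘ _) (eqToHom_bind_node ..))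
  have e2 : eqToHom (obj_bind X f (.node p (.node q r))).symm =
      eqToHom (obj_bind X f p).symm ⊗ₘ
        (eqToHom (obj_bind X f q).symm ⊗ₘ eqToHom (obj_bind X f r).symm) :=
    (eqToHom_bind_node_symm ..).trans (congrArg (_ ⊗ₘ ·) (eqToHom_bind_node_symm ..))
  have e3 : (α_ ((p.bind f).obj X) ((q.bind f).obj X) ((r.bind f).obj X)).hom =
      ((eqToHom (obj_bind X f p) ⊗ₘ eqToHom (obj_bind X f q)) ⊗ₘ eqToHom (obj_bind X f r)) ≫
        (α_ (p.obj fun k => (f k).obj X) (q.obj fun k => (f k).obj X)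
          (r.obj fun k => (f k).obj X)).hom ≫
        (eqToHom (obj_bind X f p).symm ⊗ₘ
          (eqToHom (obj_bind X f q).symm ⊗ₘ eqToHom (obj_bind X f r).symm)) := by
    rw [associator_naturality_assoc, tensorHom_comp_tensorHom, tensorHom_comp_tensorHom]
    simp
  refine e3.trans ?_
  refine Eq.trans ?_ (congrArg₂ (· ≫ ·) e1.symm
    (congrArg₂ (· ≫ ·) (can_associator (fun k => (f k).obj X) (p := p) (q := q) (r := r) _).symm
      e2.symm))
  rfl

theorem CanBind.append (l l' : List α) :
    CanBind X f (.node (.ofList l) (.ofList l')) (.ofList (l ++ l')) := by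
  induction l with
  | nil => exact CanBind.leftUnitor _
  | cons a l ih => exact (CanBind.associator _ _ _).trans ((CanBind.refl _).node ih)

/-- As `CanBind` is an equivalence relation which contains the associators and unitors, it relates
every word to its right bracketed form, and therefore any two words with the same letters. -/
theorem CanBind.ofList (p : PTree α) : CanBind X f p (.ofList p.letters) := by
  induction p with
  | unit => exact CanBind.refl _
  | leaf a => exact (CanBind.rightUnitor (.leaf a)).symm
  | node l r hl hr => exact (hl.node hr).trans (CanBind.append _ _)

theorem can_bind_left {p q : PTree α} (h : p.letters = q.letters)
    (h' : (p.bind f).letters = (q.bind f).letters) :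
    can X h' = eqToHom (obj_bind X f p) ≫ can (fun k => (f k).obj X) h ≫
      eqToHom (obj_bind X f q).symm := by
  have h1 := CanBind.ofList (X := X) (f := f) p
  rw [h] at h1
  obtain ⟨_, _, h2⟩ := h1.trans (CanBind.ofList q).symm
  exact h2

end Bind

/-- The canonical morphisms are compatible with substitution. -/
theorem canTrans_bind {p q : PTree α} (h : p.letters = q.letters) {f f' : α → PTree β}
    (hf : ∀ k, (f k).letters = (f' k).letters) (h' : (p.bind f).letters = (q.bind f').letters) :
    canTrans D h' = eqToHom (functor_bind f p) ≫
      (NatTrans.pi' (F := Functor.pi' fun k => (f k).functor D)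
        (G := Functor.pi' fun k => (f' k).functor D) (fun k => canTrans D (hf k)) ◫ canTrans D h) ≫
        eqToHom (functor_bind f' q).symm := by
  ext X
  have h1 : (p.bind f).letters = (q.bind f).letters := by simp only [PTree.letters_bind, h]
  have h2 : (q.bind f).letters = (q.bind f').letters := by simp only [PTree.letters_bind, hf]
  rw [NatTrans.comp_app, NatTrans.comp_app, eqToHom_app, eqToHom_app, NatTrans.hcomp_app]
  refine (can_trans X h1 h2).symm.trans ?_
  rw [can_bind_left h h1, can_bind_right X hf q h2]
  simp only [Category.assoc, eqToHom_trans_assoc, eqToHom_refl, Category.id_comp]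
  rfl

end Coherence

section Additivity

open MonoidalCategory

variable {D : Type u} [Category.{v} D] [MonoidalCategory D]

theorem PTree.functor_map_congr {α : Type} {p : PTree α} {X Y : α → D} {f f' : X ⟶ Y}
    (h : ∀ j ∈ p.letters, f j = f' j) : (p.functor D).map f = (p.functor D).map f' := by
  induction p with
  | unit => rfl
  | leaf a => exact h a (by simp [letters])
  | node l r hl hr =>
    have h1 := hl fun j hj => h j (List.mem_append_left _ hj)
    have h2 := hr fun j hj => h j (List.mem_append_right _ hj)
    change (l.functor D).map f ⊗ₘ (r.functor D).map f = (l.functor D).map f' ⊗ₘ (r.functor D).map f'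
    rw [h1, h2]

theorem PTree.functor_map_add [Preadditive D] [MonoidalPreadditive D] {α : Type} {p : PTree α}
    {X Y : α → D} {i : α} {f f' f'' : X ⟶ Y} (hp : p.letters.Nodup) (hi : i ∈ p.letters)
    (h : f'' i = f i + f' i) (h' : ∀ j, j ≠ i → f j = f'' j ∧ f' j = f'' j) :
    (p.functor D).map f'' = (p.functor D).map f + (p.functor D).map f' := by
  induction p with
  | unit => simp [letters] at hi
  | leaf a =>
    obtain rfl := List.mem_singleton.1 hi
    exact h
  | node l r hl hr =>
    rw [letters, List.nodup_append] at hp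
    change (l.functor D).map f'' ⊗ₘ (r.functor D).map f'' =
      ((l.functor D).map f ⊗ₘ (r.functor D).map f) + ((l.functor D).map f' ⊗ₘ (r.functor D).map f')
    rcases List.mem_append.1 hi with hi | hi
    · have hn : ∀ j ∈ r.letters, j ≠ i := fun j hj e => hp.2.2 i hi j hj e.symm
      rw [functor_map_congr (f := f) (f' := f'') fun j hj => (h' j (hn j hj)).1,
        functor_map_congr (p := r) (f := f') (f' := f'') fun j hj => (h' j (hn j hj)).2,
        hl hp.1 hi, MonoidalPreadditive.add_tensor]
    · have hn : ∀ j ∈ l.letters, j ≠ i := fun j hj e => hp.2.2 j hj i hi e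
      rw [functor_map_congr (f := f) (f' := f'') fun j hj => (h' j (hn j hj)).1,
        functor_map_congr (p := l) (f := f') (f' := f'') fun j hj => (h' j (hn j hj)).2,
        hr hp.2.1 hi, MonoidalPreadditive.tensor_add]

end Additivity

end WeakBraid

/-! ### The weak braiding -/

namespace WeakBraid

section Algebra

open MonoidalCategory

variable {D : Type u} [Category.{v} D] [MonoidalCategory D] {α β : Type} {n m : ℕ}

theorem canTrans_congr {p p' q q' : PTree α} (hp : p = p') (hq : q = q')
    (h : p.letters = q.letters) (h' : p'.letters = q'.letters) :
    canTrans D h = eqToHom (by rw [hp]) ≫ canTrans D h' ≫ eqToHom (by rw [hq]) := by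
  subst hp hq; simp

theorem canTrans_refl {p : PTree α} (h : p.letters = p.letters) : canTrans D h = 𝟙 _ := by
  ext X
  exact can_refl X h

theorem id_eq_eqToHom_comp {C : Type*} [Category C] {a b : C} (h : a = b) :
    𝟙 a = eqToHom h ≫ 𝟙 b ≫ eqToHom h.symm := by
  subst h; simp

theorem functor_bind_of_eq {f : α → PTree β} {H : α → ((β → D) ⥤ D)}
    (hH : ∀ k, (f k).functor D = H k) (p : PTree α) :
    (p.bind f).functor D = Functor.pi' H ⋙ p.functor D := by
  obtain rfl : (fun k => (f k).functor D) = H := funext hH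
  exact functor_bind f p

/-- Compatibility of the canonical morphisms with substitution, where the functors of the inserted
words are replaced by equal functors. -/
theorem canTrans_bind_of_eq {p q : PTree α} (h : p.letters = q.letters) {f f' : α → PTree β}
    (hf : ∀ k, (f k).letters = (f' k).letters) (h' : (p.bind f).letters = (q.bind f').letters)
    {H H' : α → ((β → D) ⥤ D)} (hH : ∀ k, (f k).functor D = H k)
    (hH' : ∀ k, (f' k).functor D = H' k) (t : ∀ k, H k ⟶ H' k)
    (ht : ∀ k, canTrans D (hf k) = eqToHom (hH k) ≫ t k ≫ eqToHom (hH' k).symm) :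
    canTrans D h' = eqToHom (functor_bind_of_eq hH p) ≫
      (NatTrans.pi' (F := Functor.pi' H) (G := Functor.pi' H') t ◫ canTrans D h) ≫
        eqToHom (functor_bind_of_eq hH' q).symm := by
  obtain rfl : (fun k => (f k).functor D) = H := funext hH
  obtain rfl : (fun k => (f' k).functor D) = H' := funext hH'
  obtain rfl : (fun k => canTrans D (hf k)) = t := funext fun k => by simpa using ht k
  exact canTrans_bind h hf h'

theorem functor_map_eq (s : Equiv.Perm (Fin n)) (p : PTree (Fin n)) :
    (p.map s).functor D = endSMul s (p.functor D) :=
  functor_bind_of_eq (H := fun k => Pi.eval (fun _ => D) (s k)) (fun _ => rfl) p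

theorem canTrans_map (s : Equiv.Perm (Fin n)) {p q : PTree (Fin n)} (h : p.letters = q.letters)
    (h' : (p.map s).letters = (q.map s).letters) :
    canTrans D h' = eqToHom (functor_map_eq s p) ≫ endSMulMap s (canTrans D h) ≫
      eqToHom (functor_map_eq s q).symm := by
  refine (canTrans_bind_of_eq (H := fun k => Pi.eval (fun _ => D) (s k))
    (H' := fun k => Pi.eval (fun _ => D) (s k)) h (fun _ => rfl) h' (fun _ => rfl) (fun _ => rfl)
    (fun _ => 𝟙 _) fun k => ?_).trans ?_
  · exact (canTrans_refl _).trans (id_eq_eqToHom_comp _)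
  · congr 2
    ext X
    refine (NatTrans.hcomp_app ..).trans ?_
    refine (congrArg (_ ≫ ·) ((q.functor D).map_id _)).trans ?_
    exact Category.comp_id _

theorem functor_substTree (i : Fin (n + 1)) (t : PTree (Fin m)) (k : Fin (n + 1)) :
    (WPaB.substTree i t k).functor D = argFunctor i (t.functor D) (slot m i k) := by
  rw [WPaB.substTree]
  cases slot m i k with
  | some a => rfl
  | none =>
    exact functor_bind_of_eq (H := fun b => Pi.eval (fun _ => D) (block i b)) (fun _ => rfl) t

theorem letters_substTree (i : Fin (n + 1)) {t t' : PTree (Fin m)} (h : t.letters = t'.letters)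
    (k : Fin (n + 1)) : (WPaB.substTree i t k).letters = (WPaB.substTree i t' k).letters := by
  rw [WPaB.substTree, WPaB.substTree]
  cases slot m i k with
  | some a => rfl
  | none => simp only [WPaB.slotTree, PTree.map, PTree.letters_bind, h]

theorem canTrans_substTree (i : Fin (n + 1)) {t t' : PTree (Fin m)} (h : t.letters = t'.letters)
    (k : Fin (n + 1)) :
    canTrans D (letters_substTree i h k) = eqToHom (functor_substTree i t k) ≫
      argTrans i (canTrans D h) (slot m i k) ≫ eqToHom (functor_substTree i t' k).symm := by
  have H : ∀ (o : Option (Fin (n + m)))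
      (h1 : (WPaB.slotTree i t o).letters = (WPaB.slotTree i t' o).letters)
      (h2 : (WPaB.slotTree i t o).functor D = argFunctor i (t.functor D) o)
      (h3 : (WPaB.slotTree i t' o).functor D = argFunctor i (t'.functor D) o),
      canTrans D h1 = eqToHom h2 ≫ argTrans i (canTrans D h) o ≫ eqToHom h3.symm := by
    intro o h1 h2 h3
    cases o with
    | some a => exact (canTrans_refl _).trans (id_eq_eqToHom_comp h2)
    | none =>
      refine (canTrans_bind_of_eq (H := fun b => Pi.eval (fun _ => D) (block i b))
        (H' := fun b => Pi.eval (fun _ => D) (block i b)) h (fun _ => rfl) h1 (fun _ => rfl)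
        (fun _ => rfl) (fun _ => 𝟙 _) fun k => ?_).trans ?_
      · exact (canTrans_refl _).trans (id_eq_eqToHom_comp _)
      · congr 2
        ext X
        refine (NatTrans.hcomp_app ..).trans ?_
        refine (congrArg (_ ≫ ·) ((t'.functor D).map_id _)).trans ?_
        exact Category.comp_id _
  exact H _ _ (functor_substTree i t k) (functor_substTree i t' k)

theorem functor_comp (p : PTree (Fin (n + 1))) (i : Fin (n + 1)) (t : PTree (Fin m)) :
    (Omega.compTree p i t).functor D = endComp (p.functor D) i (t.functor D) :=
  functor_bind_of_eq (functor_substTree i t) p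

theorem canTrans_comp {p p' : PTree (Fin (n + 1))} (h : p.letters = p'.letters) (i : Fin (n + 1))
    {t t' : PTree (Fin m)} (ht : t.letters = t'.letters)
    (h' : (Omega.compTree p i t).letters = (Omega.compTree p' i t').letters) :
    canTrans D h' = eqToHom (functor_comp p i t) ≫
      endCompMap (canTrans D h) i (canTrans D ht) ≫ eqToHom (functor_comp p' i t').symm :=
  canTrans_bind_of_eq h (letters_substTree i ht) h' (functor_substTree i t)
    (functor_substTree i t') _ (canTrans_substTree i ht)

theorem letters_unbraid (x : WPaB n) : x.unbraid.tree.letters = x.source.reduceOption := by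
  rw [PTree.letters_eq_vars, PTree.vars]
  exact congrArg _ x.leaves_unbraidTree

theorem letters_eq_of_hom {x y : WPaB n} (f : x ⟶ y) :
    x.unbraid.tree.letters = y.unbraid.tree.letters := by
  rw [letters_unbraid, letters_unbraid]
  exact WPaB.nonempty_hom_iff.1 ⟨f⟩

/-- The weak braiding on a monoidal category in which an object `(p, A)` acts through the tensor
product of its arguments in the order in which the strands of `A` start, and in which all morphisms
act through associators and unitors. -/
noncomputable def weakBraiding (D : Type u) [Category.{v} D] [MonoidalCategory D] :
    WeakBraiding D where
  φ n :=
    { obj := fun x => x.unbraid.tree.functor D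
      map := fun f => canTrans D (letters_eq_of_hom f)
      map_id := fun x => canTrans_refl _
      map_comp := fun f g => by
        ext X
        exact (can_trans X (letters_eq_of_hom f) (letters_eq_of_hom g)).symm }
  obj_one := congrArg (fun p : Omega 1 => p.tree.functor D) (WPaB.unbraid_ofWord _)
  obj_smul s x := (congrArg (fun p : Omega _ => p.tree.functor D) (WPaB.unbraid_smul s x)).trans
    (functor_map_eq s _)
  map_smul s x y f h := by
    have e (x) : (WPaB.smul s x).unbraid.tree = x.unbraid.tree.map s :=
      congrArg Omega.tree (WPaB.unbraid_smul s x)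
    refine (canTrans_congr (e x) (e y) _ (by
      rw [← e, ← e]; exact letters_eq_of_hom h)).trans ?_
    rw [canTrans_map s (letters_eq_of_hom f)]
    simp only [Category.assoc, eqToHom_trans, eqToHom_trans_assoc]
  obj_comp x i y :=
    (congrArg (fun p : Omega _ => p.tree.functor D) (WPaB.unbraid_comp x i y)).trans
      (functor_comp _ i _)
  map_comp {n m x x'} f i {y y'} g h := by
    have e (x : WPaB (n + 1)) (y : WPaB m) : (WPaB.comp x i y).unbraid.tree =
      Omega.compTree x.unbraid.tree i y.unbraid.tree :=
      congrArg Omega.tree (WPaB.unbraid_comp x i y)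
    refine (canTrans_congr (e x y) (e x' y') _ (by
      rw [← e, ← e]; exact letters_eq_of_hom h)).trans ?_
    rw [canTrans_comp (letters_eq_of_hom f) i (letters_eq_of_hom g)]
    simp only [Category.assoc, eqToHom_trans, eqToHom_trans_assoc]

theorem weakBraiding_obj_ofWord (p : Omega n) :
    ((weakBraiding D).φ n).obj (WPaB.ofWord p) = p.tree.functor D :=
  congrArg (fun p : Omega _ => p.tree.functor D) (WPaB.unbraid_ofWord p)

theorem nonempty_ofWord_hom {p q : Omega n} (h : p.tree.vars = q.tree.vars) :
    Nonempty (WPaB.ofWord p ⟶ WPaB.ofWord q) := by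
  rw [WPaB.nonempty_hom_iff, WPaB.source_ofWord, WPaB.source_ofWord]
  exact h

theorem weakBraiding_map_app {p q : Omega n} (f : WPaB.ofWord p ⟶ WPaB.ofWord q)
    (h : p.tree.letters = q.tree.letters) (X : Fin n → D) :
    (((weakBraiding D).φ n).map f).app X =
      eqToHom (Functor.congr_obj (weakBraiding_obj_ofWord p) X) ≫ can X h ≫
        eqToHom (Functor.congr_obj (weakBraiding_obj_ofWord q) X).symm := by
  have e (p : Omega n) : (WPaB.ofWord p).unbraid.tree = p.tree :=
    congrArg Omega.tree (WPaB.unbraid_ofWord p)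
  refine (congrArg (fun t => t.app X) (canTrans_congr (e p) (e q) (letters_eq_of_hom f) h)).trans ?_
  rw [NatTrans.comp_app, NatTrans.comp_app, eqToHom_app, eqToHom_app]
  rfl

theorem weakBraiding_extendsMonoidal : (weakBraiding D).ExtendsMonoidal where
  obj_ofWord := weakBraiding_obj_ofWord
  associator := by
    obtain ⟨f⟩ := nonempty_ofWord_hom (p := wordAssocL) (q := wordAssocR) (by decide)
    refine ⟨f, fun X => (weakBraiding_map_app f rfl X).trans ?_⟩
    exact congrArg (fun t => _ ≫ t ≫ _)
      (can_associator X (p := .leaf 0) (q := .leaf 1) (r := .leaf 2) _)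
  leftUnitor := by
    obtain ⟨f⟩ := nonempty_ofWord_hom (p := wordOX) (q := wordX) (by decide)
    refine ⟨f, fun X => (weakBraiding_map_app f rfl X).trans ?_⟩
    exact congrArg (fun t => _ ≫ t ≫ _) (can_leftUnitor X (p := .leaf 0) _)
  rightUnitor := by
    obtain ⟨f⟩ := nonempty_ofWord_hom (p := wordXO) (q := wordX) (by decide)
    refine ⟨f, fun X => (weakBraiding_map_app f rfl X).trans ?_⟩
    exact congrArg (fun t => _ ≫ t ≫ _) (can_rightUnitor X (p := .leaf 0) _)

theorem weakBraiding_isMultiadditive [Preadditive D] [MonoidalPreadditive D] (x : WPaB n) :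
    IsMultiadditive (((weakBraiding D).φ n).obj x) := by
  intro X Y i f f' f'' h h'
  refine PTree.functor_map_add (p := x.unbraid.tree) ?_ ?_ h h'
  · rw [PTree.letters_eq_vars]; exact x.unbraid.nodup
  · rw [PTree.letters_eq_vars]; exact x.unbraid.mem i

end Algebra

end WeakBraid

/-! ### The Yang–Baxter equation for the `G`-braiding -/

namespace WeakBraid

section Monoidal

open MonoidalCategory

variable {D : Type u} [Category.{v} D] [MonoidalCategory D]

theorem yangBaxter_whisker {S T U R A B B' E E' : D} (f₁ : S ⊗ T ⟶ A ⊗ S) (f₂ : S ⊗ U ⟶ B ⊗ S)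
    (f₃ : A ⊗ B ⟶ E ⊗ A) (e : E ⟶ E') (g₁ : T ⊗ U ⟶ B' ⊗ T) (g₂ : S ⊗ B' ⟶ E' ⊗ S)
    (H : f₁ ▷ U ≫ (α_ A S U).hom ≫ A ◁ f₂ ≫ (α_ A B S).inv ≫ (f₃ ≫ e ▷ A) ▷ S =
      (α_ S T U).hom ≫ S ◁ g₁ ≫ (α_ S B' T).inv ≫ g₂ ▷ T ≫ (α_ E' S T).hom ≫ E' ◁ f₁ ≫
        (α_ E' A S).inv) :
    ((α_ S T (U ⊗ R)).inv ≫ f₁ ▷ (U ⊗ R) ≫ (α_ A S (U ⊗ R)).hom) ≫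
      A ◁ ((α_ S U R).inv ≫ f₂ ▷ R ≫ (α_ B S R).hom) ≫
        ((α_ A B (S ⊗ R)).inv ≫ f₃ ▷ (S ⊗ R) ≫ (α_ E A (S ⊗ R)).hom) ≫ e ▷ (A ⊗ (S ⊗ R)) =
    S ◁ ((α_ T U R).inv ≫ g₁ ▷ R ≫ (α_ B' T R).hom) ≫
      ((α_ S B' (T ⊗ R)).inv ≫ g₂ ▷ (T ⊗ R) ≫ (α_ E' S (T ⊗ R)).hom) ≫
        E' ◁ ((α_ S T R).inv ≫ f₁ ▷ R ≫ (α_ A S R).hom) := by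
  calc _ = 𝟙 _ ⊗≫ (f₁ ▷ U ≫ (α_ A S U).hom ≫ A ◁ f₂ ≫ (α_ A B S).inv ≫ (f₃ ≫ e ▷ A) ▷ S) ▷ R ⊗≫
        𝟙 _ := by monoidal
    _ = _ := by rw [H]; monoidal

theorem cross_whisker {S T A R R' : D} (f : S ⊗ T ⟶ A ⊗ S) (g : R ⟶ R') :
    ((α_ S T R).inv ≫ f ▷ R ≫ (α_ A S R).hom) ≫ A ◁ (S ◁ g) =
      S ◁ (T ◁ g) ≫ (α_ S T R').inv ≫ f ▷ R' ≫ (α_ A S R').hom := by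
  rw [associator_inv_naturality_right_assoc, whisker_exchange_assoc, Category.assoc,
    Category.assoc, associator_naturality_right]

theorem pair_whisker {S T U A B A' B' : D} (f : S ⊗ T ⟶ A ⊗ S) (g : S ⊗ U ⟶ B ⊗ S)
    (p : A ⟶ A') (q : B ⟶ B') :
    ((α_ S T U).inv ≫ f ▷ U ≫ (α_ A S U).hom ≫ A ◁ g ≫ (α_ A B S).inv) ≫ (p ⊗ₘ q) ▷ S =
      (α_ S T U).inv ≫ (f ≫ p ▷ S) ▷ U ≫ (α_ A' S U).hom ≫ A' ◁ (g ≫ q ▷ S) ≫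
        (α_ A' B' S).inv := by
  calc _ = (α_ S T U).inv ≫ f ▷ U ≫ (α_ A S U).hom ≫ (A ◁ g ≫ p ▷ (B ⊗ S)) ≫
        (α_ A' B S).inv ≫ (A' ◁ q) ▷ S := by
          rw [MonoidalCategory.tensorHom_def]; monoidal
    _ = _ := by rw [whisker_exchange]; monoidal

end Monoidal

namespace BraidedGCrossed

open MonoidalCategory

variable {G : Type w} [Group G] {D : Type u} [Category.{v} D] [Abelian D] [MonoidalCategory D]
  {C : BraidedGCrossed G D} {n : ℕ}

theorem actStrand_mul (a b : G) (s : Strand G n) :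
    actStrand a (actStrand b s) = actStrand (a * b) s := by
  cases s with
  | none => rfl
  | some s => simp [actStrand, mul_assoc]

theorem actStrand_one (s : Strand G n) : actStrand 1 s = s := by
  cases s with
  | none => rfl
  | some s => simp [actStrand]

namespace Family

variable (X : C.Family n)

theorem strandDeg_actStrand (a : G) (s : Strand G n) :
    X.strandDeg (actStrand a s) = a * X.strandDeg s * a⁻¹ := by
  cases s with
  | none => simp [actStrand, strandDeg]
  | some s => simp [actStrand, strandDeg, mul_assoc]

/-- The isomorphisms `F a (F b S) ≅ F (a * b) S` are compatible with `actIso`. -/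
theorem actIso_actIso (a b : G) (s : Strand G n) :
    (C.F a).map (X.actIso b s).hom ≫ (X.actIso a (actStrand b s)).hom =
      (C.mulIso a b).hom.app (X.strandObj s) ≫ (X.actIso (a * b) s).hom ≫
        eqToHom (congrArg X.strandObj (actStrand_mul a b s).symm) := by
  cases s with
  | none =>
    have h := (C.mulIso_monoidal a b).unit
    rw [Functor.LaxMonoidal.comp_ε] at h
    change (C.F a).map (Functor.Monoidal.εIso (C.F b)).inv ≫ (Functor.Monoidal.εIso (C.F a)).inv =
      (C.mulIso a b).hom.app (𝟙_ D) ≫ (Functor.Monoidal.εIso (C.F (a * b))).inv ≫ 𝟙 _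
    rw [Category.comp_id, Iso.eq_comp_inv, ← Functor.mapIso_inv, Category.assoc, Iso.inv_comp_eq,
      Iso.inv_comp_eq]
    simp only [Functor.mapIso_hom, Functor.Monoidal.εIso_hom]
    rw [← h, Category.assoc]
  | some s => exact C.mulIso_assoc a b s.1 (X.obj s.2)

theorem eqToHom_actIso {a b : G} (h : a = b) (s : Strand G n) {V W Z : D}
    (k : X.strandObj (actStrand b s) ⟶ Z) (f : V ⟶ W)
    (h' : (C.F a).obj (X.strandObj s) ⊗ V = (C.F b).obj (X.strandObj s) ⊗ V) :
    eqToHom h' ≫ (((X.actIso b s).hom ≫ k) ⊗ₘ f) =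
      ((X.actIso a s).hom ≫ eqToHom (by rw [h]) ≫ k) ⊗ₘ f := by
  subst h
  simp

/-- The positive crossing of two strands. -/
def crossHom {a : G} {s : Strand G n} (hs : C.deg a (X.strandObj s)) (t : Strand G n) :
    X.strandObj s ⊗ X.strandObj t ⟶ X.strandObj (actStrand a t) ⊗ X.strandObj s :=
  (C.c hs (X.strandObj t)).hom ≫ (X.actIso a t).hom ▷ X.strandObj s

/-- The functor `F a` takes the crossing of `t` and `u` to the crossing of the twisted strands. -/
theorem act_crossHom {a b : G} {t : Strand G n} (ht : C.deg b (X.strandObj t)) (u : Strand G n)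
    {c : G} (hc : c = a * b * a⁻¹) (hat : C.deg c (X.strandObj (actStrand a t)))
    (h : actStrand c (actStrand a u) = actStrand a (actStrand b u)) :
    Functor.OplaxMonoidal.δ (C.F a) (X.strandObj t) (X.strandObj u) ≫
        ((X.actIso a t).hom ⊗ₘ (X.actIso a u).hom) ≫ X.crossHom hat (actStrand a u) ≫
          eqToHom (congrArg X.strandObj h) ▷ _ =
      (C.F a).map (X.crossHom ht u) ≫ Functor.OplaxMonoidal.δ (C.F a) _ _ ≫
        ((X.actIso a (actStrand b u)).hom ⊗ₘ (X.actIso a t).hom) := by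
  subst hc
  have hact := C.c_action a ht (X.strandObj u)
  have hR : (C.F a).map (X.crossHom ht u) ≫ Functor.OplaxMonoidal.δ (C.F a) _ _ ≫
      ((X.actIso a (actStrand b u)).hom ⊗ₘ (X.actIso a t).hom) =
      ((C.F a).map (C.c ht (X.strandObj u)).hom ≫
        Functor.OplaxMonoidal.δ (C.F a) ((C.F b).obj (X.strandObj u)) (X.strandObj t) ≫
          (C.mulIso a b).hom.app (X.strandObj u) ▷ (C.F a).obj (X.strandObj t)) ≫
        (((X.actIso (a * b) u).hom ≫ eqToHom (congrArg X.strandObj (actStrand_mul a b u).symm)) ⊗ₘ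
          (X.actIso a t).hom) := by
    rw [crossHom, Functor.map_comp, Category.assoc, ← Functor.OplaxMonoidal.δ_natural_left_assoc]
    simp only [Category.assoc]
    rw [← tensorHom_id, ← tensorHom_id, tensorHom_comp_tensorHom, tensorHom_comp_tensorHom,
      actIso_actIso]
  rw [hR, hact, crossHom]
  simp only [Category.assoc]
  rw [reassoc_of% (C.c_naturality (C.deg_F a ht) hat (X.actIso a t).hom (X.actIso a u).hom)]
  rw [X.eqToHom_actIso (show a * b * a⁻¹ * a = a * b by simp) u]
  simp only [← tensorHom_id, tensorHom_comp_tensorHom, Category.comp_id]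
  rw [reassoc_of% (X.actIso_actIso (a * b * a⁻¹) a u)]
  simp

/-- Naturality of the braiding with respect to the second factor, a pair of strands. -/
theorem c_pair {a : G} {s : Strand G n} (hs : C.deg a (X.strandObj s)) (t u : Strand G n) :
    (C.c hs (X.strandObj t ⊗ X.strandObj u)).hom ≫
        (Functor.OplaxMonoidal.δ (C.F a) (X.strandObj t) (X.strandObj u) ≫
          ((X.actIso a t).hom ⊗ₘ (X.actIso a u).hom)) ▷ X.strandObj s =
      (α_ _ _ _).inv ≫ X.crossHom hs t ▷ X.strandObj u ≫ (α_ _ _ _).hom ≫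
        X.strandObj (actStrand a t) ◁ X.crossHom hs u ≫ (α_ _ _ _).inv := by
  rw [comp_whiskerRight, reassoc_of% (C.hexagon_right hs (X.strandObj t) (X.strandObj u))]
  refine Eq.trans ?_ (pair_whisker (C.c hs (X.strandObj t)).hom (C.c hs (X.strandObj u)).hom
    (X.actIso a t).hom (X.actIso a u).hom)
  simp only [Category.assoc]

/-- The Yang–Baxter equation for three strands. -/
theorem yangBaxter {a b c : G} {s t : Strand G n} (hs : C.deg a (X.strandObj s))
    (ht : C.deg b (X.strandObj t)) (hc : c = a * b * a⁻¹)
    (hat : C.deg c (X.strandObj (actStrand a t))) (u : Strand G n)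
    (h : actStrand c (actStrand a u) = actStrand a (actStrand b u)) :
    X.crossHom hs t ▷ X.strandObj u ≫ (α_ _ _ _).hom ≫ _ ◁ X.crossHom hs u ≫ (α_ _ _ _).inv ≫
        (X.crossHom hat (actStrand a u) ≫ eqToHom (congrArg X.strandObj h) ▷ _) ▷ X.strandObj s =
      (α_ _ _ _).hom ≫ X.strandObj s ◁ X.crossHom ht u ≫ (α_ _ _ _).inv ≫
        X.crossHom hs (actStrand b u) ▷ X.strandObj t ≫ (α_ _ _ _).hom ≫
          _ ◁ X.crossHom hs t ≫ (α_ _ _ _).inv := by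
  have h1 := X.c_pair hs t u
  have h2 := X.c_pair hs (actStrand b u) t
  have h3 := X.act_crossHom ht u hc hat h
  have h4 := C.c_naturality hs hs (𝟙 _) (X.crossHom ht u)
  rw [id_tensorHom, tensorHom_id] at h4
  rw [← Iso.inv_comp_eq]
  have e1 : (α_ _ _ _).inv ≫ X.crossHom hs t ▷ X.strandObj u ≫ (α_ _ _ _).hom ≫
      _ ◁ X.crossHom hs u ≫ (α_ _ _ _).inv ≫ (X.crossHom hat (actStrand a u) ≫
        eqToHom (congrArg X.strandObj h) ▷ _) ▷ X.strandObj s =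
      ((α_ _ _ _).inv ≫ X.crossHom hs t ▷ X.strandObj u ≫ (α_ _ _ _).hom ≫
        X.strandObj (actStrand a t) ◁ X.crossHom hs u ≫ (α_ _ _ _).inv) ≫
        (X.crossHom hat (actStrand a u) ≫
        eqToHom (congrArg X.strandObj h) ▷ _) ▷ X.strandObj s := by simp only [Category.assoc]
  rw [e1, ← h1, ← h2, reassoc_of% h4, Category.assoc, ← comp_whiskerRight, ← comp_whiskerRight,
    Category.assoc, h3]

end Family

end BraidedGCrossed

end WeakBraid

/-! ### The action of the braid group on strands -/

namespace WeakBraid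

namespace BraidedGCrossed

open MonoidalCategory

variable {G : Type w} [Group G] {D : Type u} [Category.{v} D] [Abelian D] [MonoidalCategory D]
  {C : BraidedGCrossed G D} {n : ℕ}

namespace Family

variable (X : C.Family n)

theorem eqToHom_tensor_cons (s : Strand G n) {l l' : List (Strand G n)} (h : l = l') :
    eqToHom (congrArg X.tensor (congrArg (s :: ·) h)) =
      X.strandObj s ◁ eqToHom (congrArg X.tensor h) := by
  subst h
  exact (whiskerLeft_id _ _).symm

theorem eqToHom_tensor_head {s s' : Strand G n} (l : List (Strand G n)) (h : s = s') :
    eqToHom (congrArg X.tensor (congrArg (· :: l) h)) =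
      eqToHom (congrArg X.strandObj h) ▷ X.tensor l := by
  subst h
  exact (id_whiskerRight _ _).symm

@[simp]
theorem length_cross (j : ℕ) (l : List (Strand G n)) : (X.cross j l).length = l.length := by
  fun_induction X.cross j l with
  | case1 => rfl
  | case2 _ _ _ ih => simp [ih]
  | case3 => rfl

/-- On labels, a crossing depends only on the degrees of the objects. -/
theorem cross_congr {Y : C.Family n} (h : X.g = Y.g) (j : ℕ) (l : List (Strand G n)) :
    X.cross j l = Y.cross j l := by
  have hd (s : Strand G n) : X.strandDeg s = Y.strandDeg s := by
    cases s with
    | none => rfl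
    | some s => simp [strandDeg, h]
  induction j generalizing l with
  | zero =>
    rcases l with _ | ⟨s, _ | ⟨t, l⟩⟩
    · rfl
    · rfl
    · simp [cross, hd]
  | succ j ih =>
    cases l with
    | nil => rfl
    | cons s l => simp [cross, ih]

/-- The inverse of the crossing of the strands in positions `j` and `j + 1` on labels. -/
def uncross : ℕ → List (Strand G n) → List (Strand G n)
  | 0, t :: s :: l => s :: actStrand (X.strandDeg s)⁻¹ t :: l
  | j + 1, s :: l => s :: uncross j l
  | _, l => l

theorem cross_uncross (j : ℕ) (l : List (Strand G n)) : X.cross j (X.uncross j l) = l := by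
  fun_induction X.uncross j l with
  | case1 => simp [cross, actStrand_mul, actStrand_one]
  | case2 _ _ _ ih => simp [cross, ih]
  | case3 j l h1 h2 =>
    unfold cross
    split
    · exact absurd rfl (h1 _ _ _ rfl)
    · exact absurd rfl (h2 _ _ _ rfl)
    · rfl

theorem uncross_cross (j : ℕ) (l : List (Strand G n)) : X.uncross j (X.cross j l) = l := by
  fun_induction X.cross j l with
  | case1 => simp [uncross, actStrand_mul, actStrand_one]
  | case2 _ _ _ ih => simp [uncross, ih]
  | case3 j l h1 h2 =>
    unfold uncross
    split
    · exact absurd rfl (h1 _ _ _ rfl)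
    · exact absurd rfl (h2 _ _ _ rfl)
    · rfl

/-- The braid relation `σ_i σ_{i+1} σ_i = σ_{i+1} σ_i σ_{i+1}` for the action through the
`G`-braiding. -/
theorem crossIso_braid (i : ℕ) (l : List (Strand G n)) (hl : i + 2 < l.length) :
    ∃ h : X.cross i (X.cross (i + 1) (X.cross i l)) =
        X.cross (i + 1) (X.cross i (X.cross (i + 1) l)),
      (X.crossIso i l).hom ≫ (X.crossIso (i + 1) (X.cross i l)).hom ≫
          (X.crossIso i (X.cross (i + 1) (X.cross i l))).hom ≫ eqToHom (congrArg X.tensor h) =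
        (X.crossIso (i + 1) l).hom ≫ (X.crossIso i (X.cross (i + 1) l)).hom ≫
          (X.crossIso (i + 1) (X.cross i (X.cross (i + 1) l))).hom := by
  induction i generalizing l with
  | zero =>
    match l, hl with
    | s :: t :: u :: r, _ =>
      have h : actStrand (X.strandDeg (actStrand (X.strandDeg s) t))
          (actStrand (X.strandDeg s) u) =
          actStrand (X.strandDeg s) (actStrand (X.strandDeg t) u) := by
        rw [strandDeg_actStrand, actStrand_mul, actStrand_mul]
        congr 1
        group
      have e := X.eqToHom_tensor_head (actStrand (X.strandDeg s) t :: s :: r) h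
      refine ⟨congrArg (· :: actStrand (X.strandDeg s) t :: s :: r) h, ?_⟩
      refine (congrArg (fun k => (X.crossIso 0 (s :: t :: u :: r)).hom ≫
        (X.crossIso 1 (X.cross 0 (s :: t :: u :: r))).hom ≫
          (X.crossIso 0 (X.cross 1 (X.cross 0 (s :: t :: u :: r)))).hom ≫ k) e).trans ?_
      exact yangBaxter_whisker (R := X.tensor r) (X.crossHom (X.deg_strand s) t)
        (X.crossHom (X.deg_strand s) u) (X.crossHom (X.deg_strand _) _) _
        (X.crossHom (X.deg_strand t) u) (X.crossHom (X.deg_strand s) _)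
        (X.yangBaxter (X.deg_strand s) (X.deg_strand t) (X.strandDeg_actStrand _ t)
          (X.deg_strand _) u h)
  | succ i ih =>
    match l, hl with
    | s :: l, hl =>
      obtain ⟨h, e⟩ := ih l (by simp only [List.length_cons] at hl; omega)
      refine ⟨congrArg (s :: ·) h, ?_⟩
      have e' := congrArg (X.strandObj s ◁ ·) e
      simp only [whiskerLeft_comp] at e'
      rw [← X.eqToHom_tensor_cons s h] at e'
      exact e'

/-- Crossings of disjoint pairs of strands commute. -/
theorem crossIso_comm (i j : ℕ) (hij : i + 2 ≤ j) (l : List (Strand G n)) (hl : j + 1 < l.length) :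
    ∃ h : X.cross i (X.cross j l) = X.cross j (X.cross i l),
      (X.crossIso j l).hom ≫ (X.crossIso i (X.cross j l)).hom ≫ eqToHom (congrArg X.tensor h) =
        (X.crossIso i l).hom ≫ (X.crossIso j (X.cross i l)).hom := by
  induction i generalizing j l with
  | zero =>
    match j, hij, l, hl with
    | j + 2, _, s :: t :: r, _ =>
      refine ⟨rfl, ?_⟩
      refine (congrArg (_ ≫ ·) (Category.comp_id _)).trans ?_
      exact (cross_whisker (X.crossHom (X.deg_strand s) t) (X.crossIso j r).hom).symm
  | succ i ih =>
    match j, hij, l, hl with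
    | j + 1, hij, s :: l, hl =>
      obtain ⟨h, e⟩ := ih j (by omega) l (by simpa using hl)
      refine ⟨congrArg (s :: ·) h, ?_⟩
      have e' := congrArg (X.strandObj s ◁ ·) e
      simp only [whiskerLeft_comp] at e'
      rw [← X.eqToHom_tensor_cons s h] at e'
      exact e'

/-- Morphisms from the tensor product of the strands `l₀` to tensor products of `L` strands. -/
abbrev Path (L : ℕ) (l₀ : List (Strand G n)) : Type _ :=
  Σ l : {l : List (Strand G n) // l.length = L}, (X.tensor l₀ ⟶ X.tensor l.1)

variable {X} in
theorem Path.ext_iff {L : ℕ} {l₀ : List (Strand G n)} {p q : X.Path L l₀} :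
    p = q ↔ ∃ h : p.1.1 = q.1.1, p.2 ≫ eqToHom (congrArg X.tensor h) = q.2 := by
  constructor
  · rintro rfl
    exact ⟨rfl, by simp⟩
  · obtain ⟨⟨l, hl⟩, f⟩ := p
    obtain ⟨⟨l', hl'⟩, f'⟩ := q
    rintro ⟨h, e⟩
    obtain rfl : l = l' := h
    obtain rfl : f = f' := by simpa using e
    rfl

/-- Postcomposition with the crossing of the strands in positions `j` and `j + 1`. -/
def step (L : ℕ) (l₀ : List (Strand G n)) (j : ℕ) : Equiv.Perm (X.Path L l₀) where
  toFun p := ⟨⟨X.cross j p.1.1, by rw [length_cross, p.1.2]⟩, p.2 ≫ (X.crossIso j p.1.1).hom⟩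
  invFun p := ⟨⟨X.uncross j p.1.1, by
      rw [← X.length_cross j, cross_uncross, p.1.2]⟩,
    p.2 ≫ eqToHom (congrArg X.tensor (X.cross_uncross j p.1.1).symm) ≫
      (X.crossIso j (X.uncross j p.1.1)).inv⟩
  left_inv p := by
    refine Path.ext_iff.2 ⟨X.uncross_cross j p.1.1, ?_⟩
    have key : ∀ (l : List (Strand G n)) (h : l = p.1.1),
        (X.crossIso j p.1.1).hom ≫ eqToHom (congrArg (fun l => X.tensor (X.cross j l)) h.symm) ≫
          (X.crossIso j l).inv ≫ eqToHom (congrArg X.tensor h) = 𝟙 _ := by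
      rintro l rfl
      simp
    simp only [Category.assoc]
    exact (congrArg (p.2 ≫ ·) (key _ (X.uncross_cross j p.1.1))).trans (Category.comp_id _)
  right_inv p := by
    refine Path.ext_iff.2 ⟨X.cross_uncross j p.1.1, ?_⟩
    simp

/-- The action of the braid group through the `G`-braiding. -/
def braidAct (L : ℕ) (l₀ : List (Strand G n)) : BraidGroup L →* Equiv.Perm (X.Path L l₀) :=
  liftBraid (X.step L l₀)
    (by
      intro i hi
      ext1 p
      obtain ⟨h, e⟩ := X.crossIso_braid i p.1.1 (by rw [p.1.2]; exact hi)
      refine Path.ext_iff.2 ⟨h, ?_⟩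
      simpa [step] using congrArg (p.2 ≫ ·) e)
    (by
      intro i j hij hj
      ext1 p
      obtain ⟨h, e⟩ := X.crossIso_comm i j hij p.1.1 (by rw [p.1.2]; exact hj)
      refine Path.ext_iff.2 ⟨h, ?_⟩
      simpa [step] using congrArg (p.2 ≫ ·) e)

variable {X}

theorem BraidActs.braidAct_eq {L : ℕ} {A : BraidGroup L} {l l' : List (Strand G n)}
    {f : X.tensor l ⟶ X.tensor l'} (H : X.BraidActs A l l' f) (hl : l.length = L) :
    ∃ hl' : l'.length = L, X.braidAct L l A ⟨⟨l, hl⟩, 𝟙 _⟩ = ⟨⟨l', hl'⟩, f⟩ := by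
  induction H with
  | one l => exact ⟨hl, by simp⟩
  | mul hj H ih =>
    obtain ⟨h, e⟩ := ih hl
    refine ⟨(X.length_cross _ _).trans h, ?_⟩
    rw [map_mul, Equiv.Perm.mul_apply, e, braidAct, liftBraid_sig _ _ _ (by omega)]
    rfl
  | inv_mul hj H ih =>
    obtain ⟨h, e⟩ := ih hl
    refine ⟨(X.length_cross _ _).symm.trans h, ?_⟩
    rw [map_mul, Equiv.Perm.mul_apply, e, map_inv, Equiv.Perm.inv_eq_iff_eq, braidAct,
      liftBraid_sig _ _ _ (by omega)]
    refine Path.ext_iff.2 ⟨rfl, (Category.comp_id _).trans ?_⟩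
    simp [step]

/-- The action of a braid does not depend on its expression as a product of generators. -/
theorem BraidActs.unique {L : ℕ} {A : BraidGroup L} {l l₁ l₂ : List (Strand G n)}
    {f₁ : X.tensor l ⟶ X.tensor l₁} {f₂ : X.tensor l ⟶ X.tensor l₂} (H₁ : X.BraidActs A l l₁ f₁)
    (H₂ : X.BraidActs A l l₂ f₂) (hl : l.length = L) :
    ∃ h : l₁ = l₂, f₁ ≫ eqToHom (congrArg X.tensor h) = f₂ := by
  obtain ⟨h₁, e₁⟩ := H₁.braidAct_eq hl
  obtain ⟨h₂, e₂⟩ := H₂.braidAct_eq hl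
  exact Path.ext_iff.1 (e₁.symm.trans e₂)

end Family

end BraidedGCrossed

end WeakBraid

/-! ### Naturality and existence of the action -/

namespace WeakBraid

section Monoidal

open MonoidalCategory

variable {D : Type u} [Category.{v} D] [MonoidalCategory D]

theorem cross_whisker_naturality {S S' T T' A A' B R R' : D} {p : S ⟶ S'} {q : T ⟶ T'}
    {q' : A ⟶ A'} (w : R ⟶ R') {f : S ⊗ T ⟶ A ⊗ S} {f' : S' ⊗ T' ⟶ B ⊗ S'} {e : B ⟶ A'}
    (H : (p ⊗ₘ q) ≫ f' ≫ e ▷ S' = f ≫ (q' ⊗ₘ p)) :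
    (p ⊗ₘ q ⊗ₘ w) ≫ ((α_ S' T' R').inv ≫ f' ▷ R' ≫ (α_ B S' R').hom) ≫ e ▷ (S' ⊗ R') =
      ((α_ S T R).inv ≫ f ▷ R ≫ (α_ A S R).hom) ≫ (q' ⊗ₘ p ⊗ₘ w) := by
  calc _ = (α_ S T R).inv ≫ (((p ⊗ₘ q) ≫ f' ≫ e ▷ S') ⊗ₘ w ≫ 𝟙 _ ≫ 𝟙 _) ≫ (α_ A' S' R').hom := by
        simp only [Category.assoc]
        rw [associator_inv_naturality_assoc, ← associator_naturality_left]
        simp only [← tensorHom_comp_tensorHom, tensorHom_id, Category.assoc]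
    _ = (α_ S T R).inv ≫ ((f ≫ (q' ⊗ₘ p)) ⊗ₘ 𝟙 _ ≫ w) ≫ (α_ A' S' R').hom := by
        rw [H, Category.id_comp, Category.comp_id, Category.id_comp]
    _ = _ := by
        rw [← tensorHom_comp_tensorHom, tensorHom_id, Category.assoc, associator_naturality]
        simp only [Category.assoc]

end Monoidal

namespace BraidedGCrossed

section Strands

variable {G : Type w} {n : ℕ}

theorem strands_eq (a : Fin n → G) (p : PTree (Fin n)) :
    strands a p = p.leaves.map (Option.map fun i => (a i, i)) := by
  induction p with
  | unit => rfl
  | leaf i => rfl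
  | node l r hl hr => rw [strands, hl, hr, PTree.leaves, List.map_append]

theorem map_snd_strands (a : Fin n → G) (p : PTree (Fin n)) :
    (strands a p).map (Option.map Prod.snd) = p.leaves := by
  rw [strands_eq, List.map_map]
  convert List.map_id _ using 2
  ext o
  cases o <;> simp

end Strands

open MonoidalCategory

variable {G : Type w} [Group G] {D : Type u} [Category.{v} D] [Abelian D] [MonoidalCategory D]
  {C : BraidedGCrossed G D} {n : ℕ}

namespace Family

variable {X Y : C.Family n}

/-- The morphism of strands induced by morphisms of the objects of a family. -/
def strandMap (u : X.obj ⟶ Y.obj) : (s : Strand G n) → (X.strandObj s ⟶ Y.strandObj s)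
  | none => 𝟙 _
  | some (a, i) => (C.F a).map (u i)

/-- `Family.tensor` on morphisms. -/
def tensorMap (u : X.obj ⟶ Y.obj) : (l : List (Strand G n)) → (X.tensor l ⟶ Y.tensor l)
  | [] => 𝟙 _
  | s :: l => strandMap u s ⊗ₘ tensorMap u l

theorem tensorMap_eqToHom (u : X.obj ⟶ Y.obj) {l l' : List (Strand G n)} (h : l = l') :
    tensorMap u l ≫ eqToHom (congrArg Y.tensor h) =
      eqToHom (congrArg X.tensor h) ≫ tensorMap u l' := by
  subst h
  simp

theorem actIso_naturality (u : X.obj ⟶ Y.obj) (b : G) (s : Strand G n) :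
    (C.F b).map (strandMap u s) ≫ (Y.actIso b s).hom =
      (X.actIso b s).hom ≫ strandMap u (actStrand b s) := by
  cases s with
  | none =>
    change (C.F b).map (𝟙 (𝟙_ D)) ≫ (Functor.Monoidal.εIso (C.F b)).inv =
      (Functor.Monoidal.εIso (C.F b)).inv ≫ 𝟙 _
    simp
  | some s => exact (C.mulIso b s.1).hom.naturality (u s.2)

theorem crossHom_naturality (u : X.obj ⟶ Y.obj) {a b : G} (h : b = a) {s : Strand G n}
    (hX : C.deg a (X.strandObj s)) (hY : C.deg b (Y.strandObj s)) (t : Strand G n) :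
    (strandMap u s ⊗ₘ strandMap u t) ≫ Y.crossHom hY t ≫
        eqToHom (congrArg (fun c => Y.strandObj (actStrand c t)) h) ▷ Y.strandObj s =
      X.crossHom hX t ≫ (strandMap u (actStrand a t) ⊗ₘ strandMap u s) := by
  subst h
  rw [crossHom, crossHom, Category.assoc, reassoc_of% (C.c_naturality hX hY _ _)]
  simp only [← tensorHom_id, tensorHom_comp_tensorHom, eqToHom_refl, Category.comp_id,
    Category.id_comp, Category.assoc, actIso_naturality]

theorem strandDeg_congr (h : X.g = Y.g) (s : Strand G n) : X.strandDeg s = Y.strandDeg s := by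
  cases s with
  | none => rfl
  | some s => simp [strandDeg, h]

/-- A crossing is natural with respect to morphisms of families with the same degrees. -/
theorem crossIso_naturality (u : X.obj ⟶ Y.obj) (hg : X.g = Y.g) (j : ℕ) (l : List (Strand G n))
    (h : Y.cross j l = X.cross j l) :
    tensorMap u l ≫ (Y.crossIso j l).hom ≫ eqToHom (congrArg Y.tensor h) =
      (X.crossIso j l).hom ≫ tensorMap u (X.cross j l) := by
  induction j generalizing l with
  | zero =>
    match l with
    | [] =>
      change tensorMap u [] ≫ 𝟙 (Y.tensor []) ≫ 𝟙 (Y.tensor []) = 𝟙 (X.tensor []) ≫ tensorMap u []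
      simp
    | [s] =>
      change tensorMap u [s] ≫ 𝟙 (Y.tensor [s]) ≫ 𝟙 (Y.tensor [s]) =
        𝟙 (X.tensor [s]) ≫ tensorMap u [s]
      simp
    | s :: t :: l =>
      have e := (strandDeg_congr hg s).symm
      refine (congrArg (fun k => tensorMap u (s :: t :: l) ≫ (Y.crossIso 0 (s :: t :: l)).hom ≫ k)
        (Y.eqToHom_tensor_head (s :: l) (congrArg (actStrand · t) e))).trans ?_
      exact cross_whisker_naturality (tensorMap u l)
        (crossHom_naturality u e (X.deg_strand s) (Y.deg_strand s) t)
  | succ j ih =>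
    match l with
    | [] =>
      change tensorMap u [] ≫ 𝟙 (Y.tensor []) ≫ 𝟙 (Y.tensor []) = 𝟙 (X.tensor []) ≫ tensorMap u []
      simp
    | s :: l =>
      have h' := Y.cross_congr hg.symm j l
      refine (congrArg (fun k => tensorMap u (s :: l) ≫ (Y.crossIso (j + 1) (s :: l)).hom ≫ k)
        (Y.eqToHom_tensor_cons s h')).trans ?_
      change (strandMap u s ⊗ₘ tensorMap u l) ≫ Y.strandObj s ◁ (Y.crossIso j l).hom ≫
          Y.strandObj s ◁ eqToHom (congrArg Y.tensor h') =
        X.strandObj s ◁ (X.crossIso j l).hom ≫ (strandMap u s ⊗ₘ tensorMap u (X.cross j l))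
      rw [← whiskerLeft_comp, ← id_tensorHom, ← id_tensorHom, tensorHom_comp_tensorHom,
        tensorHom_comp_tensorHom, ih l h', Category.comp_id, Category.id_comp]

theorem appendIso_naturality (u : X.obj ⟶ Y.obj) (l' l : List (Strand G n)) :
    (tensorMap u l ⊗ₘ tensorMap u l') ≫ (Y.appendIso l' l).hom =
      (X.appendIso l' l).hom ≫ tensorMap u (l ++ l') := by
  induction l with
  | nil =>
    change (𝟙 (𝟙_ D) ⊗ₘ tensorMap u l') ≫ (λ_ _).hom = (λ_ _).hom ≫ tensorMap u l'
    simp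
  | cons s l ih =>
    change ((strandMap u s ⊗ₘ tensorMap u l) ⊗ₘ tensorMap u l') ≫ (α_ _ _ _).hom ≫
        Y.strandObj s ◁ (Y.appendIso l' l).hom =
      ((α_ _ _ _).hom ≫ X.strandObj s ◁ (X.appendIso l' l).hom) ≫
        (strandMap u s ⊗ₘ tensorMap u (l ++ l'))
    rw [associator_naturality_assoc, Category.assoc, ← id_tensorHom, ← id_tensorHom,
      tensorHom_comp_tensorHom, tensorHom_comp_tensorHom, ih, Category.comp_id, Category.id_comp]

theorem wordIso_naturality (u : X.obj ⟶ Y.obj) (a : Fin n → G) (p : PTree (Fin n)) :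
    (p.functor D).map (X := X.twisted a) (Y := Y.twisted a) (fun i => (C.F (a i)).map (u i)) ≫
        (Y.wordIso a p).hom =
      (X.wordIso a p).hom ≫ tensorMap u (strands a p) := by
  induction p with
  | unit =>
    change 𝟙 (𝟙_ D) ≫ (ρ_ (𝟙_ D)).inv = (ρ_ (𝟙_ D)).inv ≫ (𝟙 (𝟙_ D) ⊗ₘ 𝟙 (𝟙_ D))
    simp
  | leaf i =>
    change (C.F (a i)).map (u i) ≫ (ρ_ _).inv = (ρ_ _).inv ≫ ((C.F (a i)).map (u i) ⊗ₘ 𝟙 (𝟙_ D))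
    simp
  | node l r hl hr =>
    change (((l.functor D).map _) ⊗ₘ ((r.functor D).map _)) ≫
        ((Y.wordIso a l).hom ⊗ₘ (Y.wordIso a r).hom) ≫ (Y.appendIso _ _).hom =
      (((X.wordIso a l).hom ⊗ₘ (X.wordIso a r).hom) ≫ (X.appendIso _ _).hom) ≫
        tensorMap u (strands a l ++ strands a r)
    rw [tensorHom_comp_tensorHom_assoc, hl, hr, ← tensorHom_comp_tensorHom, Category.assoc,
      Category.assoc, appendIso_naturality]

theorem BraidActs.cast {L : ℕ} {A : BraidGroup L} {l l₁ l₂ : List (Strand G n)}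
    {f : X.tensor l ⟶ X.tensor l₁} (H : X.BraidActs A l l₁ f) (h : l₁ = l₂) :
    X.BraidActs A l l₂ (f ≫ eqToHom (congrArg X.tensor h)) := by
  subst h
  simpa using H

theorem BraidActs.isIso {L : ℕ} {A : BraidGroup L} {l l' : List (Strand G n)}
    {f : X.tensor l ⟶ X.tensor l'} (H : X.BraidActs A l l' f) : IsIso f := by
  induction H <;> infer_instance

/-- On the letters, a crossing is a transposition. -/
theorem rearr_cross (Z : C.Family n) {j : ℕ} {l : List (Strand G n)} (h : j + 1 < l.length) :
    Rearr (Equiv.swap j (j + 1)) ((Z.cross j l).map (Option.map Prod.snd))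
      (l.map (Option.map Prod.snd)) := by
  have key : ∀ (P Q : List (Strand G n)) (s t : Strand G n),
      Z.cross P.length (P ++ s :: t :: Q) = P ++ actStrand (Z.strandDeg s) t :: s :: Q := by
    intro P Q s t
    induction P with
    | nil => rfl
    | cons r P ih => exact congrArg (r :: ·) ih
  obtain ⟨P, Q, s, t, rfl, rfl⟩ : ∃ P Q s t, P.length = j ∧ l = P ++ s :: t :: Q :=
    ⟨l.take j, l.drop (j + 2), l[j], l[j + 1], by simp; omega, by simp⟩
  have e : ∀ b : G, Option.map Prod.snd (actStrand b t) = Option.map Prod.snd t := by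
    intro b
    cases t <;> rfl
  rw [key]
  simp only [List.map_append, List.map_cons, e]
  exact Rearr.swap _ _ (by simp)

/-- Every braid acts on every list of strands. The resulting strands depend on the degrees of the
objects only, not on the objects, and the action is natural in the objects. -/
theorem exists_braidActs (Z : C.Family n) {L : ℕ} (A : BraidGroup L) {l : List (Strand G n)}
    (hl : l.length = L) :
    ∃ l' : List (Strand G n), l'.length = L ∧
      Rearr (natPerm L A) (l'.map (Option.map Prod.snd)) (l.map (Option.map Prod.snd)) ∧
      ∃ f : ∀ X : C.Family n, X.g = Z.g → (X.tensor l ⟶ X.tensor l'),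
        (∀ (X : C.Family n) (hX : X.g = Z.g), X.BraidActs A l l' (f X hX)) ∧
        ∀ (X Y : C.Family n) (hX : X.g = Z.g) (hY : Y.g = Z.g) (u : X.obj ⟶ Y.obj),
          tensorMap u l ≫ f Y hY = f X hX ≫ tensorMap u l' := by
  induction A using braid_induction_left with
  | one =>
    refine ⟨l, hl, ?_, fun X _ => 𝟙 _, fun X _ => .one l, fun X Y _ _ u => by simp⟩
    rw [map_one]
    exact Rearr.one _
  | mul j A hj ih =>
    obtain ⟨l', hl', hr, f, hf, hn⟩ := ih
    refine ⟨Z.cross j l', (Z.length_cross _ _).trans hl', ?_,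
      fun X hX => (f X hX ≫ (X.crossIso j l').hom) ≫
        eqToHom (congrArg X.tensor (X.cross_congr hX j l')),
      fun X hX => ((hf X hX).mul hj).cast (X.cross_congr hX j l'), fun X Y hX hY u => ?_⟩
    · rw [map_mul, natPerm_sig hj]
      exact (rearr_cross Z (by omega)).mul hr
    · have e := crossIso_naturality u (hX.trans hY.symm) j l'
        ((Y.cross_congr hY j l').trans (X.cross_congr hX j l').symm)
      have e' := tensorMap_eqToHom u (X.cross_congr hX j l')
      simp only [Category.assoc]
      rw [reassoc_of% (hn X Y hX hY u), ← e', ← reassoc_of% e, eqToHom_trans]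
  | inv_mul j A hj ih =>
    obtain ⟨l', hl', hr, f, hf, hn⟩ := ih
    have hc (X : C.Family n) (hX : X.g = Z.g) : l' = X.cross j (Z.uncross j l') :=
      ((X.cross_congr hX j _).trans (Z.cross_uncross j l')).symm
    have hlen : (Z.uncross j l').length = L := by
      rw [← Z.length_cross j, Z.cross_uncross, hl']
    refine ⟨Z.uncross j l', hlen, ?_,
      fun X hX => (f X hX ≫ eqToHom (congrArg X.tensor (hc X hX))) ≫
        (X.crossIso j (Z.uncross j l')).inv,
      fun X hX => ((hf X hX).cast (hc X hX)).inv_mul hj, fun X Y hX hY u => ?_⟩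
    · have := rearr_cross Z (j := j) (l := Z.uncross j l') (by omega)
      rw [Z.cross_uncross] at this
      rw [map_mul, map_inv, natPerm_sig hj]
      exact this.inv.mul hr
    · have e := crossIso_naturality u (hX.trans hY.symm) j (Z.uncross j l')
        ((hc Y hY).symm.trans (hc X hX))
      have e' := tensorMap_eqToHom u (hc X hX)
      rw [← Category.assoc, Iso.comp_inv_eq]
      simp only [Category.assoc]
      rw [reassoc_of% (hn X Y hX hY u), ← cancel_mono (eqToHom (congrArg Y.tensor
        ((hc Y hY).symm.trans (hc X hX))))]
      simp only [Category.assoc, eqToHom_trans]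
      rw [e', e, Iso.inv_hom_id_assoc]

end Family

/-- A list of strands in which every `x_i` occurs at most once consists of the strands of a word. -/
theorem exists_strands_eq {p : PTree (Fin n)} (hp : p.vars.Nodup) {l : List (Strand G n)}
    (hl : l.map (Option.map Prod.snd) = p.leaves) : ∃ a : Fin n → G, l = strands a p := by
  rw [PTree.vars, ← hl] at hp
  simp only [strands_eq, ← hl]
  clear hl
  induction l with
  | nil => exact ⟨1, rfl⟩
  | cons s l ih =>
    cases s with
    | none =>
      obtain ⟨a, ha⟩ := ih hp
      exact ⟨a, by simpa using ha⟩
    | some s =>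
      obtain ⟨b, i⟩ := s
      simp only [List.map_cons, Option.map_some, List.reduceOption_cons_of_some,
        List.nodup_cons] at hp
      obtain ⟨a, ha⟩ := ih hp.2
      refine ⟨Function.update a i b, ?_⟩
      simp only [List.map_cons, Option.map_some, Function.update_self]
      congr 1
      refine ha.trans (List.map_congr_left fun o ho => ?_)
      cases o with
      | none => rfl
      | some j =>
        have : j ≠ i := fun e => hp.1 (List.reduceOption_mem_iff.2 (e ▸ ho))
        simp [Function.update_of_ne this]

end BraidedGCrossed

end WeakBraid

/-! ### Twisting -/

namespace WeakBraid

/-- The unwinding of `x` is unique. -/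
theorem eq_unwind {n : ℕ} {q : Omega n} {x : WPaB n} (h : BraidedGCrossed.IsUnwinding q x) :
    q = x.unwind := by
  refine Omega.eq_of_tree (PTree.eq_of_shape_leaves (h.1.trans x.shape_unwind.symm) ?_)
  rw [x.leaves_unwind]
  have hl : q.tree.leaves.length = x.len :=
    (PTree.length_leaves_of_shape h.1).trans x.length_leaves
  refine List.ext_getElem? fun a => ?_
  rcases Nat.lt_or_ge a x.len with ha | ha
  · rw [x.rearr_source a, ← val_perm x.braid ⟨a, ha⟩]
    exact h.2 ⟨a, ha⟩
  · rw [List.getElem?_eq_none (by omega), List.getElem?_eq_none (by rw [x.length_source]; exact ha)]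

theorem nonempty_unwind_hom {n : ℕ} (x : WPaB n) : Nonempty (WPaB.ofWord x.unwind ⟶ x) := by
  rw [WPaB.nonempty_hom_iff, WPaB.source_ofWord, x.leaves_unwind]

/-- The morphism `(p', 1) ⟶ (p, A)`, where `p'` is the unwinding of `(p, A)`. -/
noncomputable def unwindIso {n : ℕ} (x : WPaB n) : WPaB.ofWord x.unwind ≅ x where
  hom := (nonempty_unwind_hom x).some
  inv := (WPaB.nonempty_hom_iff.2 (WPaB.nonempty_hom_iff.1 (nonempty_unwind_hom x)).symm).some
  hom_inv_id := Subsingleton.elim _ _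
  inv_hom_id := Subsingleton.elim _ _

namespace BraidedGCrossed

open MonoidalCategory
open scoped ZeroObject

variable {G : Type w} [Group G] {D : Type u} [Category.{v} D] [Abelian D] [MonoidalCategory D]
  (C : BraidedGCrossed G D) {n : ℕ}

/-- The twists of the strands at the end of a braid, and the action of the braid on objects of given
degrees. -/
theorem exists_twist (x : WPaB n) (g : Fin n → G) :
    ∃ (a : Fin n → G) (f : ∀ X : C.Family n, X.g = g →
        (X.tensor (strands (fun _ => 1) x.unwind.tree) ⟶ X.tensor (strands a x.word.tree))),
      (∀ (X : C.Family n) (hX : X.g = g), X.BraidActs x.braid _ _ (f X hX)) ∧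
      ∀ (X Y : C.Family n) (hX : X.g = g) (hY : Y.g = g) (u : X.obj ⟶ Y.obj),
        Family.tensorMap u _ ≫ f Y hY = f X hX ≫ Family.tensorMap u _ := by
  -- The zero object has every degree, so there is a family of objects of the degrees `g`.
  let Z : C.Family n :=
    ⟨g, fun _ => (0 : D), fun i => C.deg_zero (g i) (Limits.isZero_zero D)⟩
  have hs := map_snd_strands (fun _ => (1 : G)) x.unwind.tree
  have hl : (strands (fun _ => (1 : G)) x.unwind.tree).length = x.len := by
    rw [← List.length_map (Option.map Prod.snd), hs, x.leaves_unwind, x.length_source]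
  obtain ⟨l', -, hr, f, hf, hn⟩ := Family.exists_braidActs Z x.braid hl
  rw [hs, x.leaves_unwind] at hr
  have e : l'.map (Option.map Prod.snd) = x.word.tree.leaves := hr.inv.eq x.rearr_source.inv
  obtain ⟨a, rfl⟩ := exists_strands_eq x.word.nodup e
  exact ⟨a, f, hf, hn⟩

/-- The twists at the end of a braid. -/
noncomputable def twist (x : WPaB n) (g : Fin n → G) : Fin n → G :=
  (C.exists_twist x g).choose

variable {C}

/-- The action of the braid of `x` on the tensor product of the objects of a family. -/
noncomputable def Family.act (X : C.Family n) (x : WPaB n) :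
    X.tensor (strands (fun _ => 1) x.unwind.tree) ⟶
      X.tensor (strands (C.twist x X.g) x.word.tree) :=
  (C.exists_twist x X.g).choose_spec.choose X rfl

theorem Family.braidActs_act (X : C.Family n) (x : WPaB n) :
    X.BraidActs x.braid _ _ (X.act x) :=
  (C.exists_twist x X.g).choose_spec.choose_spec.1 X rfl

instance (X : C.Family n) (x : WPaB n) : IsIso (X.act x) := (X.braidActs_act x).isIso

theorem Family.act_naturality {g : Fin n → G} {X Y : Fin n → D} (hX : ∀ i, C.deg (g i) (X i))
    (hY : ∀ i, C.deg (g i) (Y i)) (u : X ⟶ Y) (x : WPaB n) :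
    tensorMap (X := ⟨g, X, hX⟩) (Y := ⟨g, Y, hY⟩) u _ ≫ Family.act ⟨g, Y, hY⟩ x =
      Family.act ⟨g, X, hX⟩ x ≫ tensorMap (X := ⟨g, X, hX⟩) (Y := ⟨g, Y, hY⟩) u _ :=
  (C.exists_twist x g).choose_spec.choose_spec.2 ⟨g, X, hX⟩ ⟨g, Y, hY⟩ rfl rfl u

/-- The isomorphisms `F 1 (X_i) ≅ X_i` inside a word. -/
noncomputable def Family.untwist (X : C.Family n) (p : PTree (Fin n)) :
    (p.functor D).obj (X.twisted fun _ => 1) ≅ (p.functor D).obj X.obj :=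
  (p.functor D).mapIso (Pi.isoMk fun i => C.oneIso.app (X.obj i))

/-- The twisted tensor product of `x` is identified with a tensor product of twisted objects by
undoing the coherence isomorphism from the unwound word, and letting the braid act through the
`G`-braiding instead. -/
noncomputable def Family.theta (X : C.Family n) (x : WPaB n) :
    (((weakBraiding D).φ n).obj x).obj X.obj ≅
      (x.word.tree.functor D).obj (X.twisted (C.twist x X.g)) :=
  (((weakBraiding D).φ n).mapIso (unwindIso x)).symm.app X.obj ≪≫
    eqToIso (Functor.congr_obj (weakBraiding_obj_ofWord x.unwind) X.obj) ≪≫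
      (X.untwist x.unwind.tree).symm ≪≫ X.wordIso (fun _ => 1) x.unwind.tree ≪≫
        asIso (X.act x) ≪≫ (X.wordIso (C.twist x X.g) x.word.tree).symm

theorem weakBraiding_actsByTwisting :
    C.ActsByTwisting (weakBraiding D) weakBraiding_extendsMonoidal := by
  refine ⟨fun x g => C.twist x g, fun x X => X.theta x, fun x g X Y hX hY u => ?_,
    fun {n} x X q hq => ?_⟩
  · have e {H K : (Fin _ → D) ⥤ D} (h : H = K) : CommSq (eqToHom (Functor.congr_obj h X))
        (H.map u) (K.map u) (eqToHom (Functor.congr_obj h Y)) := by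
      subst h
      exact ⟨by simp⟩
    have h1 : CommSq ((((weakBraiding D).φ _).map (unwindIso x).inv).app X)
        ((((weakBraiding D).φ _).obj x).map u) _
        ((((weakBraiding D).φ _).map (unwindIso x).inv).app Y) :=
      ⟨(NatTrans.naturality _ u).symm⟩
    have h2 : CommSq (Family.untwist (C := C) ⟨g, X, hX⟩ x.unwind.tree).hom
        ((x.unwind.tree.functor D).map fun i => (C.F 1).map (u i))
        ((x.unwind.tree.functor D).map u)
        (Family.untwist (C := C) ⟨g, Y, hY⟩ x.unwind.tree).hom := by
      refine ⟨((x.unwind.tree.functor D).map_comp _ _).symm.trans (Eq.trans ?_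
        ((x.unwind.tree.functor D).map_comp _ _))⟩
      exact congrArg _ (funext fun i => (C.oneIso.hom.naturality (u i)).symm)
    have h3 (a : Fin _ → G) (p : PTree (Fin _)) :
        CommSq (Family.wordIso (C := C) ⟨g, X, hX⟩ a p).hom
          ((p.functor D).map fun i => (C.F (a i)).map (u i)) _
          (Family.wordIso (C := C) ⟨g, Y, hY⟩ a p).hom :=
      ⟨(Family.wordIso_naturality (X := ⟨g, X, hX⟩) (Y := ⟨g, Y, hY⟩) u a p).symm⟩
    have h4 := CommSq.mk (Family.act_naturality hX hY u x).symm
    exact (h1.horiz_comp ((e (weakBraiding_obj_ofWord x.unwind)).horiz_comp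
      (h2.horiz_inv.horiz_comp ((h3 _ _).horiz_comp
        (h4.horiz_comp (h3 _ _).horiz_inv))))).w.symm
  · obtain rfl := eq_unwind hq
    refine ⟨(unwindIso x).hom, X.act x, ?_, X.braidActs_act x, fun l' f' hf' => ?_⟩
    · have h1 : (((weakBraiding D).φ n).map (unwindIso x).hom).app X.obj ≫
          (((weakBraiding D).φ n).map (unwindIso x).inv).app X.obj = 𝟙 _ :=
        (((weakBraiding D).φ n).mapIso (unwindIso x)).hom_inv_id_app X.obj
      have h2 : (x.unwind.tree.functor D).map (fun i => C.oneIso.hom.app (X.obj i)) ≫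
          (X.untwist x.unwind.tree).inv = 𝟙 _ := (X.untwist x.unwind.tree).hom_inv_id
      have e : (X.theta x).hom = (((weakBraiding D).φ n).map (unwindIso x).inv).app X.obj ≫
        eqToHom (Functor.congr_obj (weakBraiding_obj_ofWord x.unwind) X.obj) ≫
        (X.untwist x.unwind.tree).inv ≫ (X.wordIso (fun _ => 1) x.unwind.tree).hom ≫
        X.act x ≫ (X.wordIso (C.twist x X.g) x.word.tree).inv := rfl
      rw [e]
      simp only [Category.assoc, Iso.inv_hom_id, Category.comp_id]
      rw [reassoc_of% h1, eqToHom_trans_assoc, eqToHom_refl, Category.id_comp, reassoc_of% h2]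
    · refine Family.BraidActs.unique hf' (X.braidActs_act x) ?_
      rw [← List.length_map (Option.map Prod.snd), map_snd_strands, x.leaves_unwind,
        x.length_source]

end BraidedGCrossed

end WeakBraid

open CategoryTheory WeakBraid in
theorem theorem5 {k : Type w} [Field k] {G : Type w'} [Group G] {D : Type u} [Category.{v} D]
    [Abelian D] [Linear k D] [MonoidalCategory D] [MonoidalPreadditive D] [MonoidalLinear k D]
    [RigidCategory D] [FusionCategory k D] (C : BraidedGCrossed G D) :
    ∃ (W : WeakBraiding D) (hW : W.ExtendsMonoidal),
      (∀ (n : ℕ) (x : WPaB n), IsMultiadditive ((W.φ n).obj x)) ∧ C.ActsByTwisting W hW :=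
  ⟨weakBraiding D, weakBraiding_extendsMonoidal, fun _ x => weakBraiding_isMultiadditive x,
    BraidedGCrossed.weakBraiding_actsByTwisting⟩
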